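/- Let $p\ge 0$ and let $\mathcal C_p$ be the space of all $p\times p$ positive semi-definite correlation matrices with its usual topology. For $C\in\mathcal C_p$ and CDFs $F_1,\dots,F_p$ on $\mathbb R$, let $G_{C,F_1,\dots,F_p}$ be the Gaussian copula distribution, i.e. the law of $Y=(F_1^{-1}\{\Phi(z_1)\},\dots,F_p^{-1}\{\Phi(z_p)\})$ with $z\sim N_p(0,C)$, where $\Phi$ is the standard normal CDF and $F_j^{-1}(u)=\inf\{x: u\le F_j(x)\}$. Let $F_1,\dots,F_p$ be CDFs, none of which is the CDF of a point mass (otherwise arbitrary: discrete, continuous or mixed). Let $p(r\mid y)$, $r\in\{0,1\}^p$, $y\in\mathbb R^p$, be a missingness mechanism ($r_j=1$ means that the $j$-th coordinate is missing) which is ignorable: it does not involve the copula parameter, and it is missing-at-random, i.e. $p(r\mid y)$ depends on $y$ only through the observed coordinates $(y_j: r_j=0)$. Given $C_0$, let $(Y_i,R_i)$, $i=1,2,\dots$, be i.i.d. with $Y_i\sim G_{C_0,F_1,\dots,F_p}$ and $R_i\mid Y_i\sim p(\cdot\mid Y_i)$. Let $\Pi$ be a prior probability distribution on $\mathcal C_p$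 with density $\pi$ with respect to a Borel measure $\nu$ on $\mathcal C_p$, and suppose $\pi>0$ $\nu$-almost everywhere. Let $\mathcal D(Y_n^{obs})$ be the event that the latent values satisfy $z_{ij}<z_{kj}$ for all $j\le p$ and all $i,k\le n$ with $Y_{ij},Y_{kj}$ both observed and $Y_{ij}<Y_{kj}$. The extended rank-likelihood posterior is $$\Pi\{C\in A\mid Z_n^{obs}\in\mathcal D(Y_n^{obs})\}=\frac{\int_A P_C\{Z_n^{obs}\in\mathcal D(Y_n^{obs})\}\,d\Pi(C)}{\int P_C\{Z_n^{obs}\in\mathcal D(Y_n^{obs})\}\,d\Pi(C)},$$ where under $P_C$ the rows $Z_1,\dots,Z_n$ are i.i.d. $N_p(0,C)$, the data and the missingness patterns are held fixed, and the latent values at missing entries are integrated out. Then for $\nu$-almost every $C_0$ for which complete cases are possible at almost every data value, i.e. $p((0,\dots,0)\mid y)>0$ for $G_{C_0,F_1,\dots,F_p}$-almost every $y$, and for every neighbourhood $\mathcal A$ of $C_0$, $$\lim_{n\to\infty}\Pi\{C\in\mathcal A\mid Z_n^{obs}\in\mathcal D(Y_n^{obs})\}=1$$ almost surely under the law of $(Y_i,R_i)_{i\ge1}$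 with parameter $C_0$. -/

import Mathlib

open MeasureTheory ProbabilityTheory Filter Topology

noncomputable section

/-- The space of all `p × p` (real, positive semi-definite) correlation matrices. -/
def CorrelationMatrix (p : ℕ) : Type :=
  {C : Matrix (Fin p) (Fin p) ℝ // C.PosSemidef ∧ ∀ j, C j j = 1}

/-- The topology of entrywise convergence. -/
instance (p : ℕ) : TopologicalSpace (CorrelationMatrix p) :=
  inferInstanceAs (TopologicalSpace
    {C : Matrix (Fin p) (Fin p) ℝ // C.PosSemidef ∧ ∀ j, C j j = 1})

instance (p : ℕ) : MeasurableSpace (CorrelationMatrix p) := borel _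

instance (p : ℕ) : BorelSpace (CorrelationMatrix p) := ⟨rfl⟩

/-- The law `N_p(0, C)` of one latent vector. -/
def latentLaw {p : ℕ} (C : CorrelationMatrix p) : Measure (EuclideanSpace ℝ (Fin p)) :=
  multivariateGaussian 0 C.1

instance {p : ℕ} (C : CorrelationMatrix p) : IsProbabilityMeasure (latentLaw C) := by
  unfold latentLaw; infer_instance

/-- The quantile function (generalized inverse of the CDF) `F⁻¹(u) = inf {x | u ≤ F x}` of a
probability measure on `ℝ` with CDF `F`; it is meaningful for `0 < u < 1`. -/
def quantile (μ : Measure ℝ) (u : ℝ) : ℝ := sInf {x : ℝ | u ≤ cdf μ x}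

/-- The standard normal CDF. -/
def stdNormalCDF (z : ℝ) : ℝ := cdf (gaussianReal 0 1) z

/-- The map `z ↦ (F_j⁻¹(Φ(z_j)))_j` from the latent scale to the observed scale. -/
def copulaLink {p : ℕ} (F : Fin p → Measure ℝ) (z : EuclideanSpace ℝ (Fin p)) : Fin p → ℝ :=
  fun j => quantile (F j) (stdNormalCDF (z j))

/-- The distribution `G_{C, F_1, …, F_p}` of one data vector: the Gaussian copula with correlation
matrix `C` and margins `F_1, …, F_p`. -/
def gaussianCopula {p : ℕ} (C : CorrelationMatrix p) (F : Fin p → Measure ℝ) :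
    Measure (Fin p → ℝ) :=
  (latentLaw C).map (copulaLink F)

theorem stdNormalCDF_pos (z : ℝ) : 0 < stdNormalCDF z := by
  unfold stdNormalCDF
  rw [cdf_eq_real, measureReal_def, ENNReal.toReal_pos_iff]
  refine ⟨?_, measure_lt_top _ _⟩
  rw [pos_iff_ne_zero]
  intro h
  have h2 := gaussianReal_absolutelyContinuous' 0 (one_ne_zero : (1 : NNReal) ≠ 0) h
  simp at h2

theorem stdNormalCDF_lt_one (z : ℝ) : stdNormalCDF z < 1 := by
  unfold stdNormalCDF
  have h1 : 0 < gaussianReal 0 1 (Set.Iic z)ᶜ := by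
    rw [pos_iff_ne_zero]
    intro h
    have h2 := gaussianReal_absolutelyContinuous' 0 (one_ne_zero : (1 : NNReal) ≠ 0) h
    simp at h2
  have h2 := probReal_compl_eq_one_sub (μ := gaussianReal 0 1) (measurableSet_Iic (a := z))
  rw [cdf_eq_real]
  have h3 : 0 < (gaussianReal 0 1).real (Set.Iic z)ᶜ := by
    rw [measureReal_def]; exact ENNReal.toReal_pos h1.ne' (measure_ne_top _ _)
  linarith

theorem quantile_le_iff (μ : Measure ℝ) {u : ℝ} (h0 : 0 < u) (h1 : u < 1) (x : ℝ) :
    quantile μ u ≤ x ↔ u ≤ cdf μ x := by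
  have hne : {x : ℝ | u ≤ cdf μ x}.Nonempty := by
    obtain ⟨y, hy⟩ := ((tendsto_cdf_atTop μ).eventually (lt_mem_nhds h1)).exists
    exact ⟨y, hy.le⟩
  have hbd : BddBelow {x : ℝ | u ≤ cdf μ x} := by
    obtain ⟨y, hy⟩ := ((tendsto_cdf_atBot μ).eventually (gt_mem_nhds h0)).exists
    refine ⟨y, fun t ht => ?_⟩
    by_contra hlt
    exact absurd (ht.trans (monotone_cdf μ (not_le.1 hlt).le)) (not_le.2 hy)
  refine ⟨fun h => ?_, fun h => csInf_le hbd h⟩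
  have ht : Tendsto (fun t => cdf μ t) (𝓝[>] x) (𝓝 (cdf μ x)) :=
    ((cdf μ).right_continuous x).mono_left (nhdsWithin_mono _ Set.Ioi_subset_Ici_self)
  refine ge_of_tendsto ht ?_
  filter_upwards [self_mem_nhdsWithin] with t ht
  obtain ⟨s, hs, hst⟩ := exists_lt_of_csInf_lt hne (lt_of_le_of_lt h ht)
  exact le_trans hs (monotone_cdf μ hst.le)

theorem measurable_copulaLink {p : ℕ} (F : Fin p → Measure ℝ) : Measurable (copulaLink F) := by
  refine measurable_pi_lambda _ fun j => ?_
  have hmono : Monotone fun t : ℝ => quantile (F j) (stdNormalCDF t) := fun a b hab =>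
    (quantile_le_iff _ (stdNormalCDF_pos a) (stdNormalCDF_lt_one a) _).2 <|
      (monotone_cdf (gaussianReal 0 1) hab).trans <|
        (quantile_le_iff _ (stdNormalCDF_pos b) (stdNormalCDF_lt_one b) _).1 le_rfl
  exact hmono.measurable.comp (by fun_prop)

instance {p : ℕ} (C : CorrelationMatrix p) (F : Fin p → Measure ℝ) :
    IsProbabilityMeasure (gaussianCopula C F) :=
  Measure.isProbabilityMeasure_map (measurable_copulaLink F).aemeasurable

/-- A missingness pattern of one data vector: `r j = true` means that coordinate `j` is missing,
`r j = false` that it is observed. -/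
abbrev Pattern (p : ℕ) : Type := Fin p → Bool

/-- A missingness mechanism `κ`, i.e. the conditional law `p(r ∣ y)` of the pattern given the full
data vector, is missing-at-random if `p(r ∣ y)` depends on `y` only through the coordinates which
`r` declares observed. -/
def MissingAtRandom {p : ℕ} (κ : Kernel (Fin p → ℝ) (Pattern p)) : Prop :=
  ∀ (r : Pattern p) (y y' : Fin p → ℝ), (∀ j, r j = false → y j = y' j) → κ y {r} = κ y' {r}

/-- The law of the infinite sequence `(Y_i, R_i)`, `i = 0, 1, 2, …`, of i.i.d. pairs of a full data
vector `Y_i ∼ G_{C, F_1, …, F_p}` and its missingness pattern `R_i ∣ Y_i ∼ κ(Y_i)`. -/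
def dataLaw {p : ℕ} (C : CorrelationMatrix p) (F : Fin p → Measure ℝ)
    (κ : Kernel (Fin p → ℝ) (Pattern p)) : Measure (ℕ → (Fin p → ℝ) × Pattern p) :=
  Measure.infinitePi fun _ => (gaussianCopula C F) ⊗ₘ κ

/-- The event `𝒟(Y_n^obs)`: the latent values at the observed entries of the first `n` rows respect,
in each column, the ordering of the observed data. Neither the latent values nor the data at missing
entries play a role. -/
def rankEvent {p : ℕ} (n : ℕ) (ω : ℕ → (Fin p → ℝ) × Pattern p) :
    Set (Fin n → EuclideanSpace ℝ (Fin p)) :=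
  {z | ∀ (j : Fin p) (i k : Fin n), (ω i).2 j = false → (ω k).2 j = false →
    (ω i).1 j < (ω k).1 j → z i j < z k j}

/-- The extended rank-likelihood `p(Z_n^obs ∈ 𝒟(Y_n^obs) ∣ C)`, with the rows of `Z` i.i.d.
`N_p(0, C)` and the latent values at missing entries integrated out. -/
def rankLikelihood {p : ℕ} (n : ℕ) (ω : ℕ → (Fin p → ℝ) × Pattern p)
    (C : CorrelationMatrix p) : ENNReal :=
  Measure.pi (fun _ : Fin n => latentLaw C) (rankEvent n ω)

/-- The extended rank-likelihood posterior `Π(· ∣ Z_n^obs ∈ 𝒟(Y_n^obs))` of the correlation matrix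
under the prior `Π`: the normalization of `p(Z_n^obs ∈ 𝒟(Y_n^obs) ∣ C) Π(dC)`. -/
def rankPosterior {p : ℕ} (prior : Measure (CorrelationMatrix p)) (n : ℕ)
    (ω : ℕ → (Fin p → ℝ) × Pattern p) : Measure (CorrelationMatrix p) :=
  (∫⁻ C, rankLikelihood n ω C ∂prior)⁻¹ • prior.withDensity (rankLikelihood n ω)

end

/-!
The posterior is consistent because the rank likelihood of a wrong correlation matrix `C`, averaged
over all data sets of the kind that occur under the truth, is exponentially small, while the
likelihood near the true matrix `C₀`, averaged over the prior, is not. No density with respect to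
the unknown margins is available, so the argument runs on the finite space of rank structures
(`RankData`): missingness patterns, grid cells of the observed entries, and their columnwise orders.

*Identification.* Each margin is not a point mass and so has a threshold that corresponds to a finite
threshold on the latent scale (`exists_threshold`). The bivariate normal orthant probability at these
thresholds is strictly increasing in the correlation (`orthant_strictMono`), so a wrong entry of `C`
changes it by at least a fixed amount (`exists_orthant_gap`).

*Missingness.* A missing-at-random mechanism can be replaced by a mechanism `kh` depending only on
the cells of the observed entries, with total mass at most `1 + ε`, at the cost of factors
`exp (ε n)` (`MissingAtRandom.exists_grid_mechanism`). Summing over the patterns `r` with the cells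
held fixed is then possible, and complete cases, weighted by the inverse of `kh`, reveal the
proportions of the cells by Chernoff's bound (`sum_patternWeight_enoughCases_le`).

*Wrong matrices.* For fixed latent values, a compatible rank structure is given by cells that are
monotone in the latent values, the patterns, and the places of ties (`exists_decodeRankData_eq`).
There are polynomially many monotone cells (`card_monotoneCells_le`), and subexponentially many
placements of the ties (`exists_card_smallTieSets_le`), since repeated values are atoms
(`ae_eventually_card_repeated_le`). If the latent values are typical for a wrong `C`, monotone cells
have wrong proportions in some quadrant (`exists_quadrant_card_le`), contradicting what the complete
cases show. This gives `sum_patternWeight_mul_likelihood_le`.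

*The truth.* Latent samples of size `n` for matrices within `(n + 1)⁻¹¹` of each other can be coupled
so that all ranks agree up to a summable probability (`stdGaussian_order_ne_le`); hence probabilities
of rank structures under the truth are bounded by sums of likelihoods at any such matrix
(`pi_rankData_mem_le`). Cells of that mesh have polynomially small, hence sufficient, prior mass at
almost every `C₀` (`ae_eventually_le_measure_correlationCell`); this is the only place where an
exceptional null set of true matrices arises.

Averaging the last two bounds over the prior and applying the Borel–Cantelli lemma yields
`ae_eventually_averagedLikelihood_lt`, one entry of the matrix at a time, and thereby the theorem.
-/

open scoped ENNReal NNReal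

/-! ### Independent rows -/

theorem lintegral_pi_prod {α : Type*} [MeasurableSpace α] (μ : Measure α) [IsProbabilityMeasure μ]
    {n : ℕ} (f : Fin n → α → ℝ≥0∞) (hf : ∀ i, Measurable (f i)) :
    ∫⁻ x, ∏ i, f i (x i) ∂(Measure.pi fun _ : Fin n => μ) = ∏ i, ∫⁻ a, f i a ∂μ := by
  have hind : iIndepFun (fun i (x : Fin n → α) => f i (x i)) (Measure.pi fun _ : Fin n => μ) :=
    iIndepFun_pi fun i => (hf i).aemeasurable
  rw [lintegral_prod_eq_prod_lintegral_of_indepFun Finset.univ _ hind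
    fun i => (hf i).comp (measurable_pi_apply i)]
  refine Finset.prod_congr rfl fun i _ => ?_
  exact (measurePreserving_eval (fun _ : Fin n => μ) i).lintegral_comp (hf i)

/-- The first `n` terms of an i.i.d. sequence. -/
theorem map_infinitePi_fin {α : Type*} [MeasurableSpace α] (μ : Measure α) [IsProbabilityMeasure μ]
    (n : ℕ) :
    (Measure.infinitePi fun _ : ℕ => μ).map (fun ω (i : Fin n) => ω i)
      = Measure.pi fun _ : Fin n => μ := by
  rw [Measure.map_infinitePi_infinitePi_of_inj (P := fun _ : ℕ => μ) Fin.val_injective,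
    Measure.infinitePi_eq_pi]

/-- The law of `n` independent pairs `(y_i, r_i)`, with `r_i` drawn from the kernel `κ` at `y_i` and
taking finitely many values, disintegrated along the `y_i`. -/
theorem pi_compProd_apply {α β : Type*} [MeasurableSpace α] [MeasurableSpace β] [Fintype β]
    [MeasurableSingletonClass β]
    (μ : Measure α) [IsProbabilityMeasure μ] (κ : Kernel α β) [IsMarkovKernel κ] {n : ℕ}
    {A : Set (Fin n → α × β)} (hA : MeasurableSet A) :
    (Measure.pi fun _ : Fin n => μ ⊗ₘ κ) A
      = ∫⁻ y, ∑ r : Fin n → β, (∏ i, κ (y i) {r i}) *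
          A.indicator 1 (fun i => (y i, r i)) ∂(Measure.pi fun _ : Fin n => μ) := by
  classical
  have hκ : ∀ b : β, Measurable fun y => κ y {b} := fun b =>
    κ.measurable_coe (measurableSet_singleton b)
  have hpair : ∀ r : Fin n → β, Measurable fun (y : Fin n → α) (i : Fin n) => (y i, r i) :=
    fun r => by fun_prop
  have hprod : ∀ r : Fin n → β, Measurable fun y : Fin n → α => ∏ i, κ (y i) {r i} := fun r =>
    Finset.measurable_prod _ fun i _ => (hκ (r i)).comp (measurable_pi_apply i)
  set M : Measure (Fin n → α × β) := Measure.sum fun r : Fin n → β =>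
    ((Measure.pi fun _ : Fin n => μ).withDensity fun y => ∏ i, κ (y i) {r i}).map
      (fun y i => (y i, r i)) with hM
  have hMA : ∀ B : Set (Fin n → α × β), MeasurableSet B → M B
      = ∫⁻ y, ∑ r : Fin n → β, (∏ i, κ (y i) {r i}) *
          B.indicator 1 (fun i => (y i, r i)) ∂(Measure.pi fun _ : Fin n => μ) := by
    intro B hB
    rw [hM, Measure.sum_apply _ hB, tsum_fintype, lintegral_finsetSum]
    · refine Finset.sum_congr rfl fun r _ => ?_
      rw [Measure.map_apply (hpair r) hB, withDensity_apply _ (hpair r hB),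
        ← lintegral_indicator (hpair r hB)]
      refine lintegral_congr fun y => ?_
      by_cases h : (fun i => (y i, r i)) ∈ B
      · rw [Set.indicator_of_mem (show y ∈ (fun (y : Fin n → α) i => (y i, r i)) ⁻¹' B from h),
          Set.indicator_of_mem h]
        simp
      · rw [Set.indicator_of_notMem (show y ∉ (fun (y : Fin n → α) i => (y i, r i)) ⁻¹' B from h),
          Set.indicator_of_notMem h]
        simp
    · intro r _
      exact (hprod r).mul ((measurable_one.indicator hB).comp (hpair r))
  rw [← hMA A hA]
  congr 1
  -- the right-hand side is a measure in `A`, so boxes suffice, where everything factorizes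
  refine (Measure.pi_eq fun s hs => ?_)
  rw [hMA _ (MeasurableSet.univ_pi hs)]
  have h1 : ∀ y : Fin n → α, ∑ r : Fin n → β, (∏ i, κ (y i) {r i}) *
      (Set.univ.pi s).indicator 1 (fun i => (y i, r i))
      = ∏ i, ∑ b : β, κ (y i) {b} * (s i).indicator 1 (y i, b) := by
    intro y
    rw [Finset.prod_univ_sum, Fintype.piFinset_univ]
    refine Finset.sum_congr rfl fun r _ => ?_
    rw [Finset.prod_mul_distrib]
    congr 1
    by_cases h : ∀ i, (y i, r i) ∈ s i
    · rw [Set.indicator_of_mem (by simpa using h)]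
      simp [Set.indicator_of_mem (h _)]
    · rw [Set.indicator_of_notMem (by simpa using h)]
      push Not at h
      obtain ⟨i, hi⟩ := h
      exact (Finset.prod_eq_zero (Finset.mem_univ i) (Set.indicator_of_notMem hi _)).symm
  simp_rw [h1]
  rw [lintegral_pi_prod μ (fun i y => ∑ b : β, κ y {b} * (s i).indicator 1 (y, b))]
  · refine Finset.prod_congr rfl fun i _ => ?_
    rw [Measure.compProd_apply (hs i)]
    refine lintegral_congr fun y => ?_
    have : κ y (Prod.mk y ⁻¹' s i) = ∑ b ∈ Finset.univ.filter (fun b => (y, b) ∈ s i), κ y {b} := by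
      rw [sum_measure_singleton]
      congr 1
      ext b; simp
    rw [this, Finset.sum_filter]
    refine Finset.sum_congr rfl fun b _ => ?_
    by_cases h : (y, b) ∈ s i <;> simp [h]
  · intro i
    exact Finset.measurable_sum _ fun b _ => (hκ b).mul
      ((measurable_one.indicator (hs i)).comp (by fun_prop))

/-- The strong law of large numbers on the sequence space. -/
theorem strong_law_infinitePi {α : Type*} [MeasurableSpace α] (μ : Measure α)
    [IsProbabilityMeasure μ] {f : α → ℝ} (hf : Measurable f) (hint : Integrable f μ) :
    ∀ᵐ ω ∂(Measure.infinitePi fun _ : ℕ => μ),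
      Tendsto (fun n : ℕ => (∑ i : Fin n, f (ω i)) / n) atTop (𝓝 (∫ a, f a ∂μ)) := by
  have hev : ∀ i : ℕ, MeasurePreserving (fun ω : ℕ → α => ω i)
      (Measure.infinitePi fun _ : ℕ => μ) μ := fun i =>
    measurePreserving_eval_infinitePi (fun _ : ℕ => μ) i
  have hind : iIndepFun (fun (i : ℕ) (ω : ℕ → α) => f (ω i)) (Measure.infinitePi fun _ : ℕ => μ) :=
    iIndepFun_infinitePi (P := fun _ : ℕ => μ) (X := fun _ => f) fun _ => hf
  have h := strong_law_ae_real (μ := Measure.infinitePi fun _ : ℕ => μ)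
    (fun (i : ℕ) ω => f (ω i)) ((hev 0).integrable_comp_of_integrable hint)
    (fun i j hij => hind.indepFun hij) (fun i =>
      ⟨(hf.comp (hev i).measurable).aemeasurable, (hf.comp (hev 0).measurable).aemeasurable, by
        have := ((hev i).map_eq).trans ((hev 0).map_eq).symm
        rw [show (fun ω : ℕ → α => f (ω i)) = f ∘ fun ω => ω i from rfl,
          show (fun ω : ℕ → α => f (ω 0)) = f ∘ fun ω => ω 0 from rfl,
          ← Measure.map_map hf (hev i).measurable, this,
          Measure.map_map hf (hev 0).measurable]⟩)
  have h0 : ∫ ω, f (ω 0) ∂(Measure.infinitePi fun _ : ℕ => μ) = ∫ a, f a ∂μ := by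
    have := (hev 0).map_eq
    conv_rhs => rw [← this]
    rw [integral_map (hev 0).measurable.aemeasurable hf.aestronglyMeasurable]
  rw [h0] at h
  filter_upwards [h] with ω hω
  refine hω.congr fun n => ?_
  rw [Finset.sum_range]

/-- Hoeffding's inequality for the empirical frequency of an event. -/
theorem hoeffding_frequency {α : Type*} [MeasurableSpace α] (μ : Measure α)
    [IsProbabilityMeasure μ] {A : Set α} (hA : MeasurableSet A) {γ : ℝ} (hγ : 0 ≤ γ) (n : ℕ) :
    (Measure.pi fun _ : Fin n => μ)
      {z | n * γ ≤ |∑ i, A.indicator (1 : α → ℝ) (z i) - n * μ.real A|}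
      ≤ ENNReal.ofReal (2 * Real.exp (-(2 * γ ^ 2 * n))) := by
  set P := Measure.pi fun _ : Fin n => μ with hP
  have hf : Measurable (A.indicator (1 : α → ℝ)) := measurable_one.indicator hA
  have hmean : ∫ a, A.indicator (1 : α → ℝ) a ∂μ = μ.real A := integral_indicator_one hA
  have hsub : HasSubgaussianMGF (fun a => A.indicator (1 : α → ℝ) a - μ.real A)
      ((‖(1 : ℝ) - 0‖₊ / 2) ^ 2) μ := by
    have := hasSubgaussianMGF_of_mem_Icc (μ := μ) (X := A.indicator (1 : α → ℝ)) (a := 0) (b := 1)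
      hf.aemeasurable (ae_of_all _ fun a => by
        by_cases h : a ∈ A <;> simp [h])
    rwa [hmean] at this
  have key : ∀ g : α → ℝ, Measurable g → HasSubgaussianMGF g ((‖(1 : ℝ) - 0‖₊ / 2) ^ 2) μ →
      P.real {z | n * γ ≤ ∑ i, g (z i)} ≤ Real.exp (-(2 * γ ^ 2 * n)) := by
    intro g hg hgs
    have hind : iIndepFun (fun i (z : Fin n → α) => g (z i)) P :=
      iIndepFun_pi fun i => hg.aemeasurable
    have hs : ∀ i ∈ (Finset.univ : Finset (Fin n)),
        HasSubgaussianMGF (fun z : Fin n → α => g (z i)) ((‖(1 : ℝ) - 0‖₊ / 2) ^ 2) P := by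
      intro i _
      refine HasSubgaussianMGF.of_map (Y := fun z : Fin n → α => z i) (X := g)
        (measurable_pi_apply i).aemeasurable ?_
      rwa [(measurePreserving_eval (fun _ : Fin n => μ) i).map_eq]
    have := HasSubgaussianMGF.measure_sum_ge_le_of_iIndepFun hind hs (ε := n * γ) (by positivity)
    refine this.trans (Real.exp_le_exp.2 ?_)
    simp only [Finset.sum_const, Finset.card_univ, Fintype.card_fin, nsmul_eq_mul]
    push_cast
    simp only [sub_zero, norm_one]
    rcases Nat.eq_zero_or_pos n with hn | hn
    · simp [hn]
    · have : (0 : ℝ) < n := by exact_mod_cast hn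
      apply le_of_eq
      field_simp
  -- both tails
  have h1 := key _ (hf.sub_const _) hsub
  have h2 := key _ (hf.sub_const _).neg hsub.neg
  have hsum : ∀ z : Fin n → α, ∑ i, (A.indicator (1 : α → ℝ) (z i) - μ.real A)
      = ∑ i, A.indicator (1 : α → ℝ) (z i) - n * μ.real A := by
    intro z; simp [Finset.sum_sub_distrib]
  have hset : {z : Fin n → α | n * γ ≤ |∑ i, A.indicator (1 : α → ℝ) (z i) - n * μ.real A|}
      ⊆ {z | n * γ ≤ ∑ i, (A.indicator (1 : α → ℝ) (z i) - μ.real A)} ∪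
        {z | n * γ ≤ ∑ i, (-(fun a => A.indicator (1 : α → ℝ) a - μ.real A)) (z i)} := by
    intro z hz
    simp only [Set.mem_ofPred_eq, Set.mem_union, Pi.neg_apply, Finset.sum_neg_distrib, hsum] at hz ⊢
    exact le_abs.1 hz
  refine (measure_mono hset).trans ((measure_union_le _ _).trans ?_)
  rw [← ofReal_measureReal, ← ofReal_measureReal, ← ENNReal.ofReal_add measureReal_nonneg
    measureReal_nonneg]
  exact ENNReal.ofReal_le_ofReal (by linarith)

/-! ### The latent square root and the coupling of nearby latent laws -/

section MatrixSqrt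

open scoped MatrixOrder

/-- An eigenvalue `lam` of `√A - √B` satisfies `lam² ≤ |uᵀ(A - B)u|` for its unit eigenvectors `u`,
since `A - B = √A (√A - √B) + (√A - √B) √B` and both square roots are positive semi-definite. -/
theorem sq_eigenvalue_sqrt_sub_sqrt_le {p : ℕ} {A B : Matrix (Fin p) (Fin p) ℝ}
    (hA : A.PosSemidef) (hB : B.PosSemidef) {u : Fin p → ℝ} {lam : ℝ}
    (hu : (CFC.sqrt A - CFC.sqrt B).mulVec u = lam • u) (hu1 : u ⬝ᵥ u = 1) :
    lam ^ 2 ≤ |u ⬝ᵥ (A - B).mulVec u| := by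
  set S := CFC.sqrt A with hS
  set T := CFC.sqrt B with hT
  have hSp : S.PosSemidef := Matrix.nonneg_iff_posSemidef.1 (CFC.sqrt_nonneg A)
  have hTp : T.PosSemidef := Matrix.nonneg_iff_posSemidef.1 (CFC.sqrt_nonneg B)
  have hSS : S * S = A := CFC.sqrt_mul_sqrt_self A hA.nonneg
  have hTT : T * T = B := CFC.sqrt_mul_sqrt_self B hB.nonneg
  have ha : 0 ≤ u ⬝ᵥ S.mulVec u := by simpa using hSp.dotProduct_mulVec_nonneg u
  have hb : 0 ≤ u ⬝ᵥ T.mulVec u := by simpa using hTp.dotProduct_mulVec_nonneg u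
  have hsymm : ∀ v w : Fin p → ℝ, v ⬝ᵥ (S - T).mulVec w = (S - T).mulVec v ⬝ᵥ w := by
    intro v w
    have hST : (S - T).transpose = S - T := by
      have := (hSp.isHermitian.sub hTp.isHermitian).eq
      simpa using this
    rw [Matrix.dotProduct_mulVec, ← Matrix.mulVec_transpose, hST]
  have hlam : lam = u ⬝ᵥ S.mulVec u - u ⬝ᵥ T.mulVec u := by
    have : u ⬝ᵥ (S - T).mulVec u = lam := by rw [hu, dotProduct_smul, hu1]; simp
    rw [← this, Matrix.sub_mulVec, dotProduct_sub]
  have hAB : u ⬝ᵥ (A - B).mulVec u = lam * (u ⬝ᵥ S.mulVec u + u ⬝ᵥ T.mulVec u) := by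
    have h1 : A - B = S * (S - T) + (S - T) * T := by rw [← hSS, ← hTT]; noncomm_ring
    rw [h1, Matrix.add_mulVec, dotProduct_add, ← Matrix.mulVec_mulVec, ← Matrix.mulVec_mulVec, hu,
      hsymm, hu, Matrix.mulVec_smul, dotProduct_smul, smul_dotProduct]
    simp only [smul_eq_mul]
    ring
  rw [hAB, abs_mul, abs_of_nonneg (add_nonneg ha hb), ← sq_abs, pow_two]
  refine mul_le_mul_of_nonneg_left ?_ (abs_nonneg _)
  rw [hlam]
  exact abs_le.2 ⟨by linarith, by linarith⟩

/-- The matrix square root is Hölder continuous with exponent `1 / 2`, row by row. -/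
theorem sum_sq_sqrt_sub_sqrt_le {p : ℕ} {A B : Matrix (Fin p) (Fin p) ℝ}
    (hA : A.PosSemidef) (hB : B.PosSemidef) {ρ : ℝ} (hAB : ∀ i j, |A i j - B i j| ≤ ρ)
    (j : Fin p) :
    ∑ k, (CFC.sqrt A j k - CFC.sqrt B j k) ^ 2 ≤ p * ρ := by
  have hSp : (CFC.sqrt A).PosSemidef := Matrix.nonneg_iff_posSemidef.1 (CFC.sqrt_nonneg A)
  have hTp : (CFC.sqrt B).PosSemidef := Matrix.nonneg_iff_posSemidef.1 (CFC.sqrt_nonneg B)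
  have hρ : 0 ≤ ρ := (abs_nonneg _).trans (hAB j j)
  set D := CFC.sqrt A - CFC.sqrt B with hD
  have hDh : D.IsHermitian := hSp.isHermitian.sub hTp.isHermitian
  set b := hDh.eigenvectorBasis with hb
  have hbound : ∀ i, hDh.eigenvalues i ^ 2 ≤ p * ρ := by
    intro i
    set u : Fin p → ℝ := (b i).ofLp with hu
    have hu1 : u ⬝ᵥ u = 1 := by
      have h := b.orthonormal.1 i
      have h2 : ‖b i‖ ^ 2 = 1 := by rw [h]; norm_num
      rw [EuclideanSpace.real_norm_sq_eq] at h2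
      rw [← h2]
      simp [dotProduct, hu, pow_two]
    refine (sq_eigenvalue_sqrt_sub_sqrt_le hA hB (hDh.mulVec_eigenvectorBasis i) hu1).trans ?_
    have h1 : |u ⬝ᵥ (A - B).mulVec u| ≤ ∑ k, |u k| * ∑ l, ρ * |u l| := by
      refine (Finset.abs_sum_le_sum_abs (fun k => u k * (A - B).mulVec u k) Finset.univ).trans
        (Finset.sum_le_sum fun k _ => ?_)
      rw [abs_mul]
      refine mul_le_mul_of_nonneg_left ?_ (abs_nonneg _)
      refine (Finset.abs_sum_le_sum_abs (fun l => (A - B) k l * u l) Finset.univ).trans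
        (Finset.sum_le_sum fun l _ => ?_)
      rw [abs_mul]
      exact mul_le_mul_of_nonneg_right (hAB k l) (abs_nonneg _)
    have h2 : ∑ k, |u k| * ∑ l, ρ * |u l| = ρ * (∑ k, |u k|) ^ 2 := by
      rw [← Finset.mul_sum, ← Finset.sum_mul]; ring
    have h3 : (∑ k, |u k|) ^ 2 ≤ p := by
      have := sq_sum_le_card_mul_sum_sq (s := Finset.univ) (f := fun k => |u k|)
      simp only [Finset.card_univ, Fintype.card_fin, sq_abs] at this
      have h4 : ∑ k, u k ^ 2 = 1 := by rw [← hu1]; simp [dotProduct, pow_two]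
      rwa [h4, mul_one] at this
    rw [h2] at h1
    refine h1.trans ?_
    rw [mul_comm]
    exact mul_le_mul_of_nonneg_right h3 hρ
  set e : EuclideanSpace ℝ (Fin p) := EuclideanSpace.single j 1 with he
  set w : EuclideanSpace ℝ (Fin p) := WithLp.toLp 2 (fun k => D j k) with hw
  have hinner : ∀ i, inner ℝ (b i) w = hDh.eigenvalues i * inner ℝ (b i) e := by
    intro i
    have h1 := congrFun (hDh.mulVec_eigenvectorBasis i) j
    simp only [Matrix.mulVec, dotProduct, Pi.smul_apply, smul_eq_mul] at h1
    have h2 : inner ℝ (b i) e = (b i).ofLp j := by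
      rw [he, EuclideanSpace.inner_single_right]; simp
    rw [h2, hb, ← h1]
    simp [PiLp.inner_apply, hw]
  have hsum : ∑ k, (CFC.sqrt A j k - CFC.sqrt B j k) ^ 2 = ‖w‖ ^ 2 := by
    rw [EuclideanSpace.real_norm_sq_eq]
    simp [hw, hD]
  rw [hsum, ← b.sum_sq_inner_right w]
  calc ∑ i, inner ℝ (b i) w ^ 2 = ∑ i, hDh.eigenvalues i ^ 2 * inner ℝ (b i) e ^ 2 :=
        Finset.sum_congr rfl fun i _ => by rw [hinner, mul_pow]
    _ ≤ ∑ i, p * ρ * inner ℝ (b i) e ^ 2 :=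
        Finset.sum_le_sum fun i _ => mul_le_mul_of_nonneg_right (hbound i) (sq_nonneg _)
    _ = p * ρ := by
        rw [← Finset.mul_sum, b.sum_sq_inner_right e]
        simp [he]

theorem continuous_sqrt_correlationMatrix {p : ℕ} (j k : Fin p) :
    Continuous fun C : CorrelationMatrix p => CFC.sqrt C.1 j k := by
  have hentry : ∀ i l : Fin p, Continuous fun C : CorrelationMatrix p => C.1 i l := fun i l =>
    (continuous_apply_apply i l).comp continuous_subtype_val
  refine continuous_iff_continuousAt.2 fun C₀ => ?_
  set f : CorrelationMatrix p → ℝ := fun C => ∑ i, ∑ l, |C.1 i l - C₀.1 i l| with hf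
  have hfc : Continuous f := by
    refine continuous_finsetSum _ fun i _ => continuous_finsetSum _ fun l _ => ?_
    exact ((hentry i l).sub continuous_const).abs
  have hle : ∀ C : CorrelationMatrix p, |CFC.sqrt C.1 j k - CFC.sqrt C₀.1 j k| ≤ √(p * f C) := by
    intro C
    refine Real.abs_le_sqrt ?_
    refine (Finset.single_le_sum (f := fun k => (CFC.sqrt C.1 j k - CFC.sqrt C₀.1 j k) ^ 2)
      (fun k _ => sq_nonneg _) (Finset.mem_univ k)).trans ?_
    refine sum_sq_sqrt_sub_sqrt_le C.2.1 C₀.2.1 (fun i l => ?_) j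
    refine (Finset.single_le_sum (f := fun l => |C.1 i l - C₀.1 i l|)
      (fun l _ => abs_nonneg _) (Finset.mem_univ l)).trans ?_
    exact Finset.single_le_sum (f := fun i => ∑ l, |C.1 i l - C₀.1 i l|)
      (fun i _ => Finset.sum_nonneg fun l _ => abs_nonneg _) (Finset.mem_univ i)
  have hlim : Tendsto (fun C => √(p * f C)) (𝓝 C₀) (𝓝 0) := by
    have hc : Continuous fun C => √(p * f C) := (continuous_const.mul hfc).sqrt
    have := hc.tendsto C₀
    have h0 : f C₀ = 0 := by simp [hf]
    rwa [h0, mul_zero, Real.sqrt_zero] at this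
  have h := squeeze_zero (fun C => abs_nonneg _) hle hlim
  replace h := (tendsto_zero_iff_abs_tendsto_zero _).2 h
  have h2 := h.add_const (CFC.sqrt C₀.1 j k)
  simp only [sub_add_cancel, zero_add] at h2
  exact h2

/-- The linear map `√C` on the latent space; it carries the standard Gaussian law to `N_p(0, C)`. -/
noncomputable def latentMap {p : ℕ} (C : CorrelationMatrix p) :
    EuclideanSpace ℝ (Fin p) →L[ℝ] EuclideanSpace ℝ (Fin p) :=
  Matrix.toEuclideanCLM (𝕜 := ℝ) (CFC.sqrt C.1)

theorem latentMap_apply {p : ℕ} (C : CorrelationMatrix p) (x : EuclideanSpace ℝ (Fin p))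
    (j : Fin p) : latentMap C x j = ∑ k, CFC.sqrt C.1 j k * x k := by
  simp [latentMap, Matrix.mulVec, dotProduct]

theorem latentLaw_eq_map {p : ℕ} (C : CorrelationMatrix p) :
    latentLaw C = (stdGaussian (EuclideanSpace ℝ (Fin p))).map (latentMap C) := by
  unfold latentLaw multivariateGaussian latentMap
  simp

theorem pi_latentLaw_eq_map {p : ℕ} (C : CorrelationMatrix p) (n : ℕ) :
    (Measure.pi fun _ : Fin n => latentLaw C)
      = (Measure.pi fun _ : Fin n => stdGaussian (EuclideanSpace ℝ (Fin p))).map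
          (fun X i => latentMap C (X i)) := by
  have h := Measure.pi_map_pi (μ := fun _ : Fin n => stdGaussian (EuclideanSpace ℝ (Fin p)))
    (f := fun _ => latentMap C)
    (hμ := fun _ => by rw [← latentLaw_eq_map]; infer_instance)
    (fun _ => (latentMap C).continuous.measurable.aemeasurable)
  rw [h, latentLaw_eq_map]

theorem measurable_latentMap_uncurry {p : ℕ} :
    Measurable fun q : CorrelationMatrix p × EuclideanSpace ℝ (Fin p) => latentMap q.1 q.2 := by
  have h : Measurable fun q : CorrelationMatrix p × EuclideanSpace ℝ (Fin p) =>
      (latentMap q.1 q.2).ofLp := by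
    refine measurable_pi_lambda _ fun j => ?_
    simp_rw [latentMap_apply]
    refine Finset.measurable_sum _ fun k _ => ?_
    exact ((continuous_sqrt_correlationMatrix j k).measurable.comp measurable_fst).mul
      (by fun_prop)
  exact (WithLp.measurable_toLp 2 (Fin p → ℝ)).comp h

theorem measurable_lintegral_latentMap {p n : ℕ}
    {g : (Fin n → EuclideanSpace ℝ (Fin p)) → ℝ≥0∞} (hg : Measurable g) :
    Measurable fun C : CorrelationMatrix p => ∫⁻ X, g (fun i => latentMap C (X i))
      ∂(Measure.pi fun _ : Fin n => stdGaussian (EuclideanSpace ℝ (Fin p))) := by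
  have hjoint : Measurable fun q : CorrelationMatrix p × (Fin n → EuclideanSpace ℝ (Fin p)) =>
      fun i => latentMap q.1 (q.2 i) := by
    refine measurable_pi_lambda _ fun i => ?_
    have hq : Measurable fun q : CorrelationMatrix p × (Fin n → EuclideanSpace ℝ (Fin p)) =>
        (q.1, q.2 i) := measurable_fst.prodMk ((measurable_pi_apply i).comp measurable_snd)
    have h := (measurable_latentMap_uncurry (p := p)).comp hq
    simpa only [Function.comp_def] using h
  exact (hg.comp hjoint).lintegral_prod_right'

theorem lintegral_pi_latentLaw {p n : ℕ} (C : CorrelationMatrix p)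
    {g : (Fin n → EuclideanSpace ℝ (Fin p)) → ℝ≥0∞} (hg : Measurable g) :
    ∫⁻ Z, g Z ∂(Measure.pi fun _ : Fin n => latentLaw C)
      = ∫⁻ X, g (fun i => latentMap C (X i))
        ∂(Measure.pi fun _ : Fin n => stdGaussian (EuclideanSpace ℝ (Fin p))) := by
  rw [pi_latentLaw_eq_map, lintegral_map hg]
  exact measurable_pi_lambda _ fun i =>
    (latentMap C).continuous.measurable.comp (measurable_pi_apply i)

/-- The likelihood is measurable in the correlation matrix. -/
theorem measurable_pi_latentLaw_apply {p n : ℕ} {D : Set (Fin n → EuclideanSpace ℝ (Fin p))}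
    (hD : MeasurableSet D) :
    Measurable fun C : CorrelationMatrix p => (Measure.pi fun _ : Fin n => latentLaw C) D := by
  have h := measurable_lintegral_latentMap (measurable_one.indicator hD)
  convert h using 2 with C
  rw [← lintegral_pi_latentLaw C (measurable_one.indicator hD), lintegral_indicator_one hD]

theorem map_eval_latentLaw {p : ℕ} (C : CorrelationMatrix p) (j : Fin p) :
    (latentLaw C).map (fun z => z j) = gaussianReal 0 1 := by
  have h := (measurePreserving_eval_multivariateGaussian (μ := 0) C.2.1 (i := j)).map_eq
  rw [C.2.2 j] at h
  simpa [latentLaw] using h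

theorem gaussianReal_Icc_le (x a : ℝ) :
    gaussianReal 0 1 (Set.Icc (x - a) (x + a)) ≤ ENNReal.ofReal (2 * a) := by
  rw [gaussianReal_apply 0 one_ne_zero]
  calc ∫⁻ y in Set.Icc (x - a) (x + a), gaussianPDF 0 1 y
      ≤ ∫⁻ y in Set.Icc (x - a) (x + a), 1 := by
        refine lintegral_mono fun y => ?_
        rw [gaussianPDF, ← ENNReal.ofReal_one]
        refine ENNReal.ofReal_le_ofReal ?_
        rw [gaussianPDFReal]
        refine mul_le_one₀ ?_ (Real.exp_nonneg _) (Real.exp_le_one_iff.2 ?_)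
        · refine inv_le_one_of_one_le₀ (Real.one_le_sqrt.2 ?_)
          have := Real.pi_gt_three
          simp only [NNReal.coe_one, mul_one]
          linarith
        · simp only [NNReal.coe_one]
          have := sq_nonneg (y - 0)
          rw [neg_div]
          linarith [div_nonneg this (by norm_num : (0 : ℝ) ≤ 2 * 1)]
    _ = ENNReal.ofReal (2 * a) := by
        rw [setLIntegral_one, Real.volume_Icc]
        congr 1; ring

/-- Two rows of a latent sample rarely have `j`-th coordinates within distance `a` of each other. -/
theorem pi_latentLaw_close_le {p n : ℕ} (C : CorrelationMatrix p) (j : Fin p) {i k : Fin n}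
    (hik : i ≠ k) {a : ℝ} :
    (Measure.pi fun _ : Fin n => latentLaw C) {z | |z k j - z i j| ≤ a}
      ≤ ENNReal.ofReal (2 * a) := by
  have hpair : (Measure.pi fun _ : Fin n => latentLaw C).map (fun z => (z i, z k))
      = (latentLaw C).prod (latentLaw C) := by
    rw [← Measure.infinitePi_eq_pi]
    exact Measure.infinitePi_map_eval_prod (P := fun _ : Fin n => latentLaw C) hik
  have hm : MeasurableSet {q : EuclideanSpace ℝ (Fin p) × EuclideanSpace ℝ (Fin p) |
      |q.2 j - q.1 j| ≤ a} := measurableSet_le (by fun_prop) measurable_const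
  have h1 : (Measure.pi fun _ : Fin n => latentLaw C) {z | |z k j - z i j| ≤ a}
      = ((latentLaw C).prod (latentLaw C)) {q | |q.2 j - q.1 j| ≤ a} := by
    rw [← hpair, Measure.map_apply (by fun_prop) hm]
    rfl
  rw [h1, Measure.prod_apply hm]
  calc ∫⁻ z, latentLaw C (Prod.mk z ⁻¹' {q | |q.2 j - q.1 j| ≤ a}) ∂(latentLaw C)
      ≤ ∫⁻ _, ENNReal.ofReal (2 * a) ∂(latentLaw C) := by
        refine lintegral_mono fun z => ?_
        refine le_trans (le_of_eq ?_) (gaussianReal_Icc_le (z j) a)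
        rw [← map_eval_latentLaw C j, Measure.map_apply (by fun_prop) measurableSet_Icc]
        congr 1
        ext w
        simp only [Set.mem_preimage, Set.mem_ofPred_eq, Set.mem_Icc, abs_le]
        constructor <;> rintro ⟨h1, h2⟩ <;> constructor <;> linarith
    _ = ENNReal.ofReal (2 * a) := by simp

/-- Chebyshev's inequality for the difference of two coupled latent coordinates, whose variance is
the squared distance of two rows of matrix square roots. -/
theorem stdGaussian_latentMap_dist_le {p : ℕ} {C C' : CorrelationMatrix p} {ρ a : ℝ}
    (hC : ∀ i j, |C.1 i j - C'.1 i j| ≤ ρ) (ha : 0 < a) (j : Fin p) :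
    stdGaussian (EuclideanSpace ℝ (Fin p)) {x | a ≤ |latentMap C x j - latentMap C' x j|}
      ≤ ENNReal.ofReal (p * ρ / a ^ 2) := by
  set L : StrongDual ℝ (EuclideanSpace ℝ (Fin p)) :=
    (EuclideanSpace.proj j : EuclideanSpace ℝ (Fin p) →L[ℝ] ℝ).comp (latentMap C - latentMap C')
    with hL
  have hLx : ∀ x, L x = latentMap C x j - latentMap C' x j := fun x => by simp [hL]
  have hρ : 0 ≤ ρ := (abs_nonneg _).trans (hC j j)
  have hnorm : ‖L‖ ≤ √(p * ρ) := by
    refine L.opNorm_le_bound (Real.sqrt_nonneg _) fun x => ?_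
    rw [hLx, latentMap_apply, latentMap_apply, ← Finset.sum_sub_distrib, Real.norm_eq_abs]
    rw [← Real.sqrt_sq (norm_nonneg x), ← Real.sqrt_mul (by positivity)]
    refine Real.abs_le_sqrt ?_
    simp_rw [← sub_mul]
    refine (Finset.sum_mul_sq_le_sq_mul_sq _ _ _).trans ?_
    rw [← EuclideanSpace.real_norm_sq_eq]
    exact mul_le_mul_of_nonneg_right (sum_sq_sqrt_sub_sqrt_le C.2.1 C'.2.1 hC j) (sq_nonneg _)
  have hvar : Var[L; stdGaussian (EuclideanSpace ℝ (Fin p))] ≤ p * ρ := by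
    rw [variance_dual_stdGaussian, ← Real.sq_sqrt (show (0 : ℝ) ≤ p * ρ by positivity)]
    exact pow_le_pow_left₀ (norm_nonneg _) hnorm 2
  have hcheb := meas_ge_le_variance_div_sq (μ := stdGaussian (EuclideanSpace ℝ (Fin p)))
    (X := L) (IsGaussian.memLp_dual _ L 2 (by norm_num)) ha
  rw [integral_strongDual_stdGaussian] at hcheb
  simp only [sub_zero, hLx] at hcheb
  refine hcheb.trans (ENNReal.ofReal_le_ofReal ?_)
  gcongr

/-- If `C` and `C₀` are entrywise within `(n + 1)⁻¹¹`, then driving the latent samples of size `n`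
by the same standard Gaussian rows makes all their columnwise orderings agree, up to probability
`O(n⁻²)`. -/
theorem stdGaussian_order_ne_le {p n : ℕ} {C₀ C : CorrelationMatrix p}
    (hC : ∀ i j, |C₀.1 i j - C.1 i j| ≤ ((n : ℝ) + 1)⁻¹ ^ 11) :
    (Measure.pi fun _ : Fin n => stdGaussian (EuclideanSpace ℝ (Fin p)))
      {X | ∃ j i k, latentMap C₀ (X i) j < latentMap C₀ (X k) j ∧
        ¬ latentMap C (X i) j < latentMap C (X k) j}
      ≤ ENNReal.ofReal ((2 * p + 4 * p ^ 2) * ((n : ℝ) + 1)⁻¹ ^ 2) := by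
  set P := Measure.pi fun _ : Fin n => stdGaussian (EuclideanSpace ℝ (Fin p)) with hP
  set t : ℝ := ((n : ℝ) + 1)⁻¹ with ht
  have ht0 : 0 < t := by positivity
  have hnt : n * t ≤ 1 := by
    rw [ht, ← div_eq_mul_inv, div_le_one (by positivity)]; linarith
  -- an order can only change if two rows are within `a` under `C₀`, or if a coordinate moves by
  -- `a / 2`; a union bound gives `n² a` for the former and `n t¹¹ / a²` for the latter
  set a : ℝ := t ^ 4 with ha
  have ha0 : 0 < a := by positivity
  set U : Fin p → Fin n → Fin n → Set (Fin n → EuclideanSpace ℝ (Fin p)) := fun j i k =>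
    {X | i ≠ k ∧ |latentMap C₀ (X k) j - latentMap C₀ (X i) j| ≤ a} with hU
  set V : Fin p → Fin n → Set (Fin n → EuclideanSpace ℝ (Fin p)) := fun j i =>
    {X | a / 2 ≤ |latentMap C₀ (X i) j - latentMap C (X i) j|} with hV
  have hsub : {X : Fin n → EuclideanSpace ℝ (Fin p) |
      ∃ j i k, latentMap C₀ (X i) j < latentMap C₀ (X k) j ∧
        ¬ latentMap C (X i) j < latentMap C (X k) j}
      ⊆ (⋃ j, ⋃ i, ⋃ k, U j i k) ∪ ⋃ j, ⋃ i, V j i := by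
    rintro X ⟨j, i, k, h1, h2⟩
    by_cases hi : a / 2 ≤ |latentMap C₀ (X i) j - latentMap C (X i) j|
    · exact Or.inr (Set.mem_iUnion.2 ⟨j, Set.mem_iUnion.2 ⟨i, hi⟩⟩)
    by_cases hk : a / 2 ≤ |latentMap C₀ (X k) j - latentMap C (X k) j|
    · exact Or.inr (Set.mem_iUnion.2 ⟨j, Set.mem_iUnion.2 ⟨k, hk⟩⟩)
    refine Or.inl (Set.mem_iUnion.2 ⟨j, Set.mem_iUnion.2 ⟨i, Set.mem_iUnion.2 ⟨k, ?_, ?_⟩⟩⟩)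
    · rintro rfl; exact lt_irrefl _ h1
    · have hi' := abs_lt.1 (not_le.1 hi)
      have hk' := abs_lt.1 (not_le.1 hk)
      have h2' := not_lt.1 h2
      exact abs_le.2 ⟨by linarith, by linarith⟩
  have hUle : ∀ j i k, P (U j i k) ≤ ENNReal.ofReal (2 * a) := by
    intro j i k
    by_cases hik : i = k
    · have : U j i k = ∅ := by ext X; simp [hU, hik]
      rw [this]; simp
    · have h := pi_latentLaw_close_le C₀ j hik (a := a)
      rw [pi_latentLaw_eq_map, Measure.map_apply] at h
      · refine le_trans (measure_mono ?_) h
        exact fun X hX => hX.2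
      · exact measurable_pi_lambda _ fun i =>
          (latentMap C₀).continuous.measurable.comp (measurable_pi_apply i)
      · exact measurableSet_le (by fun_prop) measurable_const
  have hVle : ∀ j i, P (V j i) ≤ ENNReal.ofReal (p * t ^ 11 / (a / 2) ^ 2) := by
    intro j i
    have h := stdGaussian_latentMap_dist_le hC (half_pos ha0) j
    have hmeas : MeasurableSet {x : EuclideanSpace ℝ (Fin p) |
        a / 2 ≤ |latentMap C₀ x j - latentMap C x j|} :=
      measurableSet_le measurable_const (by fun_prop)
    rw [← (measurePreserving_eval (fun _ : Fin n => stdGaussian (EuclideanSpace ℝ (Fin p)))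
      i).measure_preimage hmeas.nullMeasurableSet] at h
    exact h
  refine (measure_mono hsub).trans ((measure_union_le _ _).trans ?_)
  have h1 : P (⋃ j, ⋃ i, ⋃ k, U j i k) ≤ ENNReal.ofReal (2 * p * t ^ 2) := by
    refine (measure_iUnion_fintype_le _ _).trans ?_
    refine (Finset.sum_le_sum fun j _ => (measure_iUnion_fintype_le _ _).trans
      (Finset.sum_le_sum fun i _ => (measure_iUnion_fintype_le _ _).trans
        (Finset.sum_le_sum fun k _ => hUle j i k))).trans ?_
    simp only [Finset.sum_const, Finset.card_univ, Fintype.card_fin, nsmul_eq_mul]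
    rw [← ENNReal.ofReal_natCast, ← ENNReal.ofReal_natCast, ← ENNReal.ofReal_mul (by positivity),
      ← ENNReal.ofReal_mul (by positivity), ← ENNReal.ofReal_mul (by positivity)]
    refine ENNReal.ofReal_le_ofReal ?_
    have : (n * t) ^ 2 ≤ 1 := pow_le_one₀ (by positivity) hnt
    calc (p : ℝ) * (n * (n * (2 * a))) = 2 * p * t ^ 2 * (n * t) ^ 2 := by rw [ha]; ring
      _ ≤ 2 * p * t ^ 2 * 1 := by gcongr
      _ = 2 * p * t ^ 2 := by ring
  have h2 : P (⋃ j, ⋃ i, V j i) ≤ ENNReal.ofReal (4 * p ^ 2 * t ^ 2) := by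
    refine (measure_iUnion_fintype_le _ _).trans ?_
    refine (Finset.sum_le_sum fun j _ => (measure_iUnion_fintype_le _ _).trans
      (Finset.sum_le_sum fun i _ => hVle j i)).trans ?_
    simp only [Finset.sum_const, Finset.card_univ, Fintype.card_fin, nsmul_eq_mul]
    rw [← ENNReal.ofReal_natCast, ← ENNReal.ofReal_natCast, ← ENNReal.ofReal_mul (by positivity),
      ← ENNReal.ofReal_mul (by positivity)]
    refine ENNReal.ofReal_le_ofReal ?_
    calc (p : ℝ) * (n * (p * t ^ 11 / (a / 2) ^ 2)) = 4 * p ^ 2 * t ^ 2 * (n * t) := by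
          rw [ha]; field_simp; ring
      _ ≤ 4 * p ^ 2 * t ^ 2 * 1 := by gcongr
      _ = 4 * p ^ 2 * t ^ 2 := by ring
  refine (add_le_add h1 h2).trans ?_
  rw [← ENNReal.ofReal_add (by positivity) (by positivity)]
  exact ENNReal.ofReal_le_ofReal (le_of_eq (by ring))

end MatrixSqrt

/-! ### Bivariate normal orthant probabilities -/

instance isOpenPosMeasure_gaussianReal_zero_one : (gaussianReal 0 1).IsOpenPosMeasure :=
  (gaussianReal_absolutelyContinuous' 0 one_ne_zero).isOpenPosMeasure

theorem sq_correlation_le_one {p : ℕ} (C : CorrelationMatrix p) (j k : Fin p) :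
    C.1 j k ^ 2 ≤ 1 := by
  have hsymm : C.1 k j = C.1 j k := by
    have := C.2.1.isHermitian.apply j k
    simpa using this
  set v : Fin p → ℝ := Pi.single j (-C.1 j k) + Pi.single k 1 with hv
  have h := C.2.1.dotProduct_mulVec_nonneg v
  have : star v ⬝ᵥ C.1.mulVec v = 1 - C.1 j k ^ 2 := by
    simp only [hv, star_trivial, Matrix.mulVec_add, dotProduct_add, add_dotProduct,
      Matrix.mulVec_single, single_dotProduct, Pi.smul_apply, Matrix.col_apply, hsymm, C.2.2,
      MulOpposite.op_one, one_smul, op_smul_eq_smul, smul_eq_mul]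
    ring
  rw [this] at h
  linarith

/-- Two coordinates of `N_p(0, C)` are distributed as `(x, ρ x + √(1 - ρ²) w)` with `x`, `w`
independent standard normal and `ρ` the corresponding entry of `C`. -/
theorem map_pair_latentLaw {p : ℕ} (C : CorrelationMatrix p) (j k : Fin p) :
    (latentLaw C).map (fun z => (z j, z k))
      = ((gaussianReal 0 1).prod (gaussianReal 0 1)).map
          (fun q => (q.1, C.1 j k * q.1 + √(1 - C.1 j k ^ 2) * q.2)) := by
  set ρ := C.1 j k with hρ
  have hsymm : C.1 k j = ρ := by
    have := C.2.1.isHermitian.apply j k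
    simpa using this
  have hρ1 : ρ ^ 2 ≤ 1 := sq_correlation_le_one C j k
  set c := √(1 - ρ ^ 2) with hc
  have hcsq : c ^ 2 = 1 - ρ ^ 2 := Real.sq_sqrt (by linarith)
  have hpm : Measurable fun z : EuclideanSpace ℝ (Fin p) => (z j, z k) := by fun_prop
  have hqm : Measurable fun q : ℝ × ℝ => (q.1, ρ * q.1 + c * q.2) := by fun_prop
  have h1 : IsProbabilityMeasure ((latentLaw C).map fun z => (z j, z k)) :=
    Measure.isProbabilityMeasure_map hpm.aemeasurable
  have h2 : IsProbabilityMeasure (((gaussianReal 0 1).prod (gaussianReal 0 1)).map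
      fun q : ℝ × ℝ => (q.1, ρ * q.1 + c * q.2)) :=
    Measure.isProbabilityMeasure_map hqm.aemeasurable
  refine Measure.ext_of_charFunDual ?_
  ext L
  set a := L (1, 0) with ha
  set b := L (0, 1) with hb
  have hL : ∀ x y : ℝ, L (x, y) = a * x + b * y := by
    intro x y
    have : ((x, y) : ℝ × ℝ) = x • ((1 : ℝ), (0 : ℝ)) + y • ((0 : ℝ), (1 : ℝ)) := by simp
    rw [this, map_add, map_smul, map_smul]
    simp only [smul_eq_mul, ha, hb]
    ring
  rw [charFunDual_apply, charFunDual_apply, integral_map hpm.aemeasurable (by fun_prop),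
    integral_map hqm.aemeasurable (by fun_prop)]
  simp only [hL]
  set v : EuclideanSpace ℝ (Fin p) := EuclideanSpace.single j a + EuclideanSpace.single k b with hv
  have hleft : ∫ z, Complex.exp (((a * z j + b * z k : ℝ) : ℂ) * Complex.I) ∂(latentLaw C)
      = Complex.exp (-((a ^ 2 + 2 * a * b * ρ + b ^ 2 : ℝ) : ℂ) / 2) := by
    have h := charFun_multivariateGaussian (μ := 0) C.2.1 v
    rw [charFun_apply] at h
    have hin : ∀ z : EuclideanSpace ℝ (Fin p), inner ℝ z v = a * z j + b * z k := by
      intro z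
      rw [hv, inner_add_right, EuclideanSpace.inner_single_right,
        EuclideanSpace.inner_single_right]
      simp
    simp only [hin] at h
    rw [latentLaw, h]
    congr 1
    have hq : v.ofLp ⬝ᵥ C.1.mulVec v.ofLp = a ^ 2 + 2 * a * b * ρ + b ^ 2 := by
      have : v.ofLp = Pi.single j a + Pi.single k b := by
        ext i; simp [hv, Pi.single_apply]
      simp only [this, Matrix.mulVec_add, dotProduct_add, add_dotProduct,
        Matrix.mulVec_single, single_dotProduct, Pi.smul_apply, Matrix.col_apply, hsymm, C.2.2,
        ← hρ, op_smul_eq_smul, smul_eq_mul]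
      ring
    rw [hq]
    simp
    ring
  rw [hleft]
  have hright : ∀ q : ℝ × ℝ, Complex.exp (((a * q.1 + b * (ρ * q.1 + c * q.2) : ℝ) : ℂ) * Complex.I)
      = Complex.exp ((((a + b * ρ) : ℝ) : ℂ) * q.1 * Complex.I) *
        Complex.exp (((b * c : ℝ) : ℂ) * q.2 * Complex.I) := by
    intro q
    rw [← Complex.exp_add]
    congr 1
    push_cast
    ring
  simp only [hright]
  rw [integral_prod_mul (fun x : ℝ => Complex.exp ((((a + b * ρ) : ℝ) : ℂ) * x * Complex.I))
    (fun w : ℝ => Complex.exp (((b * c : ℝ) : ℂ) * w * Complex.I)), ← charFun_apply_real,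
    ← charFun_apply_real, charFun_gaussianReal, charFun_gaussianReal, ← Complex.exp_add]
  congr 1
  have : a ^ 2 + 2 * a * b * ρ + b ^ 2 = (a + b * ρ) ^ 2 + (b * c) ^ 2 := by
    rw [mul_pow, hcsq]; ring
  rw [this]
  push_cast
  ring

theorem measure_pair_latentLaw {p : ℕ} (C : CorrelationMatrix p) (j k : Fin p) {B : Set (ℝ × ℝ)}
    (hB : MeasurableSet B) :
    latentLaw C {z | (z j, z k) ∈ B} = ((gaussianReal 0 1).prod (gaussianReal 0 1))
      {q | (q.1, C.1 j k * q.1 + √(1 - C.1 j k ^ 2) * q.2) ∈ B} := by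
  have h := congrArg (fun m => m B) (map_pair_latentLaw C j k)
  simp only at h
  rw [Measure.map_apply (by fun_prop) hB, Measure.map_apply (by fun_prop) hB] at h
  exact h

/-- For `|ρ| < 1` the pair `(z_j, z_k)` charges every nonempty open set of the plane. -/
theorem latentLaw_pair_open_pos {p : ℕ} (C : CorrelationMatrix p) {j k : Fin p}
    (hC : C.1 j k ^ 2 < 1) {B : Set (ℝ × ℝ)} (hB : IsOpen B) (hne : B.Nonempty) :
    0 < latentLaw C {z | (z j, z k) ∈ B} := by
  rw [measure_pair_latentLaw C j k hB.measurableSet]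
  have hc : 0 < √(1 - C.1 j k ^ 2) := Real.sqrt_pos.2 (by linarith)
  refine IsOpen.measure_pos _ (hB.preimage (f := fun q : ℝ × ℝ =>
    (q.1, C.1 j k * q.1 + √(1 - C.1 j k ^ 2) * q.2)) (by fun_prop)) ?_
  obtain ⟨⟨x, y⟩, hxy⟩ := hne
  refine ⟨(x, (y - C.1 j k * x) / √(1 - C.1 j k ^ 2)), ?_⟩
  have : C.1 j k * x + √(1 - C.1 j k ^ 2) * ((y - C.1 j k * x) / √(1 - C.1 j k ^ 2)) = y := by
    field_simp; ring
  simpa [this] using hxy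

theorem latentLaw_coord_le {p : ℕ} (C : CorrelationMatrix p) (j : Fin p) (s : ℝ) :
    (latentLaw C).real {z | z j ≤ s} = (gaussianReal 0 1).real (Set.Iic s) := by
  rw [← map_eval_latentLaw C j, map_measureReal_apply (by fun_prop) measurableSet_Iic]
  rfl

theorem measurableSet_coord_le {p : ℕ} (j : Fin p) (s : ℝ) :
    MeasurableSet {z : EuclideanSpace ℝ (Fin p) | z j ≤ s} :=
  measurableSet_le (by fun_prop) measurable_const

theorem measurableSet_lt_coord {p : ℕ} (j : Fin p) (s : ℝ) :
    MeasurableSet {z : EuclideanSpace ℝ (Fin p) | s < z j} :=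
  measurableSet_lt measurable_const (by fun_prop)

theorem measurableSet_orthant {p : ℕ} (j k : Fin p) (s t : ℝ) :
    MeasurableSet {z : EuclideanSpace ℝ (Fin p) | z j ≤ s ∧ z k ≤ t} :=
  (measurableSet_coord_le j s).inter (measurableSet_coord_le k t)

/-- Strict Fréchet upper bound away from `ρ = 1`. -/
theorem orthant_lt_min {p : ℕ} (C : CorrelationMatrix p) {j k : Fin p} (hC : C.1 j k ^ 2 < 1)
    (s t : ℝ) :
    (latentLaw C).real {z | z j ≤ s ∧ z k ≤ t} < (gaussianReal 0 1).real (Set.Iic s) ∧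
      (latentLaw C).real {z | z j ≤ s ∧ z k ≤ t} < (gaussianReal 0 1).real (Set.Iic t) := by
  have hj : {z : EuclideanSpace ℝ (Fin p) | z j ≤ s}
      = {z | z j ≤ s ∧ z k ≤ t} ∪ {z | z j ≤ s ∧ t < z k} := by
    ext z; simp only [Set.mem_union, Set.mem_ofPred_eq]
    rcases le_or_gt (z k) t with h | h <;> simp [h, not_lt.2, not_le.2]
  have hk : {z : EuclideanSpace ℝ (Fin p) | z k ≤ t}
      = {z | z j ≤ s ∧ z k ≤ t} ∪ {z | s < z j ∧ z k ≤ t} := by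
    ext z; simp only [Set.mem_union, Set.mem_ofPred_eq]
    rcases le_or_gt (z j) s with h | h <;> simp [h, not_lt.2, not_le.2]
  have hpos1 : 0 < (latentLaw C).real {z | z j ≤ s ∧ t < z k} := by
    refine ENNReal.toReal_pos (ne_of_gt ?_) (measure_ne_top _ _)
    refine (latentLaw_pair_open_pos C hC (B := Set.Iio s ×ˢ Set.Ioi t) (isOpen_Iio.prod isOpen_Ioi)
      ⟨(s - 1, t + 1), by simp⟩).trans_le (measure_mono ?_)
    rintro z ⟨h1, h2⟩
    exact ⟨le_of_lt h1, h2⟩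
  have hpos2 : 0 < (latentLaw C).real {z | s < z j ∧ z k ≤ t} := by
    refine ENNReal.toReal_pos (ne_of_gt ?_) (measure_ne_top _ _)
    refine (latentLaw_pair_open_pos C hC (B := Set.Ioi s ×ˢ Set.Iio t) (isOpen_Ioi.prod isOpen_Iio)
      ⟨(s + 1, t - 1), by simp⟩).trans_le (measure_mono ?_)
    rintro z ⟨h1, h2⟩
    exact ⟨h1, le_of_lt h2⟩
  constructor
  · rw [← latentLaw_coord_le C j, hj, measureReal_union]
    · linarith
    · exact Set.disjoint_left.2 fun z h1 h2 => absurd h1.2 (not_le.2 h2.2)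
    · exact (measurableSet_coord_le j s).inter (measurableSet_lt_coord k t)
  · rw [← latentLaw_coord_le C k, hk, measureReal_union]
    · linarith
    · exact Set.disjoint_left.2 fun z h1 h2 => absurd h1.1 (not_le.2 h2.1)
    · exact (measurableSet_lt_coord j s).inter (measurableSet_coord_le k t)

/-- Inclusion and exclusion for the lower and the upper orthant. -/
theorem orthant_add_upper {p : ℕ} (C : CorrelationMatrix p) (j k : Fin p) (s t : ℝ) :
    (latentLaw C).real {z | z j ≤ s ∧ z k ≤ t}
      = (gaussianReal 0 1).real (Set.Iic s) + (gaussianReal 0 1).real (Set.Iic t) - 1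
        + (latentLaw C).real {z | s < z j ∧ t < z k} := by
  have h1 := measureReal_union_add_inter (μ := latentLaw C)
    (s := {z : EuclideanSpace ℝ (Fin p) | z j ≤ s}) (measurableSet_coord_le k t)
  have h2 := probReal_compl_eq_one_sub (μ := latentLaw C)
    ((measurableSet_coord_le j s).union (measurableSet_coord_le k t))
  have h3 : ({z : EuclideanSpace ℝ (Fin p) | z j ≤ s} ∪ {z | z k ≤ t})ᶜ
      = {z | s < z j ∧ t < z k} := by
    ext z; simp
  rw [h3] at h2
  rw [latentLaw_coord_le, latentLaw_coord_le] at h1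
  have h4 : {z : EuclideanSpace ℝ (Fin p) | z j ≤ s} ∩ {z | z k ≤ t}
      = {z | z j ≤ s ∧ z k ≤ t} := rfl
  rw [h4] at h1
  linarith

/-- Strict Fréchet lower bound away from `ρ = -1`. -/
theorem orthant_gt_max {p : ℕ} (C : CorrelationMatrix p) {j k : Fin p} (hC : C.1 j k ^ 2 < 1)
    (s t : ℝ) :
    0 < (latentLaw C).real {z | z j ≤ s ∧ z k ≤ t} ∧
      (gaussianReal 0 1).real (Set.Iic s) + (gaussianReal 0 1).real (Set.Iic t) - 1
        < (latentLaw C).real {z | z j ≤ s ∧ z k ≤ t} := by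
  constructor
  · refine ENNReal.toReal_pos (ne_of_gt ?_) (measure_ne_top _ _)
    refine (latentLaw_pair_open_pos C hC (B := Set.Iio s ×ˢ Set.Iio t) (isOpen_Iio.prod isOpen_Iio)
      ⟨(s - 1, t - 1), by simp⟩).trans_le (measure_mono ?_)
    rintro z ⟨h1, h2⟩
    exact ⟨le_of_lt h1, le_of_lt h2⟩
  · rw [orthant_add_upper]
    have : 0 < (latentLaw C).real {z | s < z j ∧ t < z k} :=
      ENNReal.toReal_pos (ne_of_gt (latentLaw_pair_open_pos C hC (B := Set.Ioi s ×ˢ Set.Ioi t)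
        (isOpen_Ioi.prod isOpen_Ioi) ⟨(s + 1, t + 1), by simp⟩)) (measure_ne_top _ _)
    linarith

/-- For `ρ = 1` the Fréchet upper bound is attained. -/
theorem orthant_of_eq_one {p : ℕ} (C : CorrelationMatrix p) {j k : Fin p} (hC : C.1 j k = 1)
    (s t : ℝ) :
    (latentLaw C).real {z | z j ≤ s ∧ z k ≤ t}
      = min ((gaussianReal 0 1).real (Set.Iic s)) ((gaussianReal 0 1).real (Set.Iic t)) := by
  have hB : MeasurableSet (Set.Iic s ×ˢ Set.Iic t) := measurableSet_Iic.prod measurableSet_Iic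
  have h1 := measure_pair_latentLaw C j k hB
  have h2 : (latentLaw C).real {z | z j ≤ s ∧ z k ≤ t}
      = (gaussianReal 0 1).real (Set.Iic (min s t)) := by
    rw [measureReal_def, measureReal_def]
    congr 1
    refine h1.trans ?_
    have : {q : ℝ × ℝ | (q.1, C.1 j k * q.1 + √(1 - C.1 j k ^ 2) * q.2) ∈ Set.Iic s ×ˢ Set.Iic t}
        = Set.Iic (min s t) ×ˢ Set.univ := by
      ext q; simp [hC]
    rw [this, Measure.prod_prod]
    simp
  rw [h2]
  have hmono : Monotone fun x => (gaussianReal 0 1).real (Set.Iic x) := fun x y h =>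
    measureReal_mono (Set.Iic_subset_Iic.2 h)
  exact hmono.map_min

/-- For `ρ = -1` the Fréchet lower bound is attained. -/
theorem orthant_of_eq_neg_one {p : ℕ} (C : CorrelationMatrix p) {j k : Fin p} (hC : C.1 j k = -1)
    (s t : ℝ) :
    (latentLaw C).real {z | z j ≤ s ∧ z k ≤ t}
      ≤ max 0 ((gaussianReal 0 1).real (Set.Iic s) + (gaussianReal 0 1).real (Set.Iic t) - 1) := by
  rcases lt_or_ge (s + t) 0 with h | h
  · refine le_max_of_le_left (le_of_eq ?_)
    rw [measureReal_def]
    have h1 := measure_pair_latentLaw C j k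
      (measurableSet_Iic.prod measurableSet_Iic : MeasurableSet (Set.Iic s ×ˢ Set.Iic t))
    have : {q : ℝ × ℝ | (q.1, C.1 j k * q.1 + √(1 - C.1 j k ^ 2) * q.2) ∈ Set.Iic s ×ˢ Set.Iic t}
        = ∅ := by
      ext q
      simp only [Set.mem_ofPred_eq, Set.mem_prod, Set.mem_Iic, hC, Set.mem_empty_iff_false, iff_false]
      norm_num
      intro _
      linarith
    rw [this, measure_empty] at h1
    have h2 : latentLaw C {z | z j ≤ s ∧ z k ≤ t} = 0 := h1
    rw [h2]; simp
  · refine le_max_of_le_right ?_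
    rw [orthant_add_upper]
    have h1 := measure_pair_latentLaw C j k
      (measurableSet_Ioi.prod measurableSet_Ioi : MeasurableSet (Set.Ioi s ×ˢ Set.Ioi t))
    have : {q : ℝ × ℝ | (q.1, C.1 j k * q.1 + √(1 - C.1 j k ^ 2) * q.2) ∈ Set.Ioi s ×ˢ Set.Ioi t}
        = ∅ := by
      ext q
      simp only [Set.mem_ofPred_eq, Set.mem_prod, Set.mem_Ioi, hC, Set.mem_empty_iff_false, iff_false]
      norm_num
      intro _
      linarith
    rw [this, measure_empty] at h1
    have h2 : latentLaw C {z | s < z j ∧ t < z k} = 0 := h1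
    rw [measureReal_def (latentLaw C) {z | s < z j ∧ t < z k}, h2]
    simp

/-- The orthant probability is strictly increasing in the correlation on `(-1, 1)`. In the
coordinates of `map_pair_latentLaw` the event `z_k ≤ t` is the region below a line, whose slope
decreases with the correlation while its probability stays the same; to the left of the point
where two such lines cross, one region contains the other, and to the right it is the reverse. -/
theorem orthant_strictMono_interior {p : ℕ} (C C' : CorrelationMatrix p) {j k : Fin p}
    (hC : C.1 j k ^ 2 < 1) (hC' : C'.1 j k ^ 2 < 1) (hlt : C.1 j k < C'.1 j k) (s t : ℝ) :
    (latentLaw C).real {z | z j ≤ s ∧ z k ≤ t} < (latentLaw C').real {z | z j ≤ s ∧ z k ≤ t} := by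
  set P := (gaussianReal 0 1).prod (gaussianReal 0 1) with hP
  set r := C.1 j k with hr
  set r' := C'.1 j k with hr'
  set c := √(1 - r ^ 2) with hc
  set c' := √(1 - r' ^ 2) with hc'
  have hc0 : 0 < c := Real.sqrt_pos.2 (by linarith)
  have hc0' : 0 < c' := Real.sqrt_pos.2 (by linarith)
  have hrI : r ∈ Set.Ioo (-1 : ℝ) 1 := abs_lt.1 ((sq_lt_one_iff_abs_lt_one r).1 hC)
  have hrI' : r' ∈ Set.Ioo (-1 : ℝ) 1 := abs_lt.1 ((sq_lt_one_iff_abs_lt_one r').1 hC')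
  have hslope : r / c < r' / c' := by
    rw [hc, hc', ← Real.tan_arcsin, ← Real.tan_arcsin]
    refine Real.strictMonoOn_tan ?_ ?_ (Real.strictMonoOn_arcsin ⟨hrI.1.le, hrI.2.le⟩
      ⟨hrI'.1.le, hrI'.2.le⟩ hlt)
    · exact ⟨Real.neg_pi_div_two_lt_arcsin.2 hrI.1, Real.arcsin_lt_pi_div_two.2 hrI.2⟩
    · exact ⟨Real.neg_pi_div_two_lt_arcsin.2 hrI'.1, Real.arcsin_lt_pi_div_two.2 hrI'.2⟩
  set a : ℝ → ℝ := fun x => t / c - r / c * x with ha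
  set a' : ℝ → ℝ := fun x => t / c' - r' / c' * x with ha'
  have hac : Continuous a := by fun_prop
  have hac' : Continuous a' := by fun_prop
  have hle : ∀ x w, r * x + c * w ≤ t ↔ w ≤ a x := by
    intro x w
    have : a x = (t - r * x) / c := by simp only [ha]; ring
    rw [this, le_div_iff₀ hc0]
    constructor <;> intro h <;> linarith
  have hle' : ∀ x w, r' * x + c' * w ≤ t ↔ w ≤ a' x := by
    intro x w
    have : a' x = (t - r' * x) / c' := by simp only [ha']; ring
    rw [this, le_div_iff₀ hc0']
    constructor <;> intro h <;> linarith
  -- the abscissa at which the two lines cross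
  set x₀ := (t / c' - t / c) / (r' / c' - r / c) with hx₀
  have hcross : ∀ x, a' x - a x = (r' / c' - r / c) * (x₀ - x) := by
    intro x
    have hne : r' / c' - r / c ≠ 0 := (sub_pos.2 hslope).ne'
    have : (r' / c' - r / c) * x₀ = t / c' - t / c := by
      rw [hx₀]; exact mul_div_cancel₀ _ hne
    simp only [ha, ha', mul_sub, this]
    ring
  have hR : ∀ (b : ℝ → ℝ), Continuous b → MeasurableSet {q : ℝ × ℝ | q.2 ≤ b q.1} := fun b hb =>
    (isClosed_le continuous_snd (hb.comp continuous_fst)).measurableSet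
  have hS : MeasurableSet {q : ℝ × ℝ | q.1 ≤ s} :=
    (isClosed_le continuous_fst continuous_const).measurableSet
  have hmeas : ∀ (D : CorrelationMatrix p) (b : ℝ → ℝ)
      (_ : ∀ x w, D.1 j k * x + √(1 - D.1 j k ^ 2) * w ≤ t ↔ w ≤ b x),
      (latentLaw D).real {z | z j ≤ s ∧ z k ≤ t} = P.real ({q | q.1 ≤ s} ∩ {q | q.2 ≤ b q.1}) ∧
      (gaussianReal 0 1).real (Set.Iic t) = P.real {q | q.2 ≤ b q.1} := by
    intro D b hb
    constructor
    · have h1 := measure_pair_latentLaw D j k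
        (measurableSet_Iic.prod measurableSet_Iic : MeasurableSet (Set.Iic s ×ˢ Set.Iic t))
      rw [measureReal_def, measureReal_def]
      congr 1
      refine h1.trans ?_
      congr 1
      ext q
      simp [hb]
    · have h1 := measure_pair_latentLaw D j k
        (MeasurableSet.univ.prod measurableSet_Iic : MeasurableSet (Set.univ ×ˢ Set.Iic t))
      rw [← latentLaw_coord_le D k, measureReal_def, measureReal_def]
      congr 1
      have h2 : {z : EuclideanSpace ℝ (Fin p) | z k ≤ t}
          = {z | (z j, z k) ∈ Set.univ ×ˢ Set.Iic t} := by ext z; simp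
      rw [h2]
      refine h1.trans ?_
      congr 1
      ext q
      simp [hb]
  obtain ⟨hH, hM⟩ := hmeas C a hle
  obtain ⟨hH', hM'⟩ := hmeas C' a' hle'
  rw [hH, hH']
  rcases le_or_gt s x₀ with hs | hs
  · -- left of the crossing the region for `C'` is the larger one
    have hpos : 0 < P.real {q : ℝ × ℝ | q.1 < s ∧ a q.1 < q.2 ∧ q.2 < a' q.1} := by
      refine ENNReal.toReal_pos (ne_of_gt (IsOpen.measure_pos _ ?_ ?_)) (measure_ne_top _ _)
      · exact (isOpen_lt continuous_fst continuous_const).inter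
          ((isOpen_lt (hac.comp continuous_fst) continuous_snd).inter
            (isOpen_lt continuous_snd (hac'.comp continuous_fst)))
      · refine ⟨(s - 1, (a (s - 1) + a' (s - 1)) / 2), ?_⟩
        have := hcross (s - 1)
        have h2 : 0 < (r' / c' - r / c) * (x₀ - (s - 1)) :=
          mul_pos (sub_pos.2 hslope) (by linarith)
        refine ⟨by simp, ?_, ?_⟩ <;> simp only <;> linarith
    have hsub : ({q : ℝ × ℝ | q.1 ≤ s} ∩ {q | q.2 ≤ a q.1}) ∪
        {q : ℝ × ℝ | q.1 < s ∧ a q.1 < q.2 ∧ q.2 < a' q.1}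
        ⊆ {q : ℝ × ℝ | q.1 ≤ s} ∩ {q | q.2 ≤ a' q.1} := by
      rintro q (⟨h1, h2⟩ | ⟨h1, h2, h3⟩)
      · refine ⟨h1, show q.2 ≤ _ from le_trans h2 ?_⟩
        have := hcross q.1
        have h4 : 0 ≤ (r' / c' - r / c) * (x₀ - q.1) :=
          mul_nonneg (sub_pos.2 hslope).le (by linarith [show q.1 ≤ s from h1])
        linarith
      · exact ⟨le_of_lt h1, le_of_lt h3⟩
    have h1 := measureReal_mono (μ := P) hsub
    rw [measureReal_union' _ (hS.inter (hR a hac))] at h1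
    · linarith
    · exact Set.disjoint_left.2 fun q h1 h2 => absurd h1.2 (not_le.2 h2.2.1)
  · -- right of the crossing it is the smaller one, and the two regions have the same probability
    have hpos : 0 < P.real {q : ℝ × ℝ | s < q.1 ∧ a' q.1 < q.2 ∧ q.2 < a q.1} := by
      refine ENNReal.toReal_pos (ne_of_gt (IsOpen.measure_pos _ ?_ ?_)) (measure_ne_top _ _)
      · exact (isOpen_lt continuous_const continuous_fst).inter
          ((isOpen_lt (hac'.comp continuous_fst) continuous_snd).inter
            (isOpen_lt continuous_snd (hac.comp continuous_fst)))
      · refine ⟨(s + 1, (a (s + 1) + a' (s + 1)) / 2), ?_⟩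
        have := hcross (s + 1)
        have h2 : (r' / c' - r / c) * (x₀ - (s + 1)) < 0 :=
          mul_neg_of_pos_of_neg (sub_pos.2 hslope) (by linarith)
        refine ⟨by simp, ?_, ?_⟩ <;> simp only <;> linarith
    have hsub : ({q : ℝ × ℝ | s < q.1} ∩ {q | q.2 ≤ a' q.1}) ∪
        {q : ℝ × ℝ | s < q.1 ∧ a' q.1 < q.2 ∧ q.2 < a q.1}
        ⊆ {q : ℝ × ℝ | s < q.1} ∩ {q | q.2 ≤ a q.1} := by
      rintro q (⟨h1, h2⟩ | ⟨h1, h2, h3⟩)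
      · refine ⟨h1, show q.2 ≤ _ from le_trans h2 ?_⟩
        have := hcross q.1
        have h4 : (r' / c' - r / c) * (x₀ - q.1) ≤ 0 :=
          mul_nonpos_of_nonneg_of_nonpos (sub_pos.2 hslope).le
            (by linarith [show s < q.1 from h1])
        linarith
      · exact ⟨h1, le_of_lt h3⟩
    have h1 := measureReal_mono (μ := P) hsub
    have hS' : MeasurableSet {q : ℝ × ℝ | s < q.1} :=
      (isOpen_lt continuous_const continuous_fst).measurableSet
    rw [measureReal_union' _ (hS'.inter (hR a' hac'))] at h1
    · have hsplit : ∀ b : ℝ → ℝ, Continuous b → P.real {q : ℝ × ℝ | q.2 ≤ b q.1}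
          = P.real ({q : ℝ × ℝ | q.1 ≤ s} ∩ {q | q.2 ≤ b q.1})
            + P.real ({q : ℝ × ℝ | s < q.1} ∩ {q | q.2 ≤ b q.1}) := by
        intro b hb
        rw [← measureReal_union _ (hS'.inter (hR b hb)), ← Set.union_inter_distrib_right]
        · congr 1
          ext q
          simp [le_or_gt]
        · exact Set.disjoint_left.2 fun q h1 h2 =>
            absurd (show q.1 ≤ s from h1.1) (not_le.2 h2.1)
      have e1 := hsplit a hac
      have e2 := hsplit a' hac'
      linarith
    · exact Set.disjoint_left.2 fun q h1 h2 => absurd h1.2 (not_le.2 h2.2.1)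

/-- The orthant probability is strictly increasing in the correlation on `[-1, 1]`: at the end points,
where the law is degenerate, the strict Fréchet bounds apply. -/
theorem orthant_strictMono {p : ℕ} (C C' : CorrelationMatrix p) {j k : Fin p}
    (hlt : C.1 j k < C'.1 j k) (s t : ℝ) :
    (latentLaw C).real {z | z j ≤ s ∧ z k ≤ t} < (latentLaw C').real {z | z j ≤ s ∧ z k ≤ t} := by
  have hpos : ∀ x : ℝ, 0 < (gaussianReal 0 1).real (Set.Iic x) ∧
      (gaussianReal 0 1).real (Set.Iic x) < 1 := by
    intro x
    have h1 := stdNormalCDF_pos x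
    have h2 := stdNormalCDF_lt_one x
    unfold stdNormalCDF at h1 h2
    rw [cdf_eq_real] at h1 h2
    exact ⟨h1, h2⟩
  have hCle := abs_le.1 ((sq_le_one_iff_abs_le_one _).1 (sq_correlation_le_one C j k))
  have hCle' := abs_le.1 ((sq_le_one_iff_abs_le_one _).1 (sq_correlation_le_one C' j k))
  have hin : ∀ r : ℝ, -1 < r → r < 1 → r ^ 2 < 1 := fun r h1 h2 =>
    (sq_lt_one_iff_abs_lt_one r).2 (abs_lt.2 ⟨h1, h2⟩)
  rcases hCle.1.eq_or_lt with h | h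
  · rcases hCle'.2.eq_or_lt with h' | h'
    · rw [orthant_of_eq_one C' h']
      refine (orthant_of_eq_neg_one C h.symm s t).trans_lt (max_lt ?_ ?_)
      · exact lt_min (hpos s).1 (hpos t).1
      · exact lt_min (by linarith [(hpos t).2]) (by linarith [(hpos s).2])
    · refine (orthant_of_eq_neg_one C h.symm s t).trans_lt ?_
      have := orthant_gt_max C' (hin _ (by linarith) h') s t
      exact max_lt this.1 this.2
  · rcases hCle'.2.eq_or_lt with h' | h'
    · rw [orthant_of_eq_one C' h']
      have := orthant_lt_min C (hin _ h (by linarith)) s t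
      exact lt_min this.1 this.2
    · exact orthant_strictMono_interior C C' (hin _ h (by linarith)) (hin _ (by linarith) h') hlt s t

/-! ### Discretizing the missingness mechanism -/

/-- An upper semicontinuous minorant of `y ↦ κ(r ∣ y)`, close to it in `L¹(μ)`, vanishing when an
observed coordinate exceeds `B`, and still a function of the observed coordinates only. -/
theorem MissingAtRandom.exists_usc_minorant {p : ℕ} {κ : Kernel (Fin p → ℝ) (Pattern p)}
    [IsMarkovKernel κ] (hMAR : MissingAtRandom κ) (μ : Measure (Fin p → ℝ))
    [IsProbabilityMeasure μ] {δ : ℝ≥0∞} (hδ : δ ≠ 0) {B : ℝ}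
    (hB : μ {y | ∃ j, B < |y j|} ≤ δ) (r : Pattern p) :
    ∃ g : (Fin p → ℝ) → ℝ≥0, UpperSemicontinuous g ∧ (∀ y, (g y : ℝ≥0∞) ≤ κ y {r}) ∧
      (∀ y y', (∀ j, r j = false → y j = y' j) → g y = g y') ∧
      (∀ y, g y ≠ 0 → ∀ j, r j = false → |y j| ≤ B) ∧
      ∫⁻ y, (κ y {r} - g y) ∂μ ≤ 2 * δ := by
  classical
  -- Working with the law of the observed coordinates makes the minorant a function of them.
  set proj : (Fin p → ℝ) → (Fin p → ℝ) := fun y j => if r j then 0 else y j with hproj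
  have hprojc : Continuous proj := by
    refine continuous_pi fun j => ?_
    by_cases h : r j
    · simp only [hproj, h, if_true]; exact continuous_const
    · simp only [hproj, h]; exact continuous_apply j
  have hκproj : ∀ y, κ (proj y) {r} = κ y {r} := fun y =>
    hMAR r _ _ fun j hj => by simp [hproj, hj]
  have hκm : Measurable fun y => κ y {r} := κ.measurable_coe (measurableSet_singleton r)
  set cube : Set (Fin p → ℝ) := {y | ∀ j, r j = false → |y j| ≤ B} with hcube
  have hcubem : MeasurableSet cube := by
    have : cube = ⋂ j, {y | r j = false → |y j| ≤ B} := by ext y; simp [hcube]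
    rw [this]
    refine MeasurableSet.iInter fun j => ?_
    by_cases h : r j = false
    · simp only [h, forall_const]
      exact measurableSet_le (by fun_prop) measurable_const
    · simp [h]
  set f : (Fin p → ℝ) → ℝ≥0 := cube.indicator fun y => (κ y {r}).toNNReal with hf
  have hfm : Measurable f := (ENNReal.measurable_toNNReal.comp hκm).indicator hcubem
  have hfle : ∀ y, (f y : ℝ≥0∞) ≤ κ y {r} := by
    intro y
    by_cases h : y ∈ cube
    · rw [hf, Set.indicator_of_mem h, ENNReal.coe_toNNReal (measure_ne_top _ _)]
    · rw [hf, Set.indicator_of_notMem h]; simp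
  have hint : ∫⁻ y, (f y : ℝ≥0∞) ∂(μ.map proj) ≠ ∞ := by
    rw [lintegral_map hfm.coe_nnreal_ennreal hprojc.measurable]
    refine ((lintegral_mono fun y => (hfle _).trans prob_le_one).trans_lt ?_).ne
    simp
  obtain ⟨g, hgf, hgusc, hgint⟩ := exists_upperSemicontinuous_le_lintegral_le f hint hδ
  refine ⟨g ∘ proj, hgusc.comp hprojc, fun y => ?_, fun y y' h => ?_, fun y hy j hj => ?_, ?_⟩
  · rw [← hκproj y]
    exact (ENNReal.coe_le_coe.2 (hgf _)).trans (hfle _)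
  · have : proj y = proj y' := by
      funext j
      by_cases hj : r j
      · simp [hproj, hj]
      · simp [hproj, h j (by simpa using hj)]
    simp [this]
  · by_contra hcon
    refine hy (nonpos_iff_eq_zero.1 ((hgf _).trans (le_of_eq ?_)))
    rw [hf, Set.indicator_of_notMem]
    intro hmem
    refine hcon ?_
    have := hmem j hj
    simpa [hproj, hj] using this
  · have hgm : Measurable fun y => ((g ∘ proj) y : ℝ≥0∞) :=
      (hgusc.measurable.comp hprojc.measurable).coe_nnreal_ennreal
    have hsplit : ∀ y, κ y {r} ≤ f (proj y) + Set.indicator {y : Fin p → ℝ | ∃ j, B < |y j|} 1 y := by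
      intro y
      by_cases h : ∃ j, B < |y j|
      · rw [Set.indicator_of_mem (show y ∈ {y : Fin p → ℝ | ∃ j, B < |y j|} from h)]
        exact prob_le_one.trans le_add_self
      · push Not at h
        have hmem : proj y ∈ cube := fun j hj => by simpa [hproj, hj] using h j
        rw [hf, Set.indicator_of_mem hmem, hκproj, ENNReal.coe_toNNReal (measure_ne_top _ _)]
        exact le_self_add
    have hBm : MeasurableSet {y : Fin p → ℝ | ∃ j, B < |y j|} := by
      have : {y : Fin p → ℝ | ∃ j, B < |y j|} = ⋃ j, {y | B < |y j|} := by ext y; simp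
      rw [this]
      exact MeasurableSet.iUnion fun j => measurableSet_lt measurable_const (by fun_prop)
    have h1 : ∫⁻ y, κ y {r} ∂μ ≤ ∫⁻ y, ((g ∘ proj) y : ℝ≥0∞) ∂μ + 2 * δ := by
      calc ∫⁻ y, κ y {r} ∂μ
          ≤ ∫⁻ y, (f (proj y) + Set.indicator {y : Fin p → ℝ | ∃ j, B < |y j|} 1 y) ∂μ :=
            lintegral_mono hsplit
        _ = ∫⁻ y, f (proj y) ∂μ + μ {y | ∃ j, B < |y j|} := by
            rw [lintegral_add_right _ (measurable_one.indicator hBm), lintegral_indicator_one hBm]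
        _ ≤ (∫⁻ y, ((g ∘ proj) y : ℝ≥0∞) ∂μ + δ) + δ := by
            refine add_le_add ?_ hB
            rw [lintegral_map hfm.coe_nnreal_ennreal hprojc.measurable,
              lintegral_map hgusc.measurable.coe_nnreal_ennreal hprojc.measurable] at hgint
            exact hgint
        _ = _ := by rw [two_mul, add_assoc]
    have hgfin : ∫⁻ y, ((g ∘ proj) y : ℝ≥0∞) ∂μ ≠ ∞ := by
      refine ((lintegral_mono fun y => ?_).trans_lt (show ∫⁻ _, (1 : ℝ≥0∞) ∂μ < ∞ by simp)).ne
      exact (ENNReal.coe_le_coe.2 (hgf _)).trans ((hfle _).trans prob_le_one)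
    rw [lintegral_sub hgm hgfin]
    · exact tsub_le_iff_left.2 h1
    · refine ae_of_all _ fun y => ?_
      show ((g (proj y) : ℝ≥0) : ℝ≥0∞) ≤ κ y {r}
      rw [← hκproj y]
      exact (ENNReal.coe_le_coe.2 (hgf _)).trans (hfle _)

/-- Finitely many upper semicontinuous functions with sum at most `1`, each one supported in a cube
in the coordinates it depends on, still have sum at most `1 + ε` when they are evaluated at
different points that are close to each other. Semicontinuity gives this near each point, and
Lebesgue's number lemma makes it uniform over the cube; outside it, clipping does not decrease the
functions. -/
theorem exists_uniform_sum_le {p : ℕ} {g : Pattern p → (Fin p → ℝ) → ℝ≥0} {B : ℝ} (hB0 : 0 ≤ B)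
    (husc : ∀ r, UpperSemicontinuous (g r)) (hsum : ∀ y, ∑ r, (g r y : ℝ) ≤ 1)
    (hdep : ∀ r y y', (∀ j, r j = false → y j = y' j) → g r y = g r y')
    (hsupp : ∀ r y, g r y ≠ 0 → ∀ j, r j = false → |y j| ≤ B) {ε : ℝ} (hε : 0 < ε) :
    ∃ δ > 0, ∀ y : Pattern p → Fin p → ℝ, (∀ r r' j, |y r j - y r' j| < δ) →
      ∑ r, (g r (y r) : ℝ) ≤ 1 + ε := by
  set m : ℝ := ((Fintype.card (Pattern p) : ℕ) : ℝ) with hm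
  have hm0 : 0 < m := by rw [hm]; exact_mod_cast Fintype.card_pos
  set η : ℝ≥0 := ⟨ε / m, by positivity⟩ with hη
  have hη0 : 0 < η := by rw [← NNReal.coe_pos]; exact div_pos hε hm0
  set U : (Fin p → ℝ) → Set (Fin p → ℝ) := fun y => ⋂ r, {y' | g r y' < g r y + η} with hU
  have hUo : ∀ y, IsOpen (U y) := fun y =>
    isOpen_iInter_of_finite fun r => (husc r).isOpen_preimage _
  have hK : IsCompact (Set.Icc (fun _ : Fin p => -B) fun _ => B) := isCompact_Icc
  obtain ⟨δ, hδ, hball⟩ := lebesgue_number_lemma_of_metric (c := U) hK hUo (fun y _ =>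
    Set.mem_iUnion.2 ⟨y, Set.mem_iInter.2 fun r => lt_add_of_pos_right _ hη0⟩)
  refine ⟨δ, hδ, fun y hy => ?_⟩
  set clip : (Fin p → ℝ) → (Fin p → ℝ) := fun y j => max (-B) (min B (y j)) with hclip
  have hclipmem : ∀ y, clip y ∈ Set.Icc (fun _ : Fin p => -B) fun _ => B := fun y =>
    ⟨fun j => le_max_left _ _, fun j => max_le (by linarith) (min_le_left _ _)⟩
  have hclipdist : ∀ y y' : Fin p → ℝ, ∀ j, |clip y j - clip y' j| ≤ |y j - y' j| := by
    intro y y' j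
    refine (abs_max_sub_max_le_max _ _ _ _).trans ?_
    simp only [sub_self, abs_zero]
    refine max_le (abs_nonneg _) ?_
    refine (abs_min_sub_min_le_max _ _ _ _).trans ?_
    simp
  have hgclip : ∀ r y, g r y ≤ g r (clip y) := by
    intro r y
    by_cases h : g r y = 0
    · rw [h]; exact zero_le
    · refine le_of_eq (hdep r _ _ fun j hj => ?_)
      have := abs_le.1 (hsupp r y h j hj)
      simp [hclip, this.1, this.2]
  obtain ⟨z, hz⟩ := hball _ (hclipmem (y fun _ => false))
  have hin : ∀ r, clip (y r) ∈ U z := by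
    intro r
    refine hz ?_
    rw [Metric.mem_ball, dist_pi_lt_iff hδ]
    intro j
    rw [Real.dist_eq]
    exact (hclipdist _ _ j).trans_lt (hy _ _ j)
  have hlt : ∀ r, (g r (y r) : ℝ) ≤ g r z + ε / m := by
    intro r
    have h1 : g r (clip (y r)) < g r z + η := Set.mem_iInter.1 (hin r) r
    have h2 := (hgclip r (y r)).trans h1.le
    have h3 : ((g r (y r) : ℝ≥0) : ℝ) ≤ ((g r z + η : ℝ≥0) : ℝ) := NNReal.coe_le_coe.2 h2
    rw [NNReal.coe_add] at h3
    exact h3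
  calc ∑ r, (g r (y r) : ℝ) ≤ ∑ r, ((g r z : ℝ) + ε / m) := Finset.sum_le_sum fun r _ => hlt r
    _ = ∑ r, (g r z : ℝ) + ε := by
        rw [Finset.sum_add_distrib, Finset.sum_const, Finset.card_univ, nsmul_eq_mul, ← hm]
        field_simp
    _ ≤ 1 + ε := by linarith [hsum z]

/-- The index of the cell of mesh `h` containing `y`, in a grid of `2 N + 1` cells around `x`;
the two extreme cells are unbounded, and `x` is the right end point of cell `N`. -/
noncomputable def gridCell (N : ℕ) (h x y : ℝ) : Fin (2 * N + 1) :=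
  ⟨(max 0 (min (2 * N : ℤ) (⌈(y - x) / h⌉ + N))).toNat, by omega⟩

theorem gridCell_val (N : ℕ) (h x y : ℝ) :
    ((gridCell N h x y : ℕ) : ℤ) = max 0 (min (2 * N : ℤ) (⌈(y - x) / h⌉ + N)) := by
  unfold gridCell
  exact Int.toNat_of_nonneg (le_max_left _ _)

theorem gridCell_mono (N : ℕ) {h : ℝ} (hh : 0 < h) (x : ℝ) : Monotone (gridCell N h x) := by
  intro y y' hy
  have h1 : ⌈(y - x) / h⌉ ≤ ⌈(y' - x) / h⌉ := Int.ceil_mono (by gcongr)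
  have h2 := gridCell_val N h x y
  have h3 := gridCell_val N h x y'
  rw [Fin.le_def]
  omega

theorem gridCell_le_iff {N : ℕ} (hN : 0 < N) {h : ℝ} (hh : 0 < h) (x y : ℝ) :
    y ≤ x ↔ gridCell N h x y ≤ ⟨N, by omega⟩ := by
  have h1 : y ≤ x ↔ ⌈(y - x) / h⌉ ≤ 0 := by
    rw [Int.ceil_le]
    simp only [Int.cast_zero]
    rw [div_le_iff₀ hh]
    constructor <;> intro h <;> linarith
  have h2 := gridCell_val N h x y
  rw [h1, Fin.le_def]
  simp only
  omega

theorem gridCell_dist_le {N : ℕ} {h x y : ℝ} (hh : 0 < h) (hN : |y - x| / h ≤ N) :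
    |y - (x + h * (((gridCell N h x y : ℕ) : ℝ) - N))| ≤ h := by
  have h2 := gridCell_val N h x y
  have ha : |(y - x) / h| ≤ N := by rwa [abs_div, abs_of_pos hh]
  have hb := abs_le.1 ha
  have h3 : -(N : ℤ) ≤ ⌈(y - x) / h⌉ := by
    have h5 := Int.le_ceil ((y - x) / h)
    have : (-(N : ℤ) : ℝ) ≤ (⌈(y - x) / h⌉ : ℝ) := by push_cast; linarith
    exact_mod_cast this
  have h4 : ⌈(y - x) / h⌉ ≤ N := Int.ceil_le.2 (by push_cast; exact hb.2)
  have h5 : ((gridCell N h x y : ℕ) : ℤ) = ⌈(y - x) / h⌉ + N := by omega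
  have h6 : (((gridCell N h x y : ℕ) : ℝ)) = (⌈(y - x) / h⌉ : ℝ) + N := by exact_mod_cast h5
  rw [h6]
  have h7 := Int.le_ceil ((y - x) / h)
  have h8 := Int.ceil_lt_add_one ((y - x) / h)
  have h9 : y - x = h * ((y - x) / h) := by field_simp
  have h10 : y - (x + h * ((⌈(y - x) / h⌉ : ℝ) + N - N))
      = h * ((y - x) / h - ⌈(y - x) / h⌉) := by
    linear_combination h9
  rw [h10, abs_mul, abs_of_pos hh]
  refine mul_le_of_le_one_right hh.le (abs_le.2 ⟨by linarith, by linarith⟩)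

/-- A finite grid in each column, with `x j` among its cut points, together with a positive
"mechanism" `kh` depending on the data only through the grid cells of the observed coordinates. It
has total mass at most `1 + ε` at every cell, it is so close to `κ` that the likelihood ratio
`κ / kh` has mean at most `1 + ε`, and for complete cases it exceeds `κ` by little. -/
theorem MissingAtRandom.exists_grid_mechanism {p : ℕ} {κ : Kernel (Fin p → ℝ) (Pattern p)}
    [IsMarkovKernel κ] (hMAR : MissingAtRandom κ) (μ : Measure (Fin p → ℝ))
    [IsProbabilityMeasure μ] (x : Fin p → ℝ) {ε : ℝ} (hε : 0 < ε) :
    ∃ (N : ℕ) (ζ : Fin p → ℝ → Fin (N + 1)) (v : Fin p → Fin (N + 1))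
      (kh : Pattern p → (Fin p → Fin (N + 1)) → ℝ),
      (∀ j, Monotone (ζ j)) ∧ (∀ j y, y ≤ x j ↔ ζ j y ≤ v j) ∧ (∀ r c, 0 < kh r c) ∧
      (∀ r c c', (∀ j, r j = false → c j = c' j) → kh r c = kh r c') ∧
      (∀ c, ∑ r, kh r c ≤ 1 + ε) ∧
      ∫⁻ y, ∑ r, κ y {r} * (κ y {r} / ENNReal.ofReal (kh r fun j => ζ j (y j))) ∂μ
        ≤ ENNReal.ofReal (1 + ε) ∧
      ∫⁻ y, (ENNReal.ofReal (kh (fun _ => false) fun j => ζ j (y j)) - κ y {fun _ => false}) ∂μ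
        ≤ ENNReal.ofReal ε := by
  classical
  set m : ℝ := ((Fintype.card (Pattern p) : ℕ) : ℝ) with hm
  have hm1 : 1 ≤ m := by
    rw [hm]; exact_mod_cast Nat.one_le_iff_ne_zero.2 Fintype.card_ne_zero
  have hm0 : 0 < m := by linarith
  set e : ℝ := ε / (4 * m) with he
  have he0 : 0 < e := by positivity
  have hme : m * e = ε / 4 := by rw [he]; field_simp
  set d : ℝ := min (e * ε) (ε / 4) / (2 * m) with hd
  have hd0 : 0 < d := by positivity
  have hd1 : m * (2 * d) ≤ e * ε := by
    have : m * (2 * d) = min (e * ε) (ε / 4) := by rw [hd]; field_simp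
    rw [this]; exact min_le_left _ _
  have hd2 : m * (2 * d) ≤ ε / 4 := by
    have : m * (2 * d) = min (e * ε) (ε / 4) := by rw [hd]; field_simp
    rw [this]; exact min_le_right _ _
  -- the data are essentially bounded
  obtain ⟨B, hB0, hB⟩ : ∃ B : ℝ, 0 ≤ B ∧ μ {y | ∃ j, B < |y j|} ≤ ENNReal.ofReal d := by
    have hanti : Antitone fun n : ℕ => {y : Fin p → ℝ | ∃ j, (n : ℝ) < |y j|} := by
      rintro a b hab y ⟨j, hj⟩
      exact ⟨j, lt_of_le_of_lt (by exact_mod_cast hab) hj⟩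
    have hmeas : ∀ n : ℕ, NullMeasurableSet {y : Fin p → ℝ | ∃ j, (n : ℝ) < |y j|} μ := by
      intro n
      have : {y : Fin p → ℝ | ∃ j, (n : ℝ) < |y j|} = ⋃ j, {y | (n : ℝ) < |y j|} := by ext y; simp
      rw [this]
      exact (MeasurableSet.iUnion fun j =>
        measurableSet_lt measurable_const (by fun_prop)).nullMeasurableSet
    have hlim := tendsto_measure_iInter_atTop (μ := μ) hmeas hanti ⟨0, measure_ne_top _ _⟩
    have hempty : (⋂ n : ℕ, {y : Fin p → ℝ | ∃ j, (n : ℝ) < |y j|}) = ∅ := by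
      ext y
      simp only [Set.mem_iInter, Set.mem_ofPred_eq, Set.mem_empty_iff_false, iff_false, not_forall,
        not_exists, not_lt]
      obtain ⟨n, hn⟩ := exists_nat_ge (∑ j, |y j|)
      exact ⟨n, fun j => (Finset.single_le_sum (f := fun j => |y j|)
        (fun _ _ => abs_nonneg _) (Finset.mem_univ j)).trans hn⟩
    rw [hempty, measure_empty] at hlim
    obtain ⟨n, hn⟩ := (hlim.eventually (ge_mem_nhds (ENNReal.ofReal_pos.2 hd0))).exists
    exact ⟨n, Nat.cast_nonneg n, hn⟩
  -- `g` loses so little mass, namely `m * (2 * d)`, that this loss divided by `e` is still small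
  choose g husc hgκ hdep hsupp hgint using fun r =>
    hMAR.exists_usc_minorant μ (ENNReal.ofReal_pos.2 hd0).ne' hB r
  set k : Pattern p → (Fin p → ℝ) → ℝ := fun r y => (κ y {r}).toReal with hk
  have hkof : ∀ r y, κ y {r} = ENNReal.ofReal (k r y) := fun r y =>
    (ENNReal.ofReal_toReal (measure_ne_top _ _)).symm
  have hgof : ∀ r y, (g r y : ℝ≥0∞) = ENNReal.ofReal (g r y : ℝ) := fun r y =>
    (ENNReal.ofReal_coe_nnreal).symm
  have hgk : ∀ r y, (g r y : ℝ) ≤ k r y := fun r y => by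
    have := ENNReal.toReal_mono (measure_ne_top _ _) (hgκ r y)
    simpa using this
  have hk0 : ∀ r y, 0 ≤ k r y := fun r y => ENNReal.toReal_nonneg
  have hksum : ∀ y, ∑ r, k r y = 1 := by
    intro y
    have h1 : ∑ r, κ y {r} = 1 := by
      rw [sum_measure_singleton, Finset.coe_univ, measure_univ]
    simp only [hk]
    rw [← ENNReal.toReal_sum fun r _ => measure_ne_top _ _, h1, ENNReal.toReal_one]
  have hk1 : ∀ r y, k r y ≤ 1 := fun r y => by
    rw [← hksum y]
    exact Finset.single_le_sum (f := fun r => k r y) (fun r _ => hk0 r y) (Finset.mem_univ r)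
  have hgsum : ∀ y, ∑ r, (g r y : ℝ) ≤ 1 := fun y =>
    (Finset.sum_le_sum fun r _ => hgk r y).trans (hksum y).le
  obtain ⟨δ, hδ, hunif⟩ := exists_uniform_sum_le hB0 husc hgsum hdep hsupp
    (show 0 < ε / 4 by positivity)
  set h : ℝ := δ / 4 with hh
  have hh0 : 0 < h := by positivity
  obtain ⟨N, hN'⟩ := exists_nat_ge ((B + ∑ j, |x j|) / h + 1)
  have hN : (B + ∑ j, |x j|) / h ≤ N := by linarith
  have hN0 : 0 < N := by
    have : 0 ≤ (B + ∑ j, |x j|) / h :=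
      div_nonneg (add_nonneg hB0 (Finset.sum_nonneg fun j _ => abs_nonneg _)) hh0.le
    have : (0 : ℝ) < N := by linarith
    exact_mod_cast this
  -- `S r c` is the supremum of `g r` over a box around the cell `c`
  set cen : (Fin p → Fin (2 * N + 1)) → Fin p → ℝ := fun c j =>
    x j + h * (((c j : ℕ) : ℝ) - N) with hcen
  set box : (Fin p → Fin (2 * N + 1)) → Set (Fin p → ℝ) := fun c =>
    {y | ∀ j, |y j - cen c j| ≤ h} with hbox
  have hcenmem : ∀ c, cen c ∈ box c := fun c j => by simp [hh0.le]
  set S : Pattern p → (Fin p → Fin (2 * N + 1)) → ℝ := fun r c =>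
    sSup ((fun y => (g r y : ℝ)) '' box c) with hS
  have hbdd : ∀ r c, BddAbove ((fun y => (g r y : ℝ)) '' box c) := fun r c =>
    ⟨1, by rintro _ ⟨y, -, rfl⟩; exact (hgk r y).trans (hk1 r y)⟩
  have hne : ∀ r c, ((fun y => (g r y : ℝ)) '' box c).Nonempty := fun r c =>
    ⟨_, ⟨cen c, hcenmem c, rfl⟩⟩
  have hS0 : ∀ r c, 0 ≤ S r c := fun r c =>
    le_csSup_of_le (hbdd r c) ⟨cen c, hcenmem c, rfl⟩ (NNReal.coe_nonneg _)
  have hSsum : ∀ c, ∑ r, S r c ≤ 1 + ε / 2 := by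
    intro c
    have hex : ∀ r, ∃ y ∈ box c, S r c - e < g r y := by
      intro r
      obtain ⟨_, ⟨y, hy, rfl⟩, hlt⟩ := exists_lt_of_lt_csSup (hne r c) (sub_lt_self (S r c) he0)
      exact ⟨y, hy, hlt⟩
    choose y hy hlt using hex
    have h1 := hunif y fun r r' j => by
      have h1 := hy r j
      have h2 := hy r' j
      rw [abs_sub_comm] at h2
      have : y r j - y r' j = (y r j - cen c j) + (cen c j - y r' j) := by ring
      rw [this]
      refine (abs_add_le _ _).trans_lt ?_
      rw [hh] at h1 h2
      linarith
    have h2 : ∑ r, (S r c - e) ≤ ∑ r, (g r (y r) : ℝ) :=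
      Finset.sum_le_sum fun r _ => (hlt r).le
    rw [Finset.sum_sub_distrib, Finset.sum_const, Finset.card_univ, nsmul_eq_mul, ← hm, hme] at h2
    linarith
  set ζ : Fin p → ℝ → Fin (2 * N + 1) := fun j => gridCell N h (x j) with hζ
  have hgS : ∀ r y, (g r y : ℝ) ≤ S r fun j => ζ j (y j) := by
    intro r y
    by_cases h0 : g r y = 0
    · rw [h0]; exact hS0 _ _
    · set y' : Fin p → ℝ := fun j => if r j = false then y j else cen (fun j => ζ j (y j)) j with hy'
      have hgy : g r y = g r y' := hdep r _ _ fun j hj => by simp [hy', hj]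
      rw [hgy]
      refine le_csSup (hbdd _ _) ⟨y', fun j => ?_, rfl⟩
      by_cases hj : r j = false
      · have hyj : y' j = y j := by simp [hy', hj]
        rw [hyj]
        refine gridCell_dist_le hh0 (le_trans ?_ hN)
        gcongr
        have h1 := hsupp r y h0 j hj
        have h2 := Finset.single_le_sum (f := fun j => |x j|) (fun _ _ => abs_nonneg _)
          (Finset.mem_univ j)
        refine (abs_sub _ _).trans (add_le_add h1 h2)
      · have hyj : y' j = cen (fun j => ζ j (y j)) j := by simp [hy', hj]
        rw [hyj]; simp [hh0.le]
  -- the shift by `e` keeps the likelihood ratio bounded by `1 + (κ - g) / e`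
  set kh : Pattern p → (Fin p → Fin (2 * N + 1)) → ℝ := fun r c => e + S r c with hkh
  have hkhpos : ∀ r c, 0 < kh r c := fun r c => add_pos_of_pos_of_nonneg he0 (hS0 r c)
  have hkhsum : ∀ c, ∑ r, kh r c ≤ 1 + 3 * ε / 4 := by
    intro c
    simp only [hkh, Finset.sum_add_distrib, Finset.sum_const, Finset.card_univ, nsmul_eq_mul]
    rw [← hm, hme]
    linarith [hSsum c]
  have hint : ∫⁻ y, ∑ r, (κ y {r} - g r y) ∂μ ≤ ENNReal.ofReal (m * (2 * d)) := by
    rw [lintegral_finsetSum]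
    · refine (Finset.sum_le_sum fun r _ => hgint r).trans ?_
      rw [Finset.sum_const, Finset.card_univ, nsmul_eq_mul, hm,
        ENNReal.ofReal_mul (Nat.cast_nonneg _), ENNReal.ofReal_natCast,
        ENNReal.ofReal_mul (by norm_num)]
      simp
    · intro r _
      exact (κ.measurable_coe (measurableSet_singleton r)).sub
        (husc r).measurable.coe_nnreal_ennreal
  refine ⟨2 * N, ζ, fun _ => ⟨N, by omega⟩, kh, fun j => gridCell_mono N hh0 (x j),
    fun j y => gridCell_le_iff hN0 hh0 (x j) y, hkhpos, fun r c c' hcc => ?_,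
    fun c => (hkhsum c).trans (by linarith), ?_, ?_⟩
  · have himg : ∀ c c' : Fin p → Fin (2 * N + 1), (∀ j, r j = false → c j = c' j) →
        (fun y => (g r y : ℝ)) '' box c ⊆ (fun y => (g r y : ℝ)) '' box c' := by
      rintro c c' hcc _ ⟨y, hy, rfl⟩
      refine ⟨fun j => if r j = false then y j else cen c' j, fun j => ?_, ?_⟩
      · by_cases hj : r j = false
        · have := hy j
          simp only [hcen, hcc j hj] at this
          simpa [hj] using this
        · simp [hj, hh0.le]
      · simp only
        rw [hdep r _ y fun j hj => by simp [hj]]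
    simp only [hkh, hS]
    rw [(himg c c' hcc).antisymm (himg c' c fun j hj => (hcc j hj).symm)]
  · have hpt : ∀ y, ∑ r, κ y {r} * (κ y {r} / ENNReal.ofReal (kh r fun j => ζ j (y j)))
        ≤ 1 + ENNReal.ofReal e⁻¹ * ∑ r, (κ y {r} - g r y) := by
      intro y
      have h1 : ∑ r, κ y {r} = 1 := by
        rw [sum_measure_singleton, Finset.coe_univ, measure_univ]
      rw [← h1, Finset.mul_sum, ← Finset.sum_add_distrib]
      refine Finset.sum_le_sum fun r _ => ?_
      rw [hkof, hgof, ← ENNReal.ofReal_div_of_pos (hkhpos _ _), ← ENNReal.ofReal_mul (hk0 _ _),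
        ← ENNReal.ofReal_sub _ (NNReal.coe_nonneg _), ← ENNReal.ofReal_mul (by positivity),
        ← ENNReal.ofReal_add (hk0 _ _)
          (mul_nonneg (by positivity) (sub_nonneg.2 (hgk r y)))]
      refine ENNReal.ofReal_le_ofReal ?_
      set K := kh r fun j => ζ j (y j) with hK
      have hKg : (g r y : ℝ) + e ≤ K := by
        have := hgS r y
        simp only [hK, hkh]; linarith
      have hg0 : (0 : ℝ) ≤ g r y := NNReal.coe_nonneg _
      have hK0 : 0 < K := by linarith
      have hstep : k r y * (k r y / K) ≤ k r y * (1 + e⁻¹ * (k r y - g r y)) := by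
        refine mul_le_mul_of_nonneg_left ?_ (hk0 r y)
        rw [div_le_iff₀ hK0]
        have hKe : 1 ≤ e⁻¹ * K := by
          rw [inv_mul_eq_div, le_div_iff₀ he0]; linarith
        have hgk' := sub_nonneg.2 (hgk r y)
        have : (k r y - g r y) * 1 ≤ (k r y - g r y) * (e⁻¹ * K) :=
          mul_le_mul_of_nonneg_left hKe hgk'
        have e1 : (1 + e⁻¹ * (k r y - g r y)) * K = K + (k r y - g r y) * (e⁻¹ * K) := by ring
        rw [e1]
        linarith
      refine hstep.trans ?_
      rw [mul_add, mul_one]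
      have hnn : 0 ≤ e⁻¹ * (k r y - g r y) := mul_nonneg (by positivity) (sub_nonneg.2 (hgk r y))
      have := mul_le_of_le_one_left hnn (hk1 r y)
      linarith
    refine (lintegral_mono hpt).trans ?_
    rw [lintegral_add_left measurable_const, lintegral_const_mul', lintegral_one, measure_univ,
      ENNReal.ofReal_add zero_le_one hε.le, ENNReal.ofReal_one]
    · refine add_le_add le_rfl ((mul_le_mul_right hint _).trans ?_)
      rw [← ENNReal.ofReal_mul (by positivity)]
      refine ENNReal.ofReal_le_ofReal ?_
      rw [inv_mul_le_iff₀ he0]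
      exact hd1
    · exact ENNReal.ofReal_ne_top
  · have hpt : ∀ y, ENNReal.ofReal (kh (fun _ => false) fun j => ζ j (y j)) - κ y {fun _ => false}
        ≤ ENNReal.ofReal (3 * ε / 4) + ∑ r, (κ y {r} - g r y) := by
      intro y
      have h1 : ∀ r, κ y {r} - g r y = ENNReal.ofReal (k r y - g r y) := fun r => by
        rw [hkof, hgof, ← ENNReal.ofReal_sub _ (NNReal.coe_nonneg _)]
      simp only [h1]
      rw [← ENNReal.ofReal_sum_of_nonneg fun r _ => sub_nonneg.2 (hgk r y), hkof,
        ← ENNReal.ofReal_sub _ (hk0 _ _), ← ENNReal.ofReal_add (by positivity)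
          (Finset.sum_nonneg fun r _ => sub_nonneg.2 (hgk r y))]
      refine ENNReal.ofReal_le_ofReal ?_
      set r₀ : Pattern p := fun _ => false with hr₀
      have h2 := hkhsum fun j => ζ j (y j)
      have h3 := hksum y
      rw [← Finset.add_sum_erase _ _ (Finset.mem_univ r₀)] at h2 h3
      rw [← Finset.add_sum_erase _ (fun r => k r y - (g r y : ℝ)) (Finset.mem_univ r₀)]
      have h4 : ∑ r ∈ Finset.univ.erase r₀, (g r y : ℝ)
          ≤ ∑ r ∈ Finset.univ.erase r₀, kh r fun j => ζ j (y j) :=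
        Finset.sum_le_sum fun r _ => by
          have := hgS r y
          simp only [hkh]; linarith
      rw [Finset.sum_sub_distrib]
      have h5 := sub_nonneg.2 (hgk r₀ y)
      linarith
    refine (lintegral_mono hpt).trans ?_
    rw [lintegral_add_left measurable_const, lintegral_const, measure_univ, mul_one]
    refine (add_le_add le_rfl hint).trans ?_
    rw [← ENNReal.ofReal_add (by positivity) (by positivity)]
    exact ENNReal.ofReal_le_ofReal (by linarith)

/-! ### Counting the rank structures compatible with given latent values -/

/-- The discretized data of `n` rows seen by the rank likelihood: the missingness patterns, the grid
cells of the entries, and the strict orders within the columns. -/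
abbrev RankData (p N n : ℕ) : Type :=
  (Fin n → Pattern p) × (Fin n → Fin p → Fin (N + 1)) × (Fin p → Fin n → Fin n → Bool)

/-- The cells of a row, with the cell of a missing entry replaced by `0`. -/
def maskCell {p N : ℕ} (r : Pattern p) (c : Fin p → Fin (N + 1)) : Fin p → Fin (N + 1) :=
  fun j => if r j then 0 else c j

theorem maskCell_of_observed {p N : ℕ} {r : Pattern p} {j : Fin p} (c : Fin p → Fin (N + 1))
    (h : r j = false) : maskCell r c j = c j := by
  simp [maskCell, h]

open Classical in
/-- The discretized data of `n` rows; the order only relates observed entries, and the cells of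
missing entries are masked. -/
noncomputable def rankData {p N n : ℕ} (ζ : Fin p → ℝ → Fin (N + 1))
    (y : Fin n → (Fin p → ℝ) × Pattern p) : RankData p N n :=
  (fun i => (y i).2, fun i => maskCell (y i).2 fun j => ζ j ((y i).1 j),
    fun j i k => decide ((y i).2 j = false ∧ (y k).2 j = false ∧ (y i).1 j < (y k).1 j))

/-- The latent values which respect the strict orders `o` in the columns. -/
def orderEvent {p n : ℕ} (o : Fin p → Fin n → Fin n → Bool) :
    Set (Fin n → EuclideanSpace ℝ (Fin p)) :=
  {z | ∀ j i k, o j i k = true → z i j < z k j}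

theorem measurableSet_orderEvent {p n : ℕ} (o : Fin p → Fin n → Fin n → Bool) :
    MeasurableSet (orderEvent o) := by
  have : orderEvent o = ⋂ j, ⋂ i, ⋂ k, {z | o j i k = true → z i j < z k j} := by
    ext z; simp [orderEvent]
  rw [this]
  refine MeasurableSet.iInter fun j => MeasurableSet.iInter fun i => MeasurableSet.iInter fun k => ?_
  by_cases h : o j i k = true
  · simp only [h, forall_const]
    exact measurableSet_lt (by fun_prop) (by fun_prop)
  · simp [h]

theorem rankEvent_eq_orderEvent {p N : ℕ} (ζ : Fin p → ℝ → Fin (N + 1)) (n : ℕ)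
    (ω : ℕ → (Fin p → ℝ) × Pattern p) :
    rankEvent n ω = orderEvent (rankData ζ fun i : Fin n => ω i).2.2 := by
  ext z
  simp [rankEvent, orderEvent, rankData]

open Classical in
/-- The number of values that occur in at least two rows of column `j`. -/
noncomputable def tieCount {p n : ℕ} (y : Fin n → (Fin p → ℝ) × Pattern p) (j : Fin p) : ℕ :=
  ((Finset.univ.filter fun i => ∃ k, k ≠ i ∧ (y k).1 j = (y i).1 j).image fun i => (y i).1 j).card

open Classical in
/-- The assignments of cells to the entries that are nondecreasing in the latent values. -/
noncomputable def monotoneCells {p n : ℕ} (N : ℕ) (Z : Fin n → EuclideanSpace ℝ (Fin p)) :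
    Finset (Fin n → Fin p → Fin (N + 1)) :=
  Finset.univ.filter fun c => ∀ j i k, Z i j ≤ Z k j → c i j ≤ c k j

open Classical in
/-- The rank structure rebuilt from latent values `Z`, patterns `r`, cells `c` and, in each column,
the sets `T` and `U` of the rows which come first and last in the order of `Z` among the rows with
the same value: an observed pair of rows is tied if it lies between such a first row and every last
row following it. -/
noncomputable def decodeRankData {p N n : ℕ} (Z : Fin n → EuclideanSpace ℝ (Fin p))
    (r : Fin n → Pattern p) (T U : Fin p → Finset (Fin n)) (c : Fin n → Fin p → Fin (N + 1)) :
    RankData p N n :=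
  (r, fun i => maskCell (r i) (c i), fun j i k =>
    decide (r i j = false ∧ r k j = false ∧ Z i j < Z k j ∧
      ¬ ∃ t ∈ T j, Z t j ≤ Z i j ∧ ∀ u ∈ U j, Z t j ≤ Z u j → Z k j ≤ Z u j))

open Classical in
/-- A set of tied rows with at most one row for each value has at most `tieCount` elements. -/
theorem card_tied_representatives_le {p n : ℕ} (y : Fin n → (Fin p → ℝ) × Pattern p) (j : Fin p)
    (f : ℝ → Fin n → Prop) (hf : ∀ a i i', f a i → f a i' → i = i') :
    (Finset.univ.filter fun i => f ((y i).1 j) i ∧ ∃ k, k ≠ i ∧ (y k).1 j = (y i).1 j).card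
      ≤ tieCount y j := by
  refine Finset.card_le_card_of_injOn (fun i => (y i).1 j) (fun i hi => ?_) fun i hi i' hi' h => ?_
  · simp only [Finset.coe_filter, Finset.mem_univ, true_and] at hi
    exact Finset.mem_coe.2 (Finset.mem_image_of_mem _ (by simpa using hi.2))
  · simp only [Finset.coe_filter, Finset.mem_univ, true_and] at hi hi'
    have h1 := hi'.1
    rw [← show (y i).1 j = (y i').1 j from h] at h1
    exact hf _ _ _ hi.1 h1

/-- Latent values in the rank event determine the rank structure up to monotone cells and the first
and last rows among tied ones. -/
theorem exists_decodeRankData_eq {p N n : ℕ} {ζ : Fin p → ℝ → Fin (N + 1)}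
    (hζ : ∀ j, Monotone (ζ j)) (y : Fin n → (Fin p → ℝ) × Pattern p)
    {Z : Fin n → EuclideanSpace ℝ (Fin p)} (hZ : Z ∈ orderEvent (rankData ζ y).2.2) :
    ∃ (T U : Fin p → Finset (Fin n)), ∃ c ∈ monotoneCells N Z,
      (∀ j, (T j).card ≤ tieCount y j) ∧ (∀ j, (U j).card ≤ tieCount y j) ∧
      decodeRankData Z (fun i => (y i).2) T U c = rankData ζ y := by
  classical
  have hord : ∀ j i k, (y i).2 j = false → (y k).2 j = false → (y i).1 j < (y k).1 j →
      Z i j < Z k j := fun j i k hi hk h => hZ j i k (by simp [rankData, hi, hk, h])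
  have hle : ∀ j i k, (y i).2 j = false → (y k).2 j = false → Z i j ≤ Z k j →
      (y i).1 j ≤ (y k).1 j := fun j i k hi hk h => by
    by_contra hcon
    exact absurd (hord j k i hk hi (not_le.1 hcon)) (not_lt.2 h)
  have hfst : ∀ (j : Fin p) (a : ℝ) (_ : ∃ i, (y i).2 j = false ∧ (y i).1 j = a),
      ∃ t, ((y t).2 j = false ∧ (y t).1 j = a) ∧
        ∀ i, (y i).2 j = false → (y i).1 j = a → Z t j ≤ Z i j := by
    rintro j a ⟨i, hi⟩
    obtain ⟨t, ht, hmin⟩ := Finset.exists_min_image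
      (Finset.univ.filter fun i => (y i).2 j = false ∧ (y i).1 j = a) (fun i => Z i j)
      ⟨i, by simpa using hi⟩
    simp only [Finset.mem_filter, Finset.mem_univ, true_and] at ht hmin
    exact ⟨t, ht, fun i h1 h2 => hmin i ⟨h1, h2⟩⟩
  have hlst : ∀ (j : Fin p) (a : ℝ) (_ : ∃ i, (y i).2 j = false ∧ (y i).1 j = a),
      ∃ u, ((y u).2 j = false ∧ (y u).1 j = a) ∧
        ∀ i, (y i).2 j = false → (y i).1 j = a → Z i j ≤ Z u j := by
    rintro j a ⟨i, hi⟩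
    obtain ⟨t, ht, hmax⟩ := Finset.exists_max_image
      (Finset.univ.filter fun i => (y i).2 j = false ∧ (y i).1 j = a) (fun i => Z i j)
      ⟨i, by simpa using hi⟩
    simp only [Finset.mem_filter, Finset.mem_univ, true_and] at ht hmax
    exact ⟨t, ht, fun i h1 h2 => hmax i ⟨h1, h2⟩⟩
  choose t ht htmin using hfst
  choose u hu humax using hlst
  refine ⟨fun j => Finset.univ.filter fun i => (∃ h, t j ((y i).1 j) h = i) ∧
      ∃ k, k ≠ i ∧ (y k).1 j = (y i).1 j,
    fun j => Finset.univ.filter fun i => (∃ h, u j ((y i).1 j) h = i) ∧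
      ∃ k, k ≠ i ∧ (y k).1 j = (y i).1 j,
    fun i j => (Finset.univ.filter fun k => (y k).2 j = false ∧ Z k j ≤ Z i j).sup
      fun k => ζ j ((y k).1 j), ?_, fun j => ?_, fun j => ?_, ?_⟩
  · simp only [monotoneCells, Finset.mem_filter, Finset.mem_univ, true_and]
    intro j i k hik
    refine Finset.sup_mono fun m hm => ?_
    simp only [Finset.mem_filter, Finset.mem_univ, true_and] at hm ⊢
    exact ⟨hm.1, hm.2.trans hik⟩
  · convert card_tied_representatives_le y j (fun a i => ∃ h, t j a h = i)
      (by rintro a i i' ⟨h, rfl⟩ ⟨h', rfl⟩; rfl)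
  · convert card_tied_representatives_le y j (fun a i => ∃ h, u j a h = i)
      (by rintro a i i' ⟨h, rfl⟩ ⟨h', rfl⟩; rfl)
  · refine Prod.ext rfl (Prod.ext ?_ ?_)
    · funext i
      funext j
      by_cases hij : (y i).2 j = false
      · simp only [decodeRankData, rankData]
        rw [maskCell_of_observed _ hij, maskCell_of_observed _ hij]
        refine le_antisymm (Finset.sup_le fun k hk => ?_)
          (Finset.le_sup (f := fun k => ζ j ((y k).1 j)) (by simp [hij]))
        simp only [Finset.mem_filter, Finset.mem_univ, true_and] at hk
        exact hζ j (hle j k i hk.1 hij hk.2)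
      · simp only [Bool.not_eq_false] at hij
        simp [decodeRankData, rankData, maskCell, hij]
    · funext j i k
      simp only [decodeRankData, rankData, decide_eq_decide, Finset.mem_filter, Finset.mem_univ,
        true_and]
      -- the representative of a value shared by two rows is itself tied
      have htied : ∀ i k m : Fin n, i ≠ k → (y i).1 j = (y k).1 j → (y m).1 j = (y i).1 j →
          ∃ l, l ≠ m ∧ (y l).1 j = (y m).1 j := by
        intro i k m hik h1 h2
        by_cases him : i = m
        · exact ⟨k, fun h => hik (him.trans h.symm), by rw [h2, h1]⟩
        · exact ⟨i, him, h2.symm⟩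
      constructor
      · rintro ⟨hi, hk, hik, hno⟩
        refine ⟨hi, hk, lt_of_le_of_ne (hle j i k hi hk hik.le) fun heq => hno ?_⟩
        have hne : i ≠ k := fun h => by simp [h] at hik
        -- the first row with the common value of the rows `i` and `k` separates them from no last row
        have hex : ∃ m, (y m).2 j = false ∧ (y m).1 j = (y i).1 j := ⟨i, hi, rfl⟩
        obtain ⟨h1, h2⟩ := ht j _ hex
        refine ⟨t j _ hex, ⟨⟨⟨i, hi, h2.symm⟩, ?_⟩, htied i k _ hne heq h2⟩,
          htmin j _ hex i hi rfl, ?_⟩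
        · congr 1
        · rintro u' ⟨⟨hex', hu'⟩, -⟩ htu
          obtain ⟨h3, -⟩ := hu j _ hex'
          rw [hu'] at h3
          have h5 : (y i).1 j ≤ (y u').1 j := by
            rw [← h2]; exact hle j _ _ h1 h3 htu
          rcases h5.lt_or_eq with h5 | h5
          · exact (hord j k u' hk h3 (by rw [← heq]; exact h5)).le
          · have := humax j _ hex' k hk (by rw [← heq, h5])
            rwa [hu'] at this
      · rintro ⟨hi, hk, hlt⟩
        refine ⟨hi, hk, hord j i k hi hk hlt, ?_⟩
        rintro ⟨t', ⟨⟨hex, ht'⟩, hti⟩, hle1, hall⟩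
        obtain ⟨h1, -⟩ := ht j _ hex
        rw [ht'] at h1
        obtain ⟨h3, h4⟩ := hu j _ hex
        -- the last row with the value of `t'` comes after `k`, so that `i` and `k` are squeezed
        obtain ⟨l, hl, hl'⟩ := hti
        have hku : Z k j ≤ Z (u j _ hex) j := by
          refine hall _ ⟨⟨⟨t', h1, h4.symm⟩, ?_⟩, htied t' l _ hl.symm hl'.symm h4⟩
            (humax j _ hex t' h1 rfl)
          congr 1
        have h6 := hle j k _ hk h3 hku
        have h7 := hle j t' i h1 hi hle1
        rw [h4] at h6
        exact absurd (h6.trans h7) (not_le.2 hlt)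

open Classical in
/-- The families of sets of rows, one for each column, with at most `δ n` elements each. -/
noncomputable def smallTieSets (p n : ℕ) (δ : ℝ) : Finset (Fin p → Finset (Fin n)) :=
  Finset.univ.filter fun U => ∀ j, ((U j).card : ℝ) ≤ δ * n

open Classical in
/-- A sum over the rank structures compatible with `Z` is at most a sum over monotone cells and
arbitrary patterns, times the number of ways to place the ties. -/
theorem sum_rankData_le {p N n : ℕ} {ζ : Fin p → ℝ → Fin (N + 1)}
    (hζ : ∀ j, Monotone (ζ j)) {δ : ℝ} (G : Finset (RankData p N n))
    (hG : ∀ s ∈ G, ∃ y, s = rankData ζ y ∧ ∀ j, (tieCount y j : ℝ) ≤ δ * n)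
    (Z : Fin n → EuclideanSpace ℝ (Fin p))
    (f : (Fin n → Pattern p) → (Fin n → Fin p → Fin (N + 1)) → ℝ) (hf0 : ∀ r c, 0 ≤ f r c)
    (hf : ∀ r c, f r (fun i => maskCell (r i) (c i)) = f r c) :
    ∑ s ∈ G with Z ∈ orderEvent s.2.2, f s.1 s.2.1
      ≤ ((smallTieSets p n δ).card : ℝ) ^ 2 * ∑ c ∈ monotoneCells N Z, ∑ r, f r c := by
  set D : Finset ((((Fin p → Finset (Fin n)) × (Fin p → Finset (Fin n))) ×
    (Fin n → Fin p → Fin (N + 1))) × (Fin n → Pattern p)) :=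
    ((smallTieSets p n δ ×ˢ smallTieSets p n δ) ×ˢ monotoneCells N Z) ×ˢ Finset.univ with hD
  have hsub : (G.filter fun s => Z ∈ orderEvent s.2.2)
      ⊆ D.image fun x => decodeRankData Z x.2 x.1.1.1 x.1.1.2 x.1.2 := by
    intro s hs
    obtain ⟨hsG, hsZ⟩ := Finset.mem_filter.1 hs
    obtain ⟨y, rfl, hy⟩ := hG s hsG
    obtain ⟨T, U, c, hc, hT, hU, hdec⟩ := exists_decodeRankData_eq hζ y hsZ
    refine Finset.mem_image.2 ⟨(((T, U), c), fun i => (y i).2), ?_, hdec⟩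
    simp only [hD, Finset.mem_product, Finset.mem_univ, and_true]
    refine ⟨?_, hc⟩
    simp only [smallTieSets, Finset.mem_filter, Finset.mem_univ, true_and]
    exact ⟨fun j => (Nat.cast_le.2 (hT j)).trans (hy j),
      fun j => (Nat.cast_le.2 (hU j)).trans (hy j)⟩
  set dec : (((Fin p → Finset (Fin n)) × (Fin p → Finset (Fin n))) ×
    (Fin n → Fin p → Fin (N + 1))) × (Fin n → Pattern p) → RankData p N n := fun x =>
    decodeRankData Z x.2 x.1.1.1 x.1.1.2 x.1.2 with hdec
  calc ∑ s ∈ G with Z ∈ orderEvent s.2.2, f s.1 s.2.1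
      ≤ ∑ s ∈ D.image dec, f s.1 s.2.1 :=
        Finset.sum_le_sum_of_subset_of_nonneg hsub fun _ _ _ => hf0 _ _
    _ ≤ ∑ x ∈ D, f (dec x).1 (dec x).2.1 :=
        Finset.sum_image_le_of_nonneg fun _ _ => hf0 _ _
    _ = ∑ x ∈ D, f x.2 x.1.2 := Finset.sum_congr rfl fun x _ => hf _ _
    _ = _ := by
        rw [hD, Finset.sum_product, Finset.sum_product]
        simp only [Finset.sum_const, nsmul_eq_mul, Finset.card_product, Nat.cast_mul, sq]

/-- Two sets of rows which are both closed downwards with respect to a real-valued score are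
nested. -/
theorem subset_total_of_lower {ι : Type*} (z : ι → ℝ) {A B : Finset ι}
    (hA : ∀ i k, z i ≤ z k → k ∈ A → i ∈ A) (hB : ∀ i k, z i ≤ z k → k ∈ B → i ∈ B) :
    A ⊆ B ∨ B ⊆ A := by
  by_contra! h
  obtain ⟨a, haA, haB⟩ := Finset.not_subset.1 h.1
  obtain ⟨b, hbB, hbA⟩ := Finset.not_subset.1 h.2
  rcases le_total (z a) (z b) with hab | hab
  · exact haB (hB _ _ hab hbB)
  · exact hbA (hA _ _ hab haA)

/-- There are only polynomially many monotone cells: a column of them is determined by its cumulative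
counts, since the rows with cells at most `v` are closed downwards. -/
theorem card_monotoneCells_le {p n : ℕ} (N : ℕ) (Z : Fin n → EuclideanSpace ℝ (Fin p)) :
    (monotoneCells N Z).card ≤ (n + 1) ^ ((N + 1) * p) := by
  classical
  set cnt : (Fin n → Fin p → Fin (N + 1)) → Fin p → Fin (N + 1) → Fin (n + 1) := fun c j v =>
    ⟨(Finset.univ.filter fun i => c i j ≤ v).card,
      Nat.lt_succ_of_le ((Finset.card_le_univ _).trans (by simp))⟩ with hcnt
  have hinj : Set.InjOn cnt (monotoneCells N Z) := by
    intro c hc c' hc' h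
    simp only [monotoneCells, Finset.coe_filter, Finset.mem_univ, true_and] at hc hc'
    have hset : ∀ j v, (Finset.univ.filter fun i => c i j ≤ v)
        = Finset.univ.filter fun i => c' i j ≤ v := by
      intro j v
      have hcard : (Finset.univ.filter fun i => c i j ≤ v).card
          = (Finset.univ.filter fun i => c' i j ≤ v).card :=
        congrArg Fin.val (congrFun (congrFun h j) v)
      rcases subset_total_of_lower (fun i => Z i j)
        (A := Finset.univ.filter fun i => c i j ≤ v) (B := Finset.univ.filter fun i => c' i j ≤ v)
        (fun i k hik hk => by
          simp only [Finset.mem_filter, Finset.mem_univ, true_and] at hk ⊢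
          exact (hc j i k hik).trans hk)
        (fun i k hik hk => by
          simp only [Finset.mem_filter, Finset.mem_univ, true_and] at hk ⊢
          exact (hc' j i k hik).trans hk) with hs | hs
      · exact Finset.eq_of_subset_of_card_le hs hcard.ge
      · exact (Finset.eq_of_subset_of_card_le hs hcard.le).symm
    funext i j
    have hmem : ∀ v, c i j ≤ v ↔ c' i j ≤ v := fun v => by
      have := Finset.ext_iff.1 (hset j v) i
      simpa using this
    exact le_antisymm ((hmem _).2 le_rfl) ((hmem _).1 le_rfl)
  have := Finset.card_le_card_of_injOn (t := Finset.univ) cnt (fun _ _ => Finset.mem_univ _) hinj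
  refine this.trans (le_of_eq ?_)
  simp [pow_mul]

/-- There are few families of small sets: for every rate `a > 0`, at most `exp (a n)` of them when the
proportion `δ` is small enough. -/
theorem exists_card_smallTieSets_le (p : ℕ) {a : ℝ} (ha : 0 < a) :
    ∃ δ > 0, ∀ n : ℕ, ((smallTieSets p n δ).card : ℝ) ≤ Real.exp (a * n) := by
  classical
  set b : ℝ := a / (2 * (p + 1)) with hb
  have hb0 : 0 < b := by positivity
  set x : ℝ := min b 1 with hx
  have hx0 : 0 < x := lt_min hb0 one_pos
  have hx1 : x ≤ 1 := min_le_right _ _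
  obtain ⟨δ, hδ0, hδ⟩ : ∃ δ > 0, δ * -Real.log x ≤ b := by
    have hl : 0 ≤ -Real.log x := by
      have := Real.log_nonpos hx0.le hx1
      linarith
    refine ⟨b / (-Real.log x + 1), by positivity, ?_⟩
    rw [div_mul_eq_mul_div, div_le_iff₀ (by linarith)]
    nlinarith
  refine ⟨δ, hδ0, fun n => ?_⟩
  have hone : (((Finset.univ.filter fun T : Finset (Fin n) => (T.card : ℝ) ≤ δ * n).card : ℕ) : ℝ)
      ≤ Real.exp (2 * b * n) := by
    -- Markov's inequality for `∑ T, x ^ #T = (1 + x) ^ n`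
    have h1 : ∀ T ∈ Finset.univ.filter fun T : Finset (Fin n) => (T.card : ℝ) ≤ δ * n,
        Real.exp (-(b * n)) ≤ x ^ T.card := by
      intro T hT
      have hT' : (T.card : ℝ) ≤ δ * n := (Finset.mem_filter.1 hT).2
      have hlog : x ^ T.card = Real.exp (T.card * Real.log x) := by
        rw [Real.exp_nat_mul, Real.exp_log hx0]
      rw [hlog, Real.exp_le_exp]
      have hlx : Real.log x ≤ 0 := Real.log_nonpos hx0.le hx1
      have h2 : δ * n * Real.log x ≤ T.card * Real.log x := mul_le_mul_of_nonpos_right hT' hlx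
      have h3 : (δ * -Real.log x) * n ≤ b * n :=
        mul_le_mul_of_nonneg_right hδ (Nat.cast_nonneg n)
      linarith
    have h2 := Finset.card_nsmul_le_sum _ _ _ h1
    have h3 : ∑ T ∈ Finset.univ.filter fun T : Finset (Fin n) => (T.card : ℝ) ≤ δ * n, x ^ T.card
        ≤ ∑ T : Finset (Fin n), x ^ T.card :=
      Finset.sum_le_sum_of_subset_of_nonneg (Finset.filter_subset _ _)
        fun _ _ _ => by positivity
    have h4 : ∑ T : Finset (Fin n), x ^ T.card = (x + 1) ^ n := by
      have := Fin.sum_pow_mul_eq_add_pow x 1 (n := n)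
      simpa using this
    have h5 : (x + 1) ^ n ≤ Real.exp (b * n) := by
      calc (x + 1) ^ n ≤ (Real.exp x) ^ n := by
            gcongr
            exact Real.add_one_le_exp x
        _ = Real.exp (n * x) := (Real.exp_nat_mul x n).symm
        _ ≤ Real.exp (b * n) := by
            rw [Real.exp_le_exp, mul_comm]
            exact mul_le_mul_of_nonneg_right (min_le_left _ _) (Nat.cast_nonneg n)
    rw [nsmul_eq_mul] at h2
    have h6 := h2.trans (h3.trans (h4.le.trans h5))
    rw [Real.exp_neg, ← div_eq_mul_inv, div_le_iff₀ (Real.exp_pos _), ← Real.exp_add] at h6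
    refine h6.trans (le_of_eq ?_)
    congr 1
    ring
  have hpi : smallTieSets p n δ = Fintype.piFinset fun _ : Fin p =>
      Finset.univ.filter fun T : Finset (Fin n) => (T.card : ℝ) ≤ δ * n := by
    ext U
    simp [smallTieSets]
  rw [hpi, Fintype.card_piFinset, Finset.prod_const, Finset.card_univ, Fintype.card_fin]
  push_cast
  calc _ ≤ (Real.exp (2 * b * n)) ^ p := by gcongr
    _ = Real.exp (p * (2 * b * n)) := (Real.exp_nat_mul _ _).symm
    _ ≤ Real.exp (a * n) := by
        rw [Real.exp_le_exp]
        have h1 : p * (2 * b) ≤ a := by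
          rw [hb]
          have : (p : ℝ) * (2 * (a / (2 * (p + 1)))) = a * (p / (p + 1)) := by field_simp
          rw [this]
          refine mul_le_of_le_one_right ha.le ?_
          rw [div_le_one (by positivity)]
          linarith
        have := mul_le_mul_of_nonneg_right h1 (Nat.cast_nonneg (α := ℝ) n)
        linarith

/-! ### The weights of the rank structures -/

/-- The quadrant of the cells in columns `j` and `k` with respect to the thresholds `v`. -/
def quadrant {p N : ℕ} (v : Fin p → Fin (N + 1)) (j k : Fin p) (c : Fin p → Fin (N + 1)) :
    Bool × Bool :=
  (decide (c j ≤ v j), decide (c k ≤ v k))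

/-- The inverse probability weight of a complete case in cell `c`, truncated at `1 / η`. -/
noncomputable def caseWeight {p N : ℕ} (kh : Pattern p → (Fin p → Fin (N + 1)) → ℝ) (η : ℝ)
    (c : Fin p → Fin (N + 1)) : ℝ :=
  (max (kh (fun _ => false) c) η)⁻¹

/-- The contribution of one row to the weighted count of complete cases in quadrant `q`. -/
noncomputable def caseTerm {p N : ℕ} (kh : Pattern p → (Fin p → Fin (N + 1)) → ℝ) (η : ℝ)
    (v : Fin p → Fin (N + 1)) (j k : Fin p) (q : Bool × Bool) (r : Pattern p)
    (c : Fin p → Fin (N + 1)) : ℝ :=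
  if r = (fun _ => false) ∧ quadrant v j k c = q then caseWeight kh η c else 0

theorem caseTerm_maskCell {p N : ℕ} (kh : Pattern p → (Fin p → Fin (N + 1)) → ℝ) (η : ℝ)
    (v : Fin p → Fin (N + 1)) (j k : Fin p) (q : Bool × Bool) (r : Pattern p)
    (c : Fin p → Fin (N + 1)) :
    caseTerm kh η v j k q r (maskCell r c) = caseTerm kh η v j k q r c := by
  by_cases h : r = fun _ => false
  · have : maskCell r c = c := by
      funext i
      exact maskCell_of_observed c (by rw [h])
    rw [this]
  · simp [caseTerm, h]

/-- The complete cases, inversely weighted, are at least as frequent in each quadrant as the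
probabilities `m` predict, up to `2 γ`. -/
def EnoughCases {p N n : ℕ} (kh : Pattern p → (Fin p → Fin (N + 1)) → ℝ) (η γ : ℝ)
    (v : Fin p → Fin (N + 1)) (m : Fin p → Fin p → Bool × Bool → ℝ) (r : Fin n → Pattern p)
    (c : Fin n → Fin p → Fin (N + 1)) : Prop :=
  ∀ j k q, n * (m j k q - 2 * γ) ≤ ∑ i, caseTerm kh η v j k q (r i) (c i)

/-- The weight of the patterns `r` given the cells `c`, under the mechanism `kh`; it need not sum to
one exactly. -/
def patternWeight {p N n : ℕ} (kh : Pattern p → (Fin p → Fin (N + 1)) → ℝ) (r : Fin n → Pattern p)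
    (c : Fin n → Fin p → Fin (N + 1)) : ℝ :=
  ∏ i, kh (r i) (c i)

theorem sum_patternWeight_le {p N n : ℕ} {kh : Pattern p → (Fin p → Fin (N + 1)) → ℝ} {ε : ℝ}
    (hkh0 : ∀ r c, 0 < kh r c) (hkh : ∀ c, ∑ r, kh r c ≤ 1 + ε)
    (c : Fin n → Fin p → Fin (N + 1)) : ∑ r, patternWeight kh r c ≤ Real.exp (ε * n) := by
  unfold patternWeight
  rw [← Fintype.prod_sum (fun i r => kh r (c i))]
  calc ∏ i, ∑ r, kh r (c i) ≤ ∏ _i : Fin n, Real.exp ε :=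
        Finset.prod_le_prod (fun i _ => Finset.sum_nonneg fun r _ => (hkh0 _ _).le) fun i _ =>
          (hkh _).trans (by rw [add_comm]; exact Real.add_one_le_exp ε)
    _ = Real.exp (ε * n) := by
        rw [Finset.prod_const, Finset.card_univ, Fintype.card_fin, ← Real.exp_nat_mul, mul_comm]

open Classical in
/-- If cells `c` visit quadrant `q` too rarely, then the patterns with enough complete cases there
have exponentially small probability. This is Chernoff's bound, with parameter `γ η / 2`. -/
theorem sum_patternWeight_enoughCases_le {p N n : ℕ}
    {kh : Pattern p → (Fin p → Fin (N + 1)) → ℝ} {ε η γ : ℝ}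
    (hkh0 : ∀ r c, 0 < kh r c) (hkh : ∀ c, ∑ r, kh r c ≤ 1 + ε) (hη : 0 < η) (hγ : 0 < γ)
    (hγ1 : γ ≤ 1) (v : Fin p → Fin (N + 1)) (m : Fin p → Fin p → Bool × Bool → ℝ)
    {j k : Fin p} {q : Bool × Bool} (c : Fin n → Fin p → Fin (N + 1))
    (hq : ((Finset.univ.filter fun i => quadrant v j k (c i) = q).card : ℝ)
      ≤ n * (m j k q - 3 * γ)) :
    ∑ r, (if EnoughCases kh η γ v m r c then patternWeight kh r c else 0)
      ≤ Real.exp ((ε - γ ^ 2 * η / 4) * n) := by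
  set l : ℝ := γ * η / 2 with hl
  have hl0 : 0 < l := by positivity
  set M : ℝ := n * (m j k q - 2 * γ) with hM
  set ind : Fin n → ℝ := fun i => if quadrant v j k (c i) = q then 1 else 0 with hind
  have hstep : ∀ r : Fin n → Pattern p, (if EnoughCases kh η γ v m r c then patternWeight kh r c else 0)
      ≤ Real.exp (-(l * M)) *
        ∏ i, (kh (r i) (c i) * Real.exp (l * caseTerm kh η v j k q (r i) (c i))) := by
    intro r
    rw [Finset.prod_mul_distrib, ← Real.exp_sum, ← Finset.mul_sum]
    have hw : 0 < patternWeight kh r c := Finset.prod_pos fun i _ => hkh0 _ _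
    by_cases h : EnoughCases kh η γ v m r c
    · rw [if_pos h, mul_left_comm, ← Real.exp_add]
      refine le_mul_of_one_le_right hw.le (Real.one_le_exp ?_)
      have := mul_le_mul_of_nonneg_left (h j k q) hl0.le
      linarith
    · rw [if_neg h]
      exact mul_nonneg (Real.exp_pos _).le (mul_nonneg hw.le (Real.exp_pos _).le)
  have hrow : ∀ i, ∑ r, kh r (c i) * Real.exp (l * caseTerm kh η v j k q r (c i))
      ≤ Real.exp (ε + l * ind i + l ^ 2 / η) := by
    intro i
    set K := kh (fun _ => false) (c i) with hK
    set w := caseWeight kh η (c i) with hw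
    have hmax : 0 < max K η := lt_of_lt_of_le hη (le_max_right _ _)
    have hw0 : 0 < w := inv_pos.2 hmax
    have hKw : K * w ≤ 1 := by
      rw [hw, caseWeight, ← div_eq_mul_inv, div_le_one hmax]; exact le_max_left _ _
    have hwη : w ≤ 1 / η := by
      rw [hw, caseWeight, one_div]
      exact inv_anti₀ hη (le_max_right _ _)
    have hexp : ∀ r, kh r (c i) * Real.exp (l * caseTerm kh η v j k q r (c i))
        ≤ kh r (c i) + if r = (fun _ => false) then l * ind i + l ^ 2 / η else 0 := by
      intro r
      by_cases hr : r = fun _ => false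
      · by_cases hqi : quadrant v j k (c i) = q
        · rw [if_pos hr, caseTerm, if_pos ⟨hr, hqi⟩, hr, ← hK, ← hw]
          have hind1 : ind i = 1 := by simp [hind, hqi]
          rw [hind1, mul_one]
          have hlw : l * w ≤ 1 := by
            calc l * w ≤ l * (1 / η) := mul_le_mul_of_nonneg_left hwη hl0.le
              _ = γ / 2 := by rw [hl]; field_simp
              _ ≤ 1 := by linarith
          have hlw0 : 0 ≤ l * w := by positivity
          have hb := Real.abs_exp_sub_one_sub_id_le (x := l * w) (by rwa [abs_of_nonneg hlw0])
          have hb' := (abs_le.1 hb).2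
          have hK0 : 0 < K := hkh0 _ _
          calc K * Real.exp (l * w) ≤ K * (1 + l * w + (l * w) ^ 2) :=
                mul_le_mul_of_nonneg_left (by linarith) hK0.le
            _ = K + l * (K * w) + l ^ 2 * ((K * w) * w) := by ring
            _ ≤ K + l * 1 + l ^ 2 * (1 * (1 / η)) := by gcongr
            _ = K + (l + l ^ 2 / η) := by ring
        · rw [caseTerm, if_neg (fun h => hqi h.2), mul_zero, Real.exp_zero, mul_one, if_pos hr]
          have : ind i = 0 := by simp [hind, hqi]
          rw [this, mul_zero, zero_add]
          have : 0 ≤ l ^ 2 / η := by positivity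
          linarith
      · rw [caseTerm, if_neg (fun h => hr h.1), if_neg hr]
        simp
    calc _ ≤ ∑ r, (kh r (c i) + if r = (fun _ => false) then l * ind i + l ^ 2 / η else 0) :=
          Finset.sum_le_sum fun r _ => hexp r
      _ = ∑ r, kh r (c i) + (l * ind i + l ^ 2 / η) := by
          rw [Finset.sum_add_distrib, Finset.sum_ite_eq' Finset.univ]; simp
      _ ≤ (ε + l * ind i + l ^ 2 / η) + 1 := by linarith [hkh (c i)]
      _ ≤ _ := Real.add_one_le_exp _
  have hindsum : ∑ i, ind i = ((Finset.univ.filter fun i => quadrant v j k (c i) = q).card : ℝ) := by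
    simp [hind]
  calc _ ≤ ∑ r : Fin n → Pattern p, Real.exp (-(l * M)) *
        ∏ i, (kh (r i) (c i) * Real.exp (l * caseTerm kh η v j k q (r i) (c i))) :=
        Finset.sum_le_sum fun r _ => hstep r
    _ = Real.exp (-(l * M)) *
        ∏ i, ∑ r, kh r (c i) * Real.exp (l * caseTerm kh η v j k q r (c i)) := by
        rw [← Finset.mul_sum, ← Fintype.prod_sum
          (fun i r => kh r (c i) * Real.exp (l * caseTerm kh η v j k q r (c i)))]
    _ ≤ Real.exp (-(l * M)) * ∏ i, Real.exp (ε + l * ind i + l ^ 2 / η) := by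
        refine mul_le_mul_of_nonneg_left (Finset.prod_le_prod (fun i _ => ?_) fun i _ => hrow i)
          (Real.exp_pos _).le
        exact Finset.sum_nonneg fun r _ => mul_nonneg (hkh0 _ _).le (Real.exp_pos _).le
    _ = Real.exp (-(l * M) + (n * ε + l * ∑ i, ind i + n * (l ^ 2 / η))) := by
        rw [← Real.exp_sum, ← Real.exp_add]
        congr 2
        simp only [Finset.sum_add_distrib, Finset.sum_const, Finset.card_univ, Fintype.card_fin,
          nsmul_eq_mul, Finset.mul_sum]
    _ ≤ Real.exp ((ε - γ ^ 2 * η / 4) * n) := by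
        rw [Real.exp_le_exp, hindsum]
        have h1 := mul_le_mul_of_nonneg_left hq hl0.le
        have h2 : l ^ 2 / η = γ ^ 2 * η / 4 := by rw [hl]; field_simp; norm_num
        have h3 : l * γ = γ ^ 2 * η / 2 := by rw [hl]; ring
        rw [h2, hM]
        have h4 : -(l * (n * (m j k q - 2 * γ))) + l * (n * (m j k q - 3 * γ))
            = -(n * (l * γ)) := by ring
        rw [h3] at h4
        linarith

/-- Replacing two sets by sets nested with them changes the size of their intersection by at most as
much as it changes their own sizes. -/
theorem card_inter_sub_le {ι : Type*} [DecidableEq ι] {A A' B B' : Finset ι} {a b : ℝ}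
    (hA : A ⊆ A' ∨ A' ⊆ A) (hB : B ⊆ B' ∨ B' ⊆ B)
    (ha : |(A.card : ℝ) - A'.card| ≤ a) (hb : |(B.card : ℝ) - B'.card| ≤ b) :
    |((A ∩ B).card : ℝ) - (A' ∩ B').card| ≤ a + b := by
  have key : ∀ (A A' B : Finset ι), A ⊆ A' ∨ A' ⊆ A →
      |((A ∩ B).card : ℝ) - (A' ∩ B).card| ≤ |(A.card : ℝ) - A'.card| := by
    have aux : ∀ (A A' B : Finset ι), A ⊆ A' →
        |((A ∩ B).card : ℝ) - (A' ∩ B).card| ≤ |(A.card : ℝ) - A'.card| := by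
      intro A A' B h
      have h1 : (A ∩ B).card ≤ (A' ∩ B).card :=
        Finset.card_le_card (Finset.inter_subset_inter_right h)
      have h2 : A.card ≤ A'.card := Finset.card_le_card h
      have h3 : (A' ∩ B).card + A.card ≤ (A ∩ B).card + A'.card := by
        have e1 := Finset.card_inter_add_card_sdiff A B
        have e2 := Finset.card_inter_add_card_sdiff A' B
        have e3 : (A \ B).card ≤ (A' \ B).card :=
          Finset.card_le_card (Finset.sdiff_subset_sdiff h le_rfl)
        omega
      have h1' : ((A ∩ B).card : ℝ) ≤ (A' ∩ B).card := by exact_mod_cast h1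
      have h2' : (A.card : ℝ) ≤ A'.card := by exact_mod_cast h2
      have h3' : ((A' ∩ B).card : ℝ) + A.card ≤ (A ∩ B).card + A'.card := by exact_mod_cast h3
      rw [abs_sub_comm, abs_of_nonneg (by linarith), abs_sub_comm, abs_of_nonneg (by linarith)]
      linarith
    intro A A' B h
    rcases h with h | h
    · exact aux A A' B h
    · have := aux A' A B h
      rwa [abs_sub_comm, abs_sub_comm (A'.card : ℝ)] at this
  have h1 := key A A' B hA
  have h2 := key B B' A' hB
  rw [Finset.inter_comm B, Finset.inter_comm B'] at h2
  have : ((A ∩ B).card : ℝ) - (A' ∩ B').card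
      = ((A ∩ B).card - (A' ∩ B).card) + ((A' ∩ B).card - (A' ∩ B').card) := by ring
  rw [this]
  exact (abs_add_le _ _).trans (by linarith)

open Classical in
/-- If the latent values put the proportions `u j`, `u k` and `h` below the thresholds `t`, up to
`γ`, but `h` is not close to the probability that `m` gives to the lower quadrant, then monotone
cells visit some quadrant too rarely. -/
theorem exists_quadrant_card_le {p N n : ℕ} (hn : 0 < n) {γ : ℝ} (v : Fin p → Fin (N + 1))
    {j k : Fin p} {m : Bool × Bool → ℝ} (hm : ∑ q, m q = 1) {t : Fin p → ℝ} {h : ℝ}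
    {Z : Fin n → EuclideanSpace ℝ (Fin p)} {c : Fin n → Fin p → Fin (N + 1)}
    (hc : c ∈ monotoneCells N Z) (hgap : 25 * γ ≤ |h - m (true, true)|) (hγ : 0 < γ)
    (hj : |((Finset.univ.filter fun i => Z i j ≤ t j).card : ℝ) / n
      - (m (true, true) + m (true, false))| ≤ γ)
    (hk : |((Finset.univ.filter fun i => Z i k ≤ t k).card : ℝ) / n
      - (m (true, true) + m (false, true))| ≤ γ)
    (hjk : |((Finset.univ.filter fun i => Z i j ≤ t j ∧ Z i k ≤ t k).card : ℝ) / n - h| ≤ γ) :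
    ∃ q, ((Finset.univ.filter fun i => quadrant v j k (c i) = q).card : ℝ)
      ≤ n * (m q - 3 * γ) := by
  by_contra! hcon
  have hn0 : (0 : ℝ) < n := by exact_mod_cast hn
  simp only [monotoneCells, Finset.mem_filter, Finset.mem_univ, true_and] at hc
  set fr : Bool × Bool → ℝ := fun q =>
    ((Finset.univ.filter fun i => quadrant v j k (c i) = q).card : ℝ) with hfr
  have hsum : ∑ q, fr q = n := by
    have := Finset.card_eq_sum_card_fiberwise (s := (Finset.univ : Finset (Fin n)))
      (t := (Finset.univ : Finset (Bool × Bool))) (f := fun i => quadrant v j k (c i))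
      (fun _ _ => Finset.mem_univ _)
    simp only [Finset.card_univ, Fintype.card_fin] at this
    simp only [hfr]
    exact_mod_cast this.symm
  have hexp : ∀ f : Bool × Bool → ℝ, ∑ q, f q
      = f (true, true) + f (true, false) + f (false, true) + f (false, false) := by
    intro f
    rw [Fintype.sum_prod_type]
    simp only [Fintype.sum_bool]
    ring
  rw [hexp] at hsum hm
  set LJ : Finset (Fin n) := Finset.univ.filter fun i => c i j ≤ v j with hLJ
  set LK : Finset (Fin n) := Finset.univ.filter fun i => c i k ≤ v k with hLK
  set SJ : Finset (Fin n) := Finset.univ.filter fun i => Z i j ≤ t j with hSJ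
  set SK : Finset (Fin n) := Finset.univ.filter fun i => Z i k ≤ t k with hSK
  have hTT : LJ ∩ LK = Finset.univ.filter fun i => quadrant v j k (c i) = (true, true) := by
    ext i; simp [hLJ, hLK, quadrant]
  have hSS : SJ ∩ SK = Finset.univ.filter fun i => Z i j ≤ t j ∧ Z i k ≤ t k := by
    ext i; simp [hSJ, hSK]
  have hLJc : (LJ.card : ℝ) = fr (true, true) + fr (true, false) := by
    have := Finset.card_inter_add_card_sdiff LJ LK
    have e : LJ \ LK = Finset.univ.filter fun i => quadrant v j k (c i) = (true, false) := by
      ext i; simp [hLJ, hLK, quadrant]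
    rw [hTT, e] at this
    simp only [hfr]
    exact_mod_cast this.symm
  have hLKc : (LK.card : ℝ) = fr (true, true) + fr (false, true) := by
    have := Finset.card_inter_add_card_sdiff LK LJ
    have e : LK \ LJ = Finset.univ.filter fun i => quadrant v j k (c i) = (false, true) := by
      ext i; simp [hLJ, hLK, quadrant, and_comm]
    rw [Finset.inter_comm, hTT, e] at this
    simp only [hfr]
    exact_mod_cast this.symm
  have h1 := hcon (true, true)
  have h2 := hcon (true, false)
  have h3 := hcon (false, true)
  have h4 := hcon (false, false)
  change _ < fr _ at h1 h2 h3 h4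
  have hscale : ∀ {a b : ℝ}, |a / n - b| ≤ γ → |a - n * b| ≤ n * γ := by
    intro a b hab
    have : a - n * b = n * (a / n - b) := by field_simp
    rw [this, abs_mul, abs_of_pos hn0]
    exact mul_le_mul_of_nonneg_left hab hn0.le
  have hj' := abs_le.1 (hscale hj)
  have hk' := abs_le.1 (hscale hk)
  have hjk' := abs_le.1 (hscale hjk)
  have hmn : n * m (true, true) + n * m (true, false) + n * m (false, true) + n * m (false, false)
      = n := by rw [← mul_add, ← mul_add, ← mul_add, hm, mul_one]
  have hnest : ∀ l, (Finset.univ.filter fun i => c i l ≤ v l) ⊆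
      (Finset.univ.filter fun i => Z i l ≤ t l) ∨ (Finset.univ.filter fun i => Z i l ≤ t l) ⊆
      (Finset.univ.filter fun i => c i l ≤ v l) := fun l =>
    subset_total_of_lower (fun i => Z i l)
      (fun i k hik hk => by
        simp only [Finset.mem_filter, Finset.mem_univ, true_and] at hk ⊢
        exact (hc l i k hik).trans hk)
      (fun i k hik hk => by
        simp only [Finset.mem_filter, Finset.mem_univ, true_and] at hk ⊢
        exact hik.trans hk)
  -- each quadrant has at least `n (m q - 3 γ)` rows and they are `n` in total, so that the margins
  -- are off by at most `6 γ` and the lower quadrant by at most `9 γ`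
  have hA : |(LJ.card : ℝ) - SJ.card| ≤ 7 * (n * γ) := by
    rw [hLJc, abs_le]; constructor <;> linarith
  have hB : |(LK.card : ℝ) - SK.card| ≤ 7 * (n * γ) := by
    rw [hLKc, abs_le]; constructor <;> linarith
  have hI := abs_le.1 (card_inter_sub_le (hnest j) (hnest k) hA hB)
  rw [hTT, hSS] at hI
  change -(_) ≤ fr (true, true) - _ ∧ fr (true, true) - _ ≤ _ at hI
  -- in total `γ + 2 * 7 γ + 9 γ = 24 γ`
  have hfin : |n * h - n * m (true, true)| < n * (25 * γ) := by
    rw [abs_lt]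
    have hnγ : 0 < n * γ := by positivity
    constructor <;> linarith
  rw [← mul_sub, abs_mul, abs_of_pos hn0] at hfin
  exact absurd (mul_le_mul_of_nonneg_left hgap hn0.le) (not_le.2 hfin)

/-! ### Separation of correlation matrices by orthant probabilities -/

/-- The orthant probability depends on the correlation matrix only through one entry. -/
theorem orthant_eq_of_eq {p : ℕ} {C C' : CorrelationMatrix p} {j k : Fin p}
    (h : C.1 j k = C'.1 j k) (s t : ℝ) :
    (latentLaw C).real {z | z j ≤ s ∧ z k ≤ t} = (latentLaw C').real {z | z j ≤ s ∧ z k ≤ t} := by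
  have hB : MeasurableSet (Set.Iic s ×ˢ Set.Iic t) := measurableSet_Iic.prod measurableSet_Iic
  have h1 := measure_pair_latentLaw C j k hB
  have h2 := measure_pair_latentLaw C' j k hB
  rw [h, ← h2] at h1
  simp only [measureReal_def]
  exact congrArg ENNReal.toReal h1

theorem orthant_mono {p : ℕ} {C C' : CorrelationMatrix p} {j k : Fin p}
    (h : C.1 j k ≤ C'.1 j k) (s t : ℝ) :
    (latentLaw C).real {z | z j ≤ s ∧ z k ≤ t} ≤ (latentLaw C').real {z | z j ≤ s ∧ z k ≤ t} := by
  rcases h.lt_or_eq with h | h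
  · exact (orthant_strictMono C C' h s t).le
  · exact (orthant_eq_of_eq h s t).le

/-- A convex combination of correlation matrices with a prescribed entry. -/
theorem exists_correlationMatrix_entry {p : ℕ} (C C' : CorrelationMatrix p) (j k : Fin p) {a : ℝ}
    (ha : a ∈ Set.uIcc (C.1 j k) (C'.1 j k)) : ∃ D : CorrelationMatrix p, D.1 j k = a := by
  rw [← segment_eq_uIcc] at ha
  obtain ⟨x, y, hx, hy, hxy, rfl⟩ := ha
  refine ⟨⟨x • C.1 + y • C'.1, ?_, fun l => ?_⟩, ?_⟩
  · exact (C.2.1.smul hx).add (C'.2.1.smul hy)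
  · simp [C.2.2 l, C'.2.2 l, hxy]
  · simp

/-- Correlation matrices with a different entry have a different orthant probability, uniformly: by
monotonicity the smallest gap occurs at the entries `C₀ j k ± η`, if correlation matrices with such
entries exist. -/
theorem exists_orthant_gap {p : ℕ} (C₀ : CorrelationMatrix p) (j k : Fin p) (s t : ℝ) {η : ℝ}
    (hη : 0 < η) : ∃ Δ > 0, ∀ C : CorrelationMatrix p, η ≤ |C.1 j k - C₀.1 j k| →
      Δ ≤ |(latentLaw C).real {z | z j ≤ s ∧ z k ≤ t}
        - (latentLaw C₀).real {z | z j ≤ s ∧ z k ≤ t}| := by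
  set H : CorrelationMatrix p → ℝ := fun C => (latentLaw C).real {z | z j ≤ s ∧ z k ≤ t} with hH
  have hup : ∃ Δ > 0, ∀ C : CorrelationMatrix p, C₀.1 j k + η ≤ C.1 j k → Δ ≤ H C - H C₀ := by
    by_cases h : ∃ C : CorrelationMatrix p, C₀.1 j k + η ≤ C.1 j k
    · obtain ⟨C, hC⟩ := h
      obtain ⟨D, hD⟩ := exists_correlationMatrix_entry C₀ C j k (a := C₀.1 j k + η)
        (Set.mem_uIcc_of_le (by linarith) hC)
      exact ⟨H D - H C₀, sub_pos.2 (orthant_strictMono C₀ D (by linarith) s t), fun C' hC' =>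
        sub_le_sub_right (orthant_mono (by rw [hD]; exact hC') s t) _⟩
    · exact ⟨1, one_pos, fun C hC => absurd ⟨C, hC⟩ h⟩
  have hdown : ∃ Δ > 0, ∀ C : CorrelationMatrix p, C.1 j k ≤ C₀.1 j k - η → Δ ≤ H C₀ - H C := by
    by_cases h : ∃ C : CorrelationMatrix p, C.1 j k ≤ C₀.1 j k - η
    · obtain ⟨C, hC⟩ := h
      obtain ⟨D, hD⟩ := exists_correlationMatrix_entry C₀ C j k (a := C₀.1 j k - η)
        (Set.mem_uIcc_of_ge hC (by linarith))
      exact ⟨H C₀ - H D, sub_pos.2 (orthant_strictMono D C₀ (by linarith) s t), fun C' hC' =>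
        sub_le_sub_left (orthant_mono (by rw [hD]; exact hC') s t) _⟩
    · exact ⟨1, one_pos, fun C hC => absurd ⟨C, hC⟩ h⟩
  obtain ⟨Δ₁, h1, hup⟩ := hup
  obtain ⟨Δ₂, h2, hdown⟩ := hdown
  refine ⟨min Δ₁ Δ₂, lt_min h1 h2, fun C hC => ?_⟩
  change _ ≤ |H C - H C₀|
  rcases le_abs.1 hC with h | h
  · exact (min_le_left _ _).trans ((hup C (by linarith)).trans (le_abs_self _))
  · exact (min_le_right _ _).trans ((hdown C (by linarith)).trans
      (by rw [abs_sub_comm]; exact le_abs_self _))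

/-! ### The likelihood of wrong correlation matrices -/

theorem measurableSet_hoeffding {α : Type*} [MeasurableSpace α] {A : Set α}
    (hA : MeasurableSet A) (n : ℕ) (a b : ℝ) :
    MeasurableSet {z : Fin n → α | a ≤ |∑ i, A.indicator (1 : α → ℝ) (z i) - b|} := by
  refine measurableSet_le measurable_const (Measurable.abs ?_)
  refine (Finset.measurable_sum _ fun i _ => ?_).sub measurable_const
  exact (measurable_one.indicator hA).comp (measurable_pi_apply i)

open Classical in
/-- If the orthant probability of `C` is not the one predicted by `m`, then the likelihood of `C`,
averaged over the rank structures with few ties and enough complete cases, is exponentially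
small. -/
theorem sum_patternWeight_mul_likelihood_le {p N n : ℕ} (hn : 0 < n)
    {ζ : Fin p → ℝ → Fin (N + 1)} (hζ : ∀ j, Monotone (ζ j))
    {kh : Pattern p → (Fin p → Fin (N + 1)) → ℝ} {ε η γ δ : ℝ}
    (hkh0 : ∀ r c, 0 < kh r c)
    (hkhdep : ∀ r c c', (∀ j, r j = false → c j = c' j) → kh r c = kh r c')
    (hkh : ∀ c, ∑ r, kh r c ≤ 1 + ε) (hη : 0 < η) (hη1 : η ≤ 1) (hγ : 0 < γ) (hγ1 : γ ≤ 1)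
    {v : Fin p → Fin (N + 1)} {m : Fin p → Fin p → Bool × Bool → ℝ}
    (G : Finset (RankData p N n))
    (hG : ∀ s ∈ G, ∃ y, s = rankData ζ y ∧ ∀ j, (tieCount y j : ℝ) ≤ δ * n)
    (hG' : ∀ s ∈ G, EnoughCases kh η γ v m s.1 s.2.1)
    {t : Fin p → ℝ} {j k : Fin p} (hm : ∑ q, m j k q = 1)
    (hmj : m j k (true, true) + m j k (true, false) = (gaussianReal 0 1).real (Set.Iic (t j)))
    (hmk : m j k (true, true) + m j k (false, true) = (gaussianReal 0 1).real (Set.Iic (t k)))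
    (C : CorrelationMatrix p)
    (hgap : 25 * γ ≤
      |(latentLaw C).real {z | z j ≤ t j ∧ z k ≤ t k} - m j k (true, true)|) :
    ∑ s ∈ G, ENNReal.ofReal (patternWeight kh s.1 s.2.1) *
        Measure.pi (fun _ : Fin n => latentLaw C) (orderEvent s.2.2)
      ≤ ENNReal.ofReal (((smallTieSets p n δ).card : ℝ) ^ 2 * ((n : ℝ) + 1) ^ ((N + 1) * p) *
          (7 * Real.exp ((ε - γ ^ 2 * η / 4) * n))) := by
  set P := Measure.pi (fun _ : Fin n => latentLaw C) with hP
  set J : Set (EuclideanSpace ℝ (Fin p)) := {z | z j ≤ t j} with hJ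
  set K : Set (EuclideanSpace ℝ (Fin p)) := {z | z k ≤ t k} with hK
  set JK : Set (EuclideanSpace ℝ (Fin p)) := {z | z j ≤ t j ∧ z k ≤ t k} with hJK
  set dev : Set (EuclideanSpace ℝ (Fin p)) → Set (Fin n → EuclideanSpace ℝ (Fin p)) := fun A =>
    {z | n * γ ≤ |∑ i, A.indicator (1 : EuclideanSpace ℝ (Fin p) → ℝ) (z i)
      - n * (latentLaw C).real A|} with hdev
  set E := dev J ∪ dev K ∪ dev JK with hE
  have hJm : MeasurableSet J := measurableSet_coord_le j (t j)
  have hKm : MeasurableSet K := measurableSet_coord_le k (t k)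
  have hJKm : MeasurableSet JK := measurableSet_orthant j k (t j) (t k)
  have hEm : MeasurableSet E :=
    ((measurableSet_hoeffding hJm n _ _).union (measurableSet_hoeffding hKm n _ _)).union
      (measurableSet_hoeffding hJKm n _ _)
  have hPE : P E ≤ ENNReal.ofReal (6 * Real.exp (-(2 * γ ^ 2 * n))) := by
    have h1 := hoeffding_frequency (latentLaw C) hJm hγ.le n
    have h2 := hoeffding_frequency (latentLaw C) hKm hγ.le n
    have h3 := hoeffding_frequency (latentLaw C) hJKm hγ.le n
    calc P E ≤ P (dev J) + P (dev K) + P (dev JK) :=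
          (measure_union_le _ _).trans (add_le_add (measure_union_le _ _) le_rfl)
      _ ≤ _ := add_le_add (add_le_add h1 h2) h3
      _ = _ := by
          rw [← ENNReal.ofReal_add (by positivity) (by positivity),
            ← ENNReal.ofReal_add (by positivity) (by positivity)]
          congr 1; ring
  set M : ℝ := ((smallTieSets p n δ).card : ℝ) ^ 2 * ((n : ℝ) + 1) ^ ((N + 1) * p) with hM
  have hM0 : 0 ≤ M := by positivity
  set e : ℝ := Real.exp ((ε - γ ^ 2 * η / 4) * n) with he
  set f : (Fin n → Pattern p) → (Fin n → Fin p → Fin (N + 1)) → ℝ := fun r c =>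
    if EnoughCases kh η γ v m r c then patternWeight kh r c else 0 with hf
  have hw0 : ∀ (r : Fin n → Pattern p) (c : Fin n → Fin p → Fin (N + 1)),
    0 ≤ patternWeight kh r c := fun r c => Finset.prod_nonneg fun i _ => (hkh0 _ _).le
  have hf0 : ∀ r c, 0 ≤ f r c := fun r c => by
    simp only [hf]; split_ifs <;> [exact hw0 r c; exact le_rfl]
  have hfmask : ∀ r c, f r (fun i => maskCell (r i) (c i)) = f r c := by
    intro r c
    have h1 : patternWeight kh r (fun i => maskCell (r i) (c i)) = patternWeight kh r c :=
      Finset.prod_congr rfl fun i _ => hkhdep _ _ _ fun l hl => maskCell_of_observed _ hl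
    have h2 : EnoughCases kh η γ v m r (fun i => maskCell (r i) (c i))
        ↔ EnoughCases kh η γ v m r c := by
      simp only [EnoughCases, caseTerm_maskCell]
    simp only [hf, h1, h2]
  -- the pointwise bound, with a better rate when the latent frequencies are typical
  have hpt : ∀ Z, ∑ s ∈ G, ENNReal.ofReal (patternWeight kh s.1 s.2.1) *
      (orderEvent s.2.2).indicator 1 Z
      ≤ ENNReal.ofReal (M * e) + E.indicator (fun _ => ENNReal.ofReal (M * Real.exp (ε * n))) Z := by
    intro Z
    have h1 : ∑ s ∈ G, ENNReal.ofReal (patternWeight kh s.1 s.2.1) *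
        (orderEvent s.2.2).indicator 1 Z
        = ENNReal.ofReal (∑ s ∈ G with Z ∈ orderEvent s.2.2, f s.1 s.2.1) := by
      rw [ENNReal.ofReal_sum_of_nonneg fun _ _ => hf0 _ _, Finset.sum_filter]
      refine Finset.sum_congr rfl fun s hs => ?_
      have : f s.1 s.2.1 = patternWeight kh s.1 s.2.1 := if_pos (hG' s hs)
      rw [this]
      by_cases h : Z ∈ orderEvent s.2.2 <;> simp [h]
    rw [h1]
    have h2 := sum_rankData_le hζ G hG Z f hf0 hfmask
    have h3 : ∀ B : ℝ, 0 ≤ B → (∀ c ∈ monotoneCells N Z, ∑ r, f r c ≤ B) →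
        ∑ s ∈ G with Z ∈ orderEvent s.2.2, f s.1 s.2.1 ≤ M * B := by
      intro B hB hcB
      refine h2.trans ?_
      rw [hM, mul_assoc]
      refine mul_le_mul_of_nonneg_left ?_ (sq_nonneg _)
      refine (Finset.sum_le_card_nsmul _ _ _ hcB).trans ?_
      rw [nsmul_eq_mul]
      refine mul_le_mul_of_nonneg_right ?_ hB
      exact_mod_cast card_monotoneCells_le N Z
    by_cases hZ : Z ∈ E
    · rw [Set.indicator_of_mem hZ]
      refine le_trans (ENNReal.ofReal_le_ofReal (h3 _ (Real.exp_pos _).le fun c _ => ?_)) le_add_self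
      refine le_trans (Finset.sum_le_sum fun r _ => ?_) (sum_patternWeight_le hkh0 hkh c)
      simp only [hf]
      split_ifs <;> [exact le_rfl; exact hw0 r c]
    · rw [Set.indicator_of_notMem hZ, add_zero]
      refine ENNReal.ofReal_le_ofReal (h3 _ (Real.exp_pos _).le fun c hc => ?_)
      have hnot : ∀ A, Z ∉ dev A → ∀ b, (latentLaw C).real A = b →
          |((Finset.univ.filter fun i => Z i ∈ A).card : ℝ) / n - b| ≤ γ := by
        intro A hA b hb
        have hA' : ¬ (n * γ ≤ |∑ i, A.indicator (1 : EuclideanSpace ℝ (Fin p) → ℝ) (Z i)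
          - n * (latentLaw C).real A|) := hA
        have hcard : ∑ i, A.indicator (1 : EuclideanSpace ℝ (Fin p) → ℝ) (Z i)
            = ((Finset.univ.filter fun i => Z i ∈ A).card : ℝ) := by
          simp [Set.indicator_apply]
        rw [hcard, hb, not_le] at hA'
        have hn0 : (0 : ℝ) < n := by exact_mod_cast hn
        have : ((Finset.univ.filter fun i => Z i ∈ A).card : ℝ) / n - b
            = (((Finset.univ.filter fun i => Z i ∈ A).card : ℝ) - n * b) / n := by field_simp
        rw [this, abs_div, abs_of_pos hn0, div_le_iff₀ hn0, mul_comm γ]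
        exact hA'.le
      have hZ' : Z ∉ dev J ∧ Z ∉ dev K ∧ Z ∉ dev JK := by
        refine ⟨fun h => hZ (Or.inl (Or.inl h)), fun h => hZ (Or.inl (Or.inr h)),
          fun h => hZ (Or.inr h)⟩
      obtain ⟨q, hq⟩ := exists_quadrant_card_le hn v (j := j) (k := k) hm (t := t)
        (h := (latentLaw C).real JK) hc hgap hγ
        (hnot J hZ'.1 _ (by rw [hmj]; exact latentLaw_coord_le C j (t j)))
        (hnot K hZ'.2.1 _ (by rw [hmk]; exact latentLaw_coord_le C k (t k)))
        (by convert hnot JK hZ'.2.2 _ rfl; exact Iff.rfl)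
      exact sum_patternWeight_enoughCases_le hkh0 hkh hη hγ hγ1 v m c hq
  calc _ = ∫⁻ Z, ∑ s ∈ G, ENNReal.ofReal (patternWeight kh s.1 s.2.1) *
        (orderEvent s.2.2).indicator 1 Z ∂P := by
        rw [lintegral_finsetSum _ fun s _ =>
          (measurable_one.indicator (measurableSet_orderEvent s.2.2)).const_mul _]
        refine Finset.sum_congr rfl fun s _ => ?_
        rw [lintegral_const_mul _ (measurable_one.indicator (measurableSet_orderEvent s.2.2)),
          lintegral_indicator_one (measurableSet_orderEvent s.2.2)]
    _ ≤ ∫⁻ Z, (ENNReal.ofReal (M * e)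
        + E.indicator (fun _ => ENNReal.ofReal (M * Real.exp (ε * n))) Z) ∂P := lintegral_mono hpt
    _ = ENNReal.ofReal (M * e) + ENNReal.ofReal (M * Real.exp (ε * n)) * P E := by
        rw [lintegral_add_left measurable_const, lintegral_const, measure_univ, mul_one,
          lintegral_indicator_const hEm]
    _ ≤ ENNReal.ofReal (M * e) + ENNReal.ofReal (M * Real.exp (ε * n)) *
        ENNReal.ofReal (6 * Real.exp (-(2 * γ ^ 2 * n))) := by gcongr
    _ ≤ ENNReal.ofReal (M * (7 * e)) := by
        rw [← ENNReal.ofReal_mul (by positivity), ← ENNReal.ofReal_add (by positivity)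
          (by positivity)]
        refine ENNReal.ofReal_le_ofReal ?_
        have h1 : Real.exp (ε * n) * Real.exp (-(2 * γ ^ 2 * n)) ≤ e := by
          rw [← Real.exp_add, he, Real.exp_le_exp]
          have h2 : γ ^ 2 * η / 4 ≤ 2 * γ ^ 2 := by nlinarith [sq_nonneg γ]
          have h3 := mul_le_mul_of_nonneg_right h2 (Nat.cast_nonneg (α := ℝ) n)
          linarith
        have h2 := mul_le_mul_of_nonneg_left h1 hM0
        linarith

/-! ### Comparing the truth with the averaged likelihood -/

theorem measurable_rankData {p N n : ℕ} {ζ : Fin p → ℝ → Fin (N + 1)}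
    (hζ : ∀ j, Monotone (ζ j)) : Measurable (rankData ζ (n := n)) := by
  classical
  have hr : ∀ (i : Fin n) (j : Fin p), Measurable fun y : Fin n → (Fin p → ℝ) × Pattern p =>
      (y i).2 j := fun i j => by fun_prop
  have hy : ∀ (i : Fin n) (j : Fin p), Measurable fun y : Fin n → (Fin p → ℝ) × Pattern p =>
      (y i).1 j := fun i j => by fun_prop
  refine Measurable.prodMk (by fun_prop) (Measurable.prodMk ?_ ?_)
  · refine measurable_pi_lambda _ fun i => measurable_pi_lambda _ fun j => ?_
    unfold maskCell
    refine Measurable.ite ?_ measurable_const ((hζ j).measurable.comp (hy i j))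
    exact hr i j (measurableSet_singleton true)
  · refine measurable_pi_lambda _ fun j => measurable_pi_lambda _ fun i =>
      measurable_pi_lambda _ fun k => measurable_to_bool ?_
    have : (fun y : Fin n → (Fin p → ℝ) × Pattern p =>
        decide ((y i).2 j = false ∧ (y k).2 j = false ∧ (y i).1 j < (y k).1 j)) ⁻¹' {true}
        = (fun y => (y i).2 j) ⁻¹' {false} ∩ ((fun y => (y k).2 j) ⁻¹' {false} ∩
          {y | (y i).1 j < (y k).1 j}) := by
      ext y; simp
    rw [this]
    exact (hr i j (measurableSet_singleton _)).inter ((hr k j (measurableSet_singleton _)).inter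
      (measurableSet_lt (hy i j) (hy k j)))

theorem copulaLink_mono {p : ℕ} (F : Fin p → Measure ℝ) {z z' : EuclideanSpace ℝ (Fin p)}
    {j : Fin p} (h : z j ≤ z' j) : copulaLink F z j ≤ copulaLink F z' j :=
  (quantile_le_iff _ (stdNormalCDF_pos _) (stdNormalCDF_lt_one _) _).2 <|
    (monotone_cdf (gaussianReal 0 1) h).trans <|
      (quantile_le_iff _ (stdNormalCDF_pos _) (stdNormalCDF_lt_one _) _).1 le_rfl

theorem pi_gaussianCopula_eq_map {p : ℕ} (C : CorrelationMatrix p) (F : Fin p → Measure ℝ)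
    (n : ℕ) :
    (Measure.pi fun _ : Fin n => gaussianCopula C F)
      = (Measure.pi fun _ : Fin n => stdGaussian (EuclideanSpace ℝ (Fin p))).map
          (fun X i => copulaLink F (latentMap C (X i))) := by
  have hm : Measurable fun x : EuclideanSpace ℝ (Fin p) => copulaLink F (latentMap C x) :=
    (measurable_copulaLink F).comp (latentMap C).continuous.measurable
  have hC : gaussianCopula C F = (stdGaussian (EuclideanSpace ℝ (Fin p))).map
      (fun x => copulaLink F (latentMap C x)) := by
    rw [gaussianCopula, latentLaw_eq_map,
      Measure.map_map (measurable_copulaLink F) (latentMap C).continuous.measurable]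
    rfl
  have h := Measure.pi_map_pi (μ := fun _ : Fin n => stdGaussian (EuclideanSpace ℝ (Fin p)))
    (f := fun _ x => copulaLink F (latentMap C x))
    (hμ := fun _ => by rw [← hC]; infer_instance)
    (fun _ => hm.aemeasurable)
  rw [h, hC]

/-- A number is at most `a b`, or else at most its square over `a b`. -/
theorem le_mul_add_sq_div {a b x : ℝ≥0∞} (ha : a ≠ 0) (ha' : a ≠ ∞) (hb : b ≠ 0)
    (hb' : b ≠ ∞) : x ≤ a * b + a⁻¹ * (x * (x / b)) := by
  rcases le_total x (a * b) with h | h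
  · exact h.trans le_self_add
  · refine le_trans ?_ le_add_self
    have h1 : 1 ≤ a⁻¹ * (x / b) := by
      have : a⁻¹ * (a * b / b) ≤ a⁻¹ * (x / b) := by gcongr
      rwa [ENNReal.mul_div_cancel_right hb hb', ENNReal.inv_mul_cancel ha ha'] at this
    calc x = x * 1 := (mul_one x).symm
      _ ≤ x * (a⁻¹ * (x / b)) := by gcongr
      _ = _ := by ring

open Classical in
theorem sum_ite_mem_le_sum {ι α : Type*} [Fintype ι] (B : Finset α) {s : ι → α}
    (hs : Function.Injective s) (f : α → ℝ≥0∞) :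
    ∑ i, (if s i ∈ B then f (s i) else 0) ≤ ∑ x ∈ B, f x := by
  rw [← Finset.sum_filter, ← Finset.sum_image (s := Finset.univ.filter fun i => s i ∈ B)
    (f := f) hs.injOn]
  refine Finset.sum_le_sum_of_subset fun x hx => ?_
  obtain ⟨r, hr, rfl⟩ := Finset.mem_image.1 hx
  exact (Finset.mem_filter.1 hr).2

open Classical in
/-- The probability that the rank structure falls into `𝔅` is at most `exp (2 ε n)` times the sum
over `𝔅` of the likelihoods at any correlation matrix very close to the true one, up to a summable
error: the latent values are coupled so that with high probability all ranks agree, and the true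
mechanism is replaced by `kh`. -/
theorem pi_rankData_mem_le {p N n : ℕ} {C₀ C : CorrelationMatrix p}
    (hC : ∀ i j, |C₀.1 i j - C.1 i j| ≤ ((n : ℝ) + 1)⁻¹ ^ 11) (F : Fin p → Measure ℝ)
    (κ : Kernel (Fin p → ℝ) (Pattern p)) [IsMarkovKernel κ]
    {ζ : Fin p → ℝ → Fin (N + 1)} (hζ : ∀ j, Monotone (ζ j))
    {kh : Pattern p → (Fin p → Fin (N + 1)) → ℝ} {ε : ℝ} (hε : 0 < ε)
    (hkh0 : ∀ r c, 0 < kh r c)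
    (hkhdep : ∀ r c c', (∀ j, r j = false → c j = c' j) → kh r c = kh r c')
    (hint : ∫⁻ y, ∑ r, κ y {r} * (κ y {r} / ENNReal.ofReal (kh r fun j => ζ j (y j)))
      ∂(gaussianCopula C₀ F) ≤ ENNReal.ofReal (1 + ε))
    (B : Finset (RankData p N n)) :
    (Measure.pi fun _ : Fin n => gaussianCopula C₀ F ⊗ₘ κ) {y | rankData ζ y ∈ B}
      ≤ ENNReal.ofReal (Real.exp (2 * ε * n)) *
          ∑ s ∈ B, ENNReal.ofReal (patternWeight kh s.1 s.2.1) *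
            Measure.pi (fun _ : Fin n => latentLaw C) (orderEvent s.2.2)
        + ENNReal.ofReal ((2 * p + 4 * p ^ 2) * ((n : ℝ) + 1)⁻¹ ^ 2 + Real.exp (-(ε * n))) := by
  set P := Measure.pi fun _ : Fin n => stdGaussian (EuclideanSpace ℝ (Fin p)) with hP
  set E : Set (Fin n → EuclideanSpace ℝ (Fin p)) :=
    {X | ∃ j i k, latentMap C₀ (X i) j < latentMap C₀ (X k) j ∧
        ¬ latentMap C (X i) j < latentMap C (X k) j} with hE
  have hPE : P E ≤ ENNReal.ofReal ((2 * p + 4 * p ^ 2) * ((n : ℝ) + 1)⁻¹ ^ 2) :=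
    stdGaussian_order_ne_le hC
  set a : ℝ≥0∞ := ENNReal.ofReal (Real.exp (2 * ε * n)) with ha
  have ha0 : a ≠ 0 := (ENNReal.ofReal_pos.2 (Real.exp_pos _)).ne'
  have ha1 : a ≠ ∞ := ENNReal.ofReal_ne_top
  set Y : (Fin n → EuclideanSpace ℝ (Fin p)) → Fin n → Fin p → ℝ := fun X i =>
    copulaLink F (latentMap C₀ (X i)) with hY
  have hYm : Measurable Y := measurable_pi_lambda _ fun i =>
    ((measurable_copulaLink F).comp (latentMap C₀).continuous.measurable).comp
      (measurable_pi_apply i)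
  set S : Set (Fin n → (Fin p → ℝ) × Pattern p) := {y | rankData ζ y ∈ B} with hS
  have hSm : MeasurableSet S := measurable_rankData hζ B.measurableSet
  have hκm : ∀ r, Measurable fun y => κ y {r} := fun r =>
    κ.measurable_coe (measurableSet_singleton r)
  have hζm : ∀ r, Measurable fun y : Fin p → ℝ =>
      ENNReal.ofReal (kh r fun j => ζ j (y j)) := by
    intro r
    have h1 : Measurable fun y : Fin p → ℝ => fun j => ζ j (y j) :=
      measurable_pi_lambda _ fun j => (hζ j).measurable.comp (measurable_pi_apply j)
    exact ENNReal.measurable_ofReal.comp ((measurable_of_finite (kh r)).comp h1)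
  set g : (Fin n → Fin p → ℝ) → (Fin n → Pattern p) → ℝ≥0∞ := fun y r =>
    (∏ i, κ (y i) {r i}) * S.indicator 1 (fun i => (y i, r i)) with hg
  have hgm : Measurable fun y => ∑ r, g y r := by
    refine Finset.measurable_sum _ fun r _ => Measurable.mul ?_ ?_
    · exact Finset.measurable_prod _ fun i _ => (hκm (r i)).comp (measurable_pi_apply i)
    · exact (measurable_one.indicator hSm).comp
        (show Measurable fun (y : Fin n → Fin p → ℝ) (i : Fin n) => (y i, r i) by fun_prop)
  set Q : (Fin n → Fin p → ℝ) → ℝ≥0∞ := fun y =>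
    ∏ i, ∑ r, κ (y i) {r} * (κ (y i) {r} / ENNReal.ofReal (kh r fun j => ζ j (y i j))) with hQ
  have hQm : Measurable Q := Finset.measurable_prod _ fun i _ => Finset.measurable_sum _ fun r _ =>
    ((hκm r).mul ((hκm r).div (hζm r))).comp (measurable_pi_apply i)
  have hgsum : ∀ y, ∑ r, g y r ≤ 1 := by
    intro y
    have h1 : ∀ i, ∑ r, κ (y i) {r} = 1 := fun i => by
      rw [sum_measure_singleton, Finset.coe_univ, measure_univ]
    calc ∑ r, g y r ≤ ∑ r : Fin n → Pattern p, ∏ i, κ (y i) {r i} := by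
          refine Finset.sum_le_sum fun r _ => mul_le_of_le_one_right zero_le ?_
          exact Set.indicator_apply_le' (fun _ => le_rfl) fun _ => zero_le
      _ = 1 := by
          rw [← Fintype.prod_sum (fun i r => κ (y i) {r})]
          simp [h1]
  -- the comparison off the exceptional event, where the ranks under `C` refine those under `C₀`
  have hoff : ∀ X, X ∉ E → ∑ r, g (Y X) r ≤
      a * ∑ s ∈ B, ENNReal.ofReal (patternWeight kh s.1 s.2.1) *
        (orderEvent s.2.2).indicator 1 (fun i => latentMap C (X i)) + a⁻¹ * Q (Y X) := by
    intro X hX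
    set s : (Fin n → Pattern p) → RankData p N n := fun r =>
      rankData ζ fun i => (Y X i, r i) with hs
    have hmem : ∀ r, (fun i => latentMap C (X i)) ∈ orderEvent (s r).2.2 := by
      intro r j i k hik
      have h1 : Y X i j < Y X k j := by
        simp only [hs, rankData, decide_eq_true_eq] at hik
        exact hik.2.2
      have h2 : latentMap C₀ (X i) j < latentMap C₀ (X k) j := by
        by_contra hcon
        exact absurd (copulaLink_mono F (not_lt.1 hcon)) (not_le.2 h1)
      by_contra hcon
      exact hX ⟨j, i, k, h2, hcon⟩
    have hpw : ∀ r, ENNReal.ofReal (patternWeight kh (s r).1 (s r).2.1)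
        = ∏ i, ENNReal.ofReal (kh (r i) fun j => ζ j (Y X i j)) := by
      intro r
      rw [patternWeight, ENNReal.ofReal_prod_of_nonneg fun i _ => (hkh0 _ _).le]
      refine Finset.prod_congr rfl fun i _ => ?_
      congr 1
      exact hkhdep (r i) _ _ fun j hj =>
        maskCell_of_observed (r := r i) (fun j => ζ j (Y X i j)) hj
    have hb : ∀ r : Fin n → Pattern p, ∏ i, ENNReal.ofReal (kh (r i) fun j => ζ j (Y X i j)) ≠ 0 := fun r =>
      Finset.prod_ne_zero_iff.2 fun i _ => (ENNReal.ofReal_pos.2 (hkh0 _ _)).ne'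
    have hb' : ∀ r : Fin n → Pattern p, ∏ i, ENNReal.ofReal (kh (r i) fun j => ζ j (Y X i j)) ≠ ∞ := fun r =>
      ENNReal.prod_ne_top fun i _ => ENNReal.ofReal_ne_top
    have hterm : ∀ r, g (Y X) r ≤ a * (if s r ∈ B then
        ENNReal.ofReal (patternWeight kh (s r).1 (s r).2.1) else 0)
        + a⁻¹ * ∏ i, (κ (Y X i) {r i} *
          (κ (Y X i) {r i} / ENNReal.ofReal (kh (r i) fun j => ζ j (Y X i j)))) := by
      intro r
      by_cases h : s r ∈ B
      · rw [if_pos h, hpw]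
        have hind : S.indicator (1 : (Fin n → (Fin p → ℝ) × Pattern p) → ℝ≥0∞) (fun i => (Y X i, r i)) = 1 :=
          Set.indicator_of_mem (show (fun i => (Y X i, r i)) ∈ S from h) _
        simp only [hg]
        rw [hind, mul_one]
        refine (le_mul_add_sq_div ha0 ha1 (hb r) (hb' r)).trans (le_of_eq ?_)
        congr 2
        rw [Finset.prod_mul_distrib]
        congr 1
        simp only [div_eq_mul_inv]
        rw [Finset.prod_mul_distrib, ENNReal.prod_inv_distrib]
        intro i _ k _ _
        exact Or.inl (ENNReal.ofReal_pos.2 (hkh0 _ _)).ne'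
      · have hind : S.indicator (1 : (Fin n → (Fin p → ℝ) × Pattern p) → ℝ≥0∞) (fun i => (Y X i, r i)) = 0 :=
          Set.indicator_of_notMem (show (fun i => (Y X i, r i)) ∉ S from h) _
        simp only [hg]
        rw [hind, mul_zero]
        exact zero_le
    refine (Finset.sum_le_sum fun r _ => hterm r).trans ?_
    rw [Finset.sum_add_distrib, ← Finset.mul_sum, ← Finset.mul_sum,
      ← Fintype.prod_sum (fun i r => κ (Y X i) {r} *
          (κ (Y X i) {r} / ENNReal.ofReal (kh r fun j => ζ j (Y X i j))))]
    refine add_le_add (mul_le_mul_right ?_ a) le_rfl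
    have hinj : Function.Injective s := fun r r' h => congrArg Prod.fst h
    refine le_trans (le_of_eq ?_) (sum_ite_mem_le_sum B hinj fun x =>
      ENNReal.ofReal (patternWeight kh x.1 x.2.1) *
        (orderEvent x.2.2).indicator 1 (fun i => latentMap C (X i)))
    refine Finset.sum_congr rfl fun r _ => ?_
    rw [Set.indicator_of_mem (hmem r), Pi.one_apply, mul_one]
  have hpt : ∀ X, ∑ r, g (Y X) r ≤ (toMeasurable P E).indicator 1 X +
      (a * ∑ s ∈ B, ENNReal.ofReal (patternWeight kh s.1 s.2.1) *
        (orderEvent s.2.2).indicator 1 (fun i => latentMap C (X i)) + a⁻¹ * Q (Y X)) := by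
    intro X
    by_cases h : X ∈ E
    · rw [Set.indicator_of_mem (subset_toMeasurable P E h)]
      exact (hgsum _).trans le_self_add
    · exact (hoff X h).trans le_add_self
  have hCm : ∀ s : RankData p N n, Measurable fun X : Fin n → EuclideanSpace ℝ (Fin p) =>
      (orderEvent s.2.2).indicator (1 : (Fin n → EuclideanSpace ℝ (Fin p)) → ℝ≥0∞)
        (fun i => latentMap C (X i)) := fun s =>
    (measurable_one.indicator (measurableSet_orderEvent s.2.2)).comp (measurable_pi_lambda _
      fun i => (latentMap C).continuous.measurable.comp (measurable_pi_apply i))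
  have hQint : ∫⁻ X, Q (Y X) ∂P ≤ ENNReal.ofReal ((1 + ε) ^ n) := by
    calc ∫⁻ X, Q (Y X) ∂P = ∫⁻ y, Q y ∂(Measure.pi fun _ : Fin n => gaussianCopula C₀ F) := by
          rw [pi_gaussianCopula_eq_map, lintegral_map hQm hYm]
      _ = ∏ _i : Fin n, ∫⁻ y, ∑ r, κ y {r} *
            (κ y {r} / ENNReal.ofReal (kh r fun j => ζ j (y j))) ∂(gaussianCopula C₀ F) :=
          lintegral_pi_prod _ _ fun i => Finset.measurable_sum _ fun r _ =>
            (hκm r).mul ((hκm r).div (hζm r))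
      _ ≤ ∏ _i : Fin n, ENNReal.ofReal (1 + ε) := Finset.prod_le_prod' fun i _ => hint
      _ = _ := by
          rw [Finset.prod_const, Finset.card_univ, Fintype.card_fin,
            ENNReal.ofReal_pow (by linarith)]
  calc (Measure.pi fun _ : Fin n => gaussianCopula C₀ F ⊗ₘ κ) S
      = ∫⁻ X, ∑ r, g (Y X) r ∂P := by
        rw [pi_compProd_apply _ κ hSm, pi_gaussianCopula_eq_map, lintegral_map hgm hYm]
    _ ≤ ∫⁻ X, ((toMeasurable P E).indicator 1 X +
      (a * ∑ s ∈ B, ENNReal.ofReal (patternWeight kh s.1 s.2.1) *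
        (orderEvent s.2.2).indicator 1 (fun i => latentMap C (X i)) + a⁻¹ * Q (Y X))) ∂P :=
        lintegral_mono hpt
    _ = P E + (a * ∑ s ∈ B, ENNReal.ofReal (patternWeight kh s.1 s.2.1) *
            Measure.pi (fun _ : Fin n => latentLaw C) (orderEvent s.2.2)
          + a⁻¹ * ∫⁻ X, Q (Y X) ∂P) := by
        rw [lintegral_add_left (measurable_one.indicator (measurableSet_toMeasurable P E)),
          lintegral_indicator_one (measurableSet_toMeasurable P E), measure_toMeasurable,
          lintegral_add_left ((Finset.measurable_sum _ fun s _ =>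
            (hCm s).const_mul _).const_mul _), lintegral_const_mul _ (Finset.measurable_sum _
              fun s _ => (hCm s).const_mul _), lintegral_const_mul _ (show Measurable fun X => Q (Y X) from hQm.comp hYm),
          lintegral_finsetSum _ fun s _ => (hCm s).const_mul _]
        congr 3
        refine Finset.sum_congr rfl fun s _ => ?_
        rw [lintegral_const_mul _ (hCm s), ← lintegral_indicator_one
          (measurableSet_orderEvent s.2.2), lintegral_pi_latentLaw C
          (measurable_one.indicator (measurableSet_orderEvent s.2.2))]
    _ ≤ ENNReal.ofReal ((2 * p + 4 * p ^ 2) * ((n : ℝ) + 1)⁻¹ ^ 2) +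
          (a * ∑ s ∈ B, ENNReal.ofReal (patternWeight kh s.1 s.2.1) *
            Measure.pi (fun _ : Fin n => latentLaw C) (orderEvent s.2.2)
          + a⁻¹ * ENNReal.ofReal ((1 + ε) ^ n)) := by gcongr
    _ ≤ ENNReal.ofReal ((2 * p + 4 * p ^ 2) * ((n : ℝ) + 1)⁻¹ ^ 2) +
          (a * ∑ s ∈ B, ENNReal.ofReal (patternWeight kh s.1 s.2.1) *
            Measure.pi (fun _ : Fin n => latentLaw C) (orderEvent s.2.2)
          + ENNReal.ofReal (Real.exp (-(ε * n)))) := by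
        refine add_le_add le_rfl (add_le_add le_rfl ?_)
        rw [ha, ← ENNReal.ofReal_inv_of_pos (Real.exp_pos _), ← Real.exp_neg,
          ← ENNReal.ofReal_mul (Real.exp_pos _).le]
        refine ENNReal.ofReal_le_ofReal ?_
        have h1 : (1 + ε) ^ n ≤ Real.exp (ε * n) := by
          rw [mul_comm, Real.exp_nat_mul]
          gcongr
          rw [add_comm]; exact Real.add_one_le_exp ε
        calc _ ≤ Real.exp (-(2 * ε * n)) * Real.exp (ε * n) :=
              mul_le_mul_of_nonneg_left h1 (Real.exp_pos _).le
          _ = _ := by rw [← Real.exp_add]; congr 1; ring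
    _ = _ := by
        rw [ENNReal.ofReal_add (by positivity) (by positivity)]
        ring

/-! ### Prior mass of shrinking neighbourhoods -/

theorem abs_correlation_le_one {p : ℕ} (C : CorrelationMatrix p) (j k : Fin p) :
    |C.1 j k| ≤ 1 := by
  have := sq_correlation_le_one C j k
  rwa [sq_le_one_iff_abs_le_one] at this

theorem measurable_correlation_entry {p : ℕ} (j k : Fin p) :
    Measurable fun C : CorrelationMatrix p => C.1 j k :=
  ((continuous_apply_apply j k).comp (show Continuous fun C : CorrelationMatrix p => C.1 from
    continuous_induced_dom)).measurable

/-- The grid cell of a correlation matrix, at mesh `(n + 1)⁻¹ ^ 11` in each entry. -/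
noncomputable def correlationCell {p : ℕ} (n : ℕ) (C : CorrelationMatrix p) :
    Fin p → Fin p → ℤ :=
  fun j k => ⌊C.1 j k * ((n : ℝ) + 1) ^ 11⌋

theorem measurable_correlationCell {p : ℕ} (n : ℕ) :
    Measurable (correlationCell (p := p) n) :=
  measurable_pi_lambda _ fun j => measurable_pi_lambda _ fun k =>
    Int.measurable_floor.comp ((measurable_correlation_entry j k).mul_const _)

theorem abs_sub_le_of_correlationCell_eq {p n : ℕ} {C C' : CorrelationMatrix p}
    (h : correlationCell n C = correlationCell n C') (j k : Fin p) :
    |C.1 j k - C'.1 j k| ≤ ((n : ℝ) + 1)⁻¹ ^ 11 := by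
  have h1 := Int.abs_sub_lt_one_of_floor_eq_floor (congrFun (congrFun h j) k)
  have h0 : (0 : ℝ) < ((n : ℝ) + 1) ^ 11 := by positivity
  rw [← sub_mul, abs_mul, abs_of_pos h0, ← lt_div_iff₀ h0] at h1
  rw [inv_pow, ← one_div]
  exact h1.le

/-- The number of grid cells that can contain correlation matrices. -/
def correlationCellCount (p n : ℕ) : ℕ := ((2 * (n + 1) ^ 11 + 1) ^ p) ^ p

/-- Almost every correlation matrix eventually has cells of at least polynomially small prior
mass, since the cells with less mass have a summable total mass. -/
theorem ae_eventually_le_measure_correlationCell {p : ℕ} (prior : Measure (CorrelationMatrix p))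
    [IsProbabilityMeasure prior] :
    ∀ᵐ C ∂prior, ∀ᶠ n : ℕ in atTop,
      ENNReal.ofReal (((correlationCellCount p n : ℝ))⁻¹ * (((n : ℝ) + 1) ^ 2)⁻¹)
        ≤ prior (correlationCell n ⁻¹' {correlationCell n C}) := by
  classical
  set θ : ℕ → ℝ := fun n => ((correlationCellCount p n : ℝ))⁻¹ * (((n : ℝ) + 1) ^ 2)⁻¹ with hθ
  have hpos : ∀ n, (0 : ℝ) < correlationCellCount p n := fun n => by
    unfold correlationCellCount; positivity
  set S : ℕ → Set (CorrelationMatrix p) := fun n =>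
    {C | prior (correlationCell n ⁻¹' {correlationCell n C}) < ENNReal.ofReal (θ n)} with hS
  have hbound : ∀ n, prior (S n) ≤ ENNReal.ofReal ((((n : ℝ) + 1) ^ 2)⁻¹) := by
    intro n
    set I : Finset (Fin p → Fin p → ℤ) := Fintype.piFinset fun _ => Fintype.piFinset fun _ =>
      Finset.Icc (-((n + 1 : ℤ) ^ 11)) ((n + 1 : ℤ) ^ 11) with hI
    have hIcard : I.card = correlationCellCount p n := by
      simp only [hI, Fintype.card_piFinset, Finset.prod_const, Finset.card_univ, Fintype.card_fin,
        Int.card_Icc, correlationCellCount]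
      congr 2
      have : ((n + 1 : ℤ) ^ 11) = (((n + 1) ^ 11 : ℕ) : ℤ) := by push_cast; ring
      rw [this]
      omega
    have hmemI : ∀ C : CorrelationMatrix p, correlationCell n C ∈ I := by
      intro C
      simp only [hI, Fintype.mem_piFinset, Finset.mem_Icc]
      intro j k
      have h0 : (0 : ℝ) ≤ ((n : ℝ) + 1) ^ 11 := by positivity
      have h1 := abs_le.1 (abs_correlation_le_one C j k)
      constructor
      · refine Int.le_floor.2 ?_
        push_cast
        nlinarith
      · have : (⌊C.1 j k * ((n : ℝ) + 1) ^ 11⌋ : ℝ) ≤ ((n : ℝ) + 1) ^ 11 :=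
          (Int.floor_le _).trans (by nlinarith)
        unfold correlationCell
        exact_mod_cast this
    have hsub : S n ⊆ ⋃ a ∈ I.filter fun a =>
        prior (correlationCell n ⁻¹' {a}) < ENNReal.ofReal (θ n), correlationCell n ⁻¹' {a} := by
      intro C hC
      exact Set.mem_biUnion (Finset.mem_coe.2 (Finset.mem_filter.2 ⟨hmemI C, hC⟩)) rfl
    calc prior (S n) ≤ ∑ a ∈ I.filter fun a =>
          prior (correlationCell n ⁻¹' {a}) < ENNReal.ofReal (θ n),
            prior (correlationCell n ⁻¹' {a}) :=
          (measure_mono hsub).trans (measure_biUnion_finset_le _ _)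
      _ ≤ ∑ a ∈ I.filter fun a =>
          prior (correlationCell n ⁻¹' {a}) < ENNReal.ofReal (θ n), ENNReal.ofReal (θ n) :=
          Finset.sum_le_sum fun a ha => (Finset.mem_filter.1 ha).2.le
      _ ≤ ∑ a ∈ I, ENNReal.ofReal (θ n) :=
          Finset.sum_le_sum_of_subset (Finset.filter_subset _ _)
      _ = ENNReal.ofReal ((((n : ℝ) + 1) ^ 2)⁻¹) := by
          rw [Finset.sum_const, nsmul_eq_mul, hIcard, ← ENNReal.ofReal_natCast,
            ← ENNReal.ofReal_mul (hpos n).le]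
          congr 1
          rw [hθ]
          field_simp [(hpos n).ne']
  have hsum : ∑' n, prior (S n) ≠ ∞ := by
    have hs : Summable fun n : ℕ => (((n : ℝ) + 1) ^ 2)⁻¹ := by
      have := (summable_nat_add_iff 1).2 (Real.summable_nat_pow_inv.2 one_lt_two)
      simpa using this
    exact ne_top_of_le_ne_top hs.tsum_ofReal_ne_top (ENNReal.tsum_le_tsum hbound)
  filter_upwards [ae_eventually_notMem hsum] with C hC
  filter_upwards [hC] with n hn
  exact not_lt.1 hn

/-! ### Ties -/

open Classical in
/-- In an i.i.d. sequence, the number of distinct values taken at least twice among the first `n`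
terms is almost surely `o(n)`: repeated values are atoms, all but finitely many of which have
arbitrarily small total mass. -/
theorem ae_eventually_card_repeated_le {α : Type*} [MeasurableSpace α] (μ : Measure α)
    [IsProbabilityMeasure μ] {f : α → ℝ} (hf : Measurable f) {δ : ℝ} (hδ : 0 < δ) :
    ∀ᵐ ω ∂(Measure.infinitePi fun _ : ℕ => μ), ∀ᶠ n : ℕ in atTop,
      (((Finset.univ.filter fun i : Fin n => ∃ k : Fin n, k ≠ i ∧ f (ω k) = f (ω i)).image
        fun i : Fin n => f (ω i)).card : ℝ) ≤ δ * n := by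
  set P := Measure.infinitePi fun _ : ℕ => μ with hP
  have hlevel : ∀ x, MeasurableSet {a | f a = x} := fun x => hf (measurableSet_singleton x)
  have hcount : {x : ℝ | 0 < μ {a | f a = x}}.Countable :=
    Measure.countable_meas_level_set_pos hf
  set small : ℕ → Set ℝ := fun m =>
    {x | 0 < μ {a | f a = x} ∧ μ {a | f a = x} < ((m : ℝ≥0∞) + 1)⁻¹} with hsmall
  have hsmallm : ∀ m, MeasurableSet (small m) := fun m =>
    (hcount.mono fun x hx => hx.1).measurableSet
  -- a small tail of the atoms
  obtain ⟨m, hm⟩ : ∃ m, μ (f ⁻¹' small m) < ENNReal.ofReal (δ / 2) := by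
    have hanti : Antitone fun m => f ⁻¹' small m := by
      intro a b hab x hx
      refine ⟨hx.1, hx.2.trans_le ?_⟩
      gcongr
    have hlim := tendsto_measure_iInter_atTop (μ := μ)
      (fun m => (hf (hsmallm m)).nullMeasurableSet) hanti ⟨0, measure_ne_top _ _⟩
    have hempty : (⋂ m, f ⁻¹' small m) = ∅ := by
      ext a
      simp only [Set.mem_iInter, Set.mem_preimage, Set.mem_empty_iff_false, iff_false]
      intro h
      have h0 := (h 0).1
      obtain ⟨m, hm⟩ := ENNReal.exists_inv_nat_lt h0.ne'
      refine absurd ((h m).2.trans_le ?_) (not_lt.2 hm.le)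
      exact ENNReal.inv_le_inv.2 le_self_add
    rw [hempty, measure_empty] at hlim
    exact (hlim.eventually (gt_mem_nhds (ENNReal.ofReal_pos.2 (half_pos hδ)))).exists
  have hfin : {x : ℝ | ((m : ℝ≥0∞) + 1)⁻¹ ≤ μ {a | f a = x}}.Finite :=
    Measure.finite_const_le_meas_of_disjoint_iUnion μ
      (ENNReal.inv_pos.2 (ENNReal.add_ne_top.2 ⟨ENNReal.natCast_ne_top m, ENNReal.one_ne_top⟩))
      hlevel (fun s t hst => Disjoint.preimage f (Set.disjoint_singleton.2 hst))
      (measure_ne_top _ _)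
  set L : Finset ℝ := hfin.toFinset with hL
  -- equal values are atoms
  have hatom : ∀ᵐ ω ∂P, ∀ i k : ℕ, k ≠ i → f (ω k) = f (ω i) → 0 < μ {a | f a = f (ω i)} := by
    rw [ae_all_iff]; intro i
    rw [ae_all_iff]; intro k
    by_cases hki : k = i
    · exact ae_of_all _ fun ω h => absurd hki h
    set At : Set ℝ := {x : ℝ | 0 < μ {a | f a = x}} with hAt
    have hAtm : MeasurableSet At := hcount.measurableSet
    set S : Set (α × α) := {q | f q.1 = f q.2 ∧ f q.2 ∉ At} with hS
    have hSm : MeasurableSet S :=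
      (measurableSet_eq_fun (hf.comp measurable_fst) (hf.comp measurable_snd)).inter
        ((hf.comp measurable_snd) hAtm.compl)
    have h0 : (μ.prod μ) S = 0 := by
      rw [Measure.prod_apply_symm hSm]
      refine (lintegral_congr fun b => ?_).trans lintegral_zero
      by_cases hb : f b ∈ At
      · have : (fun a => (a, b)) ⁻¹' S = ∅ := by
          ext a; simp [hS, hb]
        rw [this, measure_empty]
      · have h1 : (fun a => (a, b)) ⁻¹' S ⊆ {a | f a = f b} := fun a ha => ha.1
        have h2 : μ {a | f a = f b} = 0 := by
          by_contra hne
          exact hb (pos_iff_ne_zero.2 hne)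
        exact measure_mono_null h1 h2
    have hmap := Measure.infinitePi_map_eval_prod (P := fun _ : ℕ => μ) hki
    rw [← hmap, Measure.map_apply (by fun_prop) hSm] at h0
    have h1 : ∀ᵐ ω ∂P, ω ∉ (fun ω : ℕ → α => (ω k, ω i)) ⁻¹' S := measure_eq_zero_iff_ae_notMem.1 h0
    filter_upwards [h1] with ω hω _ heq
    by_contra hcon
    exact hω ⟨heq, hcon⟩
  have hind : Measurable ((f ⁻¹' small m).indicator (1 : α → ℝ)) :=
    measurable_one.indicator (hf (hsmallm m))
  have hint : Integrable ((f ⁻¹' small m).indicator (1 : α → ℝ)) μ :=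
    (integrable_const (1 : ℝ)).indicator (hf (hsmallm m))
  have hslln := strong_law_infinitePi μ hind hint
  have hmean : ∫ a, (f ⁻¹' small m).indicator (1 : α → ℝ) a ∂μ < δ / 2 := by
    rw [integral_indicator_one (hf (hsmallm m)), measureReal_def]
    exact ENNReal.toReal_lt_of_lt_ofReal hm
  filter_upwards [hatom, hslln] with ω h1 h2
  have h3 : ∀ᶠ n : ℕ in atTop, (L.card : ℝ) ≤ δ / 2 * n :=
    (tendsto_natCast_atTop_atTop.const_mul_atTop (half_pos hδ)).eventually_ge_atTop _
  filter_upwards [h2.eventually (gt_mem_nhds hmean), h3, eventually_gt_atTop 0] with n hn hn' hn0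
  have hn0' : (0 : ℝ) < n := by exact_mod_cast hn0
  rw [div_lt_iff₀ hn0'] at hn
  have hsum : ∑ i : Fin n, (f ⁻¹' small m).indicator (1 : α → ℝ) (ω i)
      = ((Finset.univ.filter fun i : Fin n => ω i ∈ f ⁻¹' small m).card : ℝ) := by
    simp only [Set.indicator_apply, Pi.one_apply, Finset.sum_boole]
  rw [hsum] at hn
  have hsub : ((Finset.univ.filter fun i : Fin n => ∃ k : Fin n, k ≠ i ∧ f (ω k) = f (ω i)).image
        fun i : Fin n => f (ω i))
      ⊆ L ∪ (Finset.univ.filter fun i : Fin n => ω i ∈ f ⁻¹' small m).image fun i : Fin n => f (ω i) := by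
    intro x hx
    obtain ⟨i, hi, rfl⟩ := Finset.mem_image.1 hx
    obtain ⟨k, hki, hk⟩ := (Finset.mem_filter.1 hi).2
    have hpos := h1 i k (fun h => hki (Fin.ext h)) hk
    by_cases hbig : ((m : ℝ≥0∞) + 1)⁻¹ ≤ μ {a | f a = f (ω i)}
    · exact Finset.mem_union_left _ (hfin.mem_toFinset.2 hbig)
    · refine Finset.mem_union_right _ (Finset.mem_image_of_mem _ ?_)
      exact Finset.mem_filter.2 ⟨Finset.mem_univ _, hpos, not_le.1 hbig⟩
  have hcard := (Finset.card_le_card hsub).trans ((Finset.card_union_le _ _).trans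
    (Nat.add_le_add_left Finset.card_image_le _))
  have hcard' : (((Finset.univ.filter fun i : Fin n =>
      ∃ k : Fin n, k ≠ i ∧ f (ω k) = f (ω i)).image fun i : Fin n => f (ω i)).card : ℝ)
      ≤ L.card + (Finset.univ.filter fun i : Fin n => ω i ∈ f ⁻¹' small m).card := by
    exact_mod_cast hcard
  linarith

/-! ### Cut points -/

/-- A CDF with values in `{0, 1}` is the CDF of a point mass. -/
theorem exists_cdf_mem_Ioo {μ : Measure ℝ} [IsProbabilityMeasure μ]
    (h : ∀ x, μ ≠ Measure.dirac x) : ∃ x, 0 < cdf μ x ∧ cdf μ x < 1 := by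
  by_contra! hcon
  have h01 : ∀ x, cdf μ x = 0 ∨ cdf μ x = 1 := fun x => by
    rcases (cdf_nonneg μ x).lt_or_eq with hx | hx
    · exact Or.inr (le_antisymm (cdf_le_one μ x) (hcon x hx))
    · exact Or.inl hx.symm
  set x := quantile μ (1 / 2) with hx
  have hq : ∀ y, x ≤ y ↔ 1 / 2 ≤ cdf μ y :=
    fun y => quantile_le_iff μ (by norm_num) (by norm_num) y
  refine h x (Measure.eq_of_cdf _ _ (StieltjesFunction.ext fun y => ?_))
  rw [cdf_eq_real (Measure.dirac x), measureReal_def, Measure.dirac_apply' _ measurableSet_Iic]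
  by_cases hy : x ≤ y
  · have h1 := (hq y).1 hy
    rcases h01 y with h2 | h2
    · rw [h2] at h1; norm_num at h1
    · simp [h2, hy]
  · have h1 : cdf μ y = 0 := by
      rcases h01 y with h2 | h2
      · exact h2
      · exact absurd ((hq y).2 (by rw [h2]; norm_num)) hy
    simp [h1, hy]

/-- The normal CDF is at most `c` on a closed half-line; by symmetry, its end point is minus a
quantile. -/
theorem exists_stdNormalCDF_le_iff {c : ℝ} (h0 : 0 < c) (h1 : c < 1) :
    ∃ t, ∀ z, stdNormalCDF z ≤ c ↔ z ≤ t := by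
  have hsymm : ∀ z, stdNormalCDF z = 1 - stdNormalCDF (-z) := by
    intro z
    unfold stdNormalCDF
    rw [cdf_eq_real, cdf_eq_real]
    have hneg : (gaussianReal 0 1).real (Set.Iic (-z)) = (gaussianReal 0 1).real (Set.Ici z) := by
      have h := gaussianReal_map_neg (μ := 0) (v := 1)
      rw [neg_zero] at h
      conv_lhs => rw [← h]
      rw [map_measureReal_apply measurable_neg measurableSet_Iic]
      congr 1
      ext y; simp
    have := nullSingletonClass_gaussianReal (μ := 0) (one_ne_zero : (1 : ℝ≥0) ≠ 0)
    have hIci : (gaussianReal 0 1).real (Set.Ici z) = (gaussianReal 0 1).real (Set.Ioi z) :=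
      measureReal_congr Ioi_ae_eq_Ici.symm
    have hc := probReal_compl_eq_one_sub (μ := gaussianReal 0 1) (measurableSet_Iic (a := z))
    rw [Set.compl_Iic] at hc
    rw [hneg, hIci, hc]
    ring
  refine ⟨-quantile (gaussianReal 0 1) (1 - c), fun z => ?_⟩
  have h2 := quantile_le_iff (gaussianReal 0 1) (u := 1 - c) (by linarith) (by linarith) (-z)
  have h3 : stdNormalCDF (-z) = cdf (gaussianReal 0 1) (-z) := rfl
  rw [hsymm, h3]
  constructor
  · intro h
    have := h2.2 (by linarith)
    linarith
  · intro h
    have := h2.1 (by linarith)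
    linarith

/-- For a margin which is not a point mass there is a threshold on the observed scale which
corresponds to a finite threshold on the latent scale. -/
theorem exists_threshold {μ : Measure ℝ} [IsProbabilityMeasure μ]
    (h : ∀ x, μ ≠ Measure.dirac x) :
    ∃ x t : ℝ, ∀ z, quantile μ (stdNormalCDF z) ≤ x ↔ z ≤ t := by
  obtain ⟨x, h0, h1⟩ := exists_cdf_mem_Ioo h
  obtain ⟨t, ht⟩ := exists_stdNormalCDF_le_iff h0 h1
  exact ⟨x, t, fun z => by
    rw [quantile_le_iff _ (stdNormalCDF_pos z) (stdNormalCDF_lt_one z), ht]⟩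

/-! ### Frequencies of complete cases -/

/-- The law of large numbers for the inversely weighted complete cases: their mean weight in a
quadrant is close to the probability of the quadrant, as `κ` is positive for complete cases and `kh`
hardly exceeds it. -/
theorem ae_eventually_enoughCases {p N : ℕ} (μ : Measure (Fin p → ℝ)) [IsProbabilityMeasure μ]
    (κ : Kernel (Fin p → ℝ) (Pattern p)) [IsMarkovKernel κ]
    {ζ : Fin p → ℝ → Fin (N + 1)} (hζ : ∀ j, Monotone (ζ j))
    {kh : Pattern p → (Fin p → Fin (N + 1)) → ℝ} {ε η γ : ℝ}
    (hη : 0 < η) (hγ : 0 < γ) (hεη : ε ≤ η * (γ / 2))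
    (hκη : μ {y | κ y {fun _ => false} < ENNReal.ofReal η} ≤ ENNReal.ofReal (γ / 2))
    (hκ : ∫⁻ y, (ENNReal.ofReal (kh (fun _ => false) fun j => ζ j (y j)) - κ y {fun _ => false}) ∂μ
      ≤ ENNReal.ofReal ε)
    (v : Fin p → Fin (N + 1)) (m : Fin p → Fin p → Bool × Bool → ℝ)
    (hm : ∀ j k q, m j k q = μ.real {y | quadrant v j k (fun l => ζ l (y l)) = q}) :
    ∀ᵐ ω ∂(Measure.infinitePi fun _ : ℕ => μ ⊗ₘ κ), ∀ᶠ n : ℕ in atTop,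
      EnoughCases kh η γ v m (fun i : Fin n => (ω i).2) fun i j => ζ j ((ω i).1 j) := by
  classical
  set r₀ : Pattern p := fun _ => false with hr₀
  set cell : (Fin p → ℝ) → Fin p → Fin (N + 1) := fun y j => ζ j (y j) with hcell
  have hcellm : Measurable cell := measurable_pi_lambda _ fun j =>
    (hζ j).measurable.comp (measurable_pi_apply j)
  have hκm : Measurable fun y => κ y {r₀} := κ.measurable_coe (measurableSet_singleton r₀)
  have hkey : ∀ j k q, ∀ᵐ ω ∂(Measure.infinitePi fun _ : ℕ => μ ⊗ₘ κ), ∀ᶠ n : ℕ in atTop,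
      n * (m j k q - 2 * γ) ≤ ∑ i : Fin n, caseTerm kh η v j k q (ω i).2 (cell (ω i).1) := by
    intro j k q
    set φ : (Fin p → ℝ) × Pattern p → ℝ := fun a => caseTerm kh η v j k q a.2 (cell a.1) with hφ
    have hφm : Measurable φ :=
      (measurable_of_finite fun a : Pattern p × (Fin p → Fin (N + 1)) =>
        caseTerm kh η v j k q a.1 a.2).comp (measurable_snd.prodMk (hcellm.comp measurable_fst))
    have hw0 : ∀ c, 0 < caseWeight kh η c := fun c =>
      inv_pos.2 (lt_of_lt_of_le hη (le_max_right _ _))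
    have hφ0 : ∀ a, 0 ≤ φ a := fun a => by
      simp only [hφ, caseTerm]
      split_ifs <;> [exact (hw0 _).le; exact le_rfl]
    have hφ1 : ∀ a, φ a ≤ η⁻¹ := fun a => by
      simp only [hφ, caseTerm]
      split_ifs <;> [exact inv_anti₀ hη (le_max_right _ _); exact inv_nonneg.2 hη.le]
    have hint : Integrable φ (μ ⊗ₘ κ) :=
      Integrable.of_bound hφm.aestronglyMeasurable η⁻¹ (ae_of_all _ fun a => by
        rw [Real.norm_of_nonneg (hφ0 a)]; exact hφ1 a)
    set A : Set (Fin p → ℝ) := {y | quadrant v j k (cell y) = q} with hA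
    have hAm : MeasurableSet A := by
      have : Measurable fun y => quadrant v j k (cell y) :=
        (measurable_of_finite (quadrant v j k)).comp hcellm
      exact this (measurableSet_singleton q)
    -- the mean is close to the probability of the quadrant
    have hmean : m j k q ≤ ∫ a, φ a ∂(μ ⊗ₘ κ) + γ := by
      have hlin : ENNReal.ofReal (∫ a, φ a ∂(μ ⊗ₘ κ))
          = ∫⁻ y, κ y {r₀} * (A.indicator (fun y => ENNReal.ofReal (caseWeight kh η (cell y))) y)
            ∂μ := by
        rw [ofReal_integral_eq_lintegral_ofReal hint (ae_of_all _ hφ0),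
          Measure.lintegral_compProd hφm.ennreal_ofReal]
        refine lintegral_congr fun y => ?_
        rw [lintegral_fintype, Finset.sum_eq_single r₀]
        · rw [mul_comm]
          congr 1
          by_cases hy : y ∈ A
          · rw [Set.indicator_of_mem hy]
            simp only [hφ, caseTerm]
            rw [if_pos ⟨rfl, hy⟩]
          · rw [Set.indicator_of_notMem hy]
            simp only [hφ, caseTerm]
            rw [if_neg fun h => hy h.2, ENNReal.ofReal_zero]
        · intro r _ hr
          simp only [hφ, caseTerm]
          rw [if_neg fun h => hr h.1, ENNReal.ofReal_zero, zero_mul]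
        · simp
      have hpt : ∀ y, A.indicator (1 : (Fin p → ℝ) → ℝ≥0∞) y
          ≤ κ y {r₀} * (A.indicator (fun y => ENNReal.ofReal (caseWeight kh η (cell y))) y)
            + ({y | κ y {r₀} < ENNReal.ofReal η}.indicator 1 y
              + ENNReal.ofReal η⁻¹ * (ENNReal.ofReal (kh r₀ (cell y)) - κ y {r₀})) := by
        intro y
        by_cases hy : y ∈ A
        swap
        · rw [Set.indicator_of_notMem hy]; exact zero_le
        rw [Set.indicator_of_mem hy, Set.indicator_of_mem hy, Pi.one_apply]
        by_cases hlt : κ y {r₀} < ENNReal.ofReal η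
        · rw [Set.indicator_of_mem (show y ∈ {y | κ y {r₀} < ENNReal.ofReal η} from hlt)]
          exact le_add_left (le_add_right le_rfl)
        · rw [Set.indicator_of_notMem (show y ∉ {y | κ y {r₀} < ENNReal.ofReal η} from hlt),
            zero_add]
          have hk : κ y {r₀} = ENNReal.ofReal (κ y {r₀}).toReal :=
            (ENNReal.ofReal_toReal (measure_ne_top _ _)).symm
          set K : ℝ := (κ y {r₀}).toReal with hK
          have hK0 : 0 ≤ K := ENNReal.toReal_nonneg
          have hηK : η ≤ K := by
            rw [hk, not_lt] at hlt
            exact (ENNReal.ofReal_le_ofReal_iff hK0).1 hlt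
          have hW := hw0 (cell y)
          rw [hk, ← ENNReal.ofReal_sub _ hK0, ← ENNReal.ofReal_mul hK0]
          set H : ℝ := kh r₀ (cell y) with hH
          have hwdef : caseWeight kh η (cell y) = (max H η)⁻¹ := rfl
          have hmax : 0 < max H η := lt_of_lt_of_le hη (le_max_right _ _)
          -- `1 - K / max H η` is at most `(H - K) / η`, and negative if `H ≤ K`
          rcases le_total H K with hHK | hHK
          · refine le_add_right ?_
            rw [← ENNReal.ofReal_one]
            refine ENNReal.ofReal_le_ofReal ?_
            rw [hwdef, ← div_eq_mul_inv, le_div_iff₀ hmax, one_mul]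
            exact max_le hHK hηK
          · rw [← ENNReal.ofReal_mul (inv_nonneg.2 hη.le), ← ENNReal.ofReal_add (by positivity)
              (mul_nonneg (inv_nonneg.2 hη.le) (by linarith)), ← ENNReal.ofReal_one]
            refine ENNReal.ofReal_le_ofReal ?_
            have hHη : η ≤ H := hηK.trans hHK
            have hH0 : 0 < H := lt_of_lt_of_le hη hHη
            rw [hwdef, max_eq_left hHη]
            have h1 : (H - K) * H⁻¹ ≤ (H - K) * η⁻¹ :=
              mul_le_mul_of_nonneg_left (inv_anti₀ hη hHη) (by linarith)
            have h2 : (H - K) * H⁻¹ = 1 - K * H⁻¹ := by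
              rw [sub_mul, mul_inv_cancel₀ hH0.ne']
            linarith
      have hint0 : 0 ≤ ∫ a, φ a ∂(μ ⊗ₘ κ) := integral_nonneg hφ0
      have hle : μ A ≤ ENNReal.ofReal (∫ a, φ a ∂(μ ⊗ₘ κ)) + (ENNReal.ofReal (γ / 2)
          + ENNReal.ofReal (γ / 2)) := by
        have hSm : MeasurableSet {y | κ y {r₀} < ENNReal.ofReal η} :=
          measurableSet_lt hκm measurable_const
        have hwm : Measurable fun y => ENNReal.ofReal (caseWeight kh η (cell y)) :=
          ENNReal.measurable_ofReal.comp
            ((measurable_of_finite (caseWeight kh η)).comp hcellm)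
        calc μ A = ∫⁻ y, A.indicator 1 y ∂μ := (lintegral_indicator_one hAm).symm
          _ ≤ _ := lintegral_mono hpt
          _ = ENNReal.ofReal (∫ a, φ a ∂(μ ⊗ₘ κ)) + (μ {y | κ y {r₀} < ENNReal.ofReal η} +
              ENNReal.ofReal η⁻¹ *
                ∫⁻ y, (ENNReal.ofReal (kh r₀ (cell y)) - κ y {r₀}) ∂μ) := by
              rw [lintegral_add_left (show Measurable fun y => κ y {r₀} * A.indicator
                  (fun y => ENNReal.ofReal (caseWeight kh η (cell y))) y from
                  hκm.mul (hwm.indicator hAm)), hlin,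
                lintegral_add_left (measurable_one.indicator hSm), lintegral_indicator_one hSm,
                lintegral_const_mul' _ _ ENNReal.ofReal_ne_top]
          _ ≤ _ := by
              refine add_le_add le_rfl (add_le_add hκη ?_)
              calc _ ≤ ENNReal.ofReal η⁻¹ * ENNReal.ofReal ε := by gcongr
                _ ≤ _ := by
                  rw [← ENNReal.ofReal_mul (inv_nonneg.2 hη.le)]
                  refine ENNReal.ofReal_le_ofReal ?_
                  rw [inv_mul_le_iff₀ hη]
                  exact hεη
      rw [← ENNReal.ofReal_add (by positivity) (by positivity),
        ← ENNReal.ofReal_add hint0 (by positivity)] at hle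
      have := ENNReal.toReal_le_of_le_ofReal (by positivity) hle
      rw [hm, measureReal_def]
      linarith
    have hslln := strong_law_infinitePi (μ ⊗ₘ κ) hφm hint
    filter_upwards [hslln] with ω hω
    filter_upwards [hω.eventually (lt_mem_nhds (show m j k q - 2 * γ < _ by linarith)),
      eventually_gt_atTop 0] with n hn hn0
    have hn0' : (0 : ℝ) < n := by exact_mod_cast hn0
    rw [lt_div_iff₀ hn0', mul_comm] at hn
    exact hn.le
  have hall : ∀ᵐ ω ∂(Measure.infinitePi fun _ : ℕ => μ ⊗ₘ κ), ∀ j k q, ∀ᶠ n : ℕ in atTop,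
      n * (m j k q - 2 * γ) ≤ ∑ i : Fin n, caseTerm kh η v j k q (ω i).2 (cell (ω i).1) := by
    rw [ae_all_iff]; intro j
    rw [ae_all_iff]; intro k
    rw [ae_all_iff]; exact hkey j k
  filter_upwards [hall] with ω hω
  have h1 : ∀ᶠ n : ℕ in atTop, ∀ j k q,
      n * (m j k q - 2 * γ) ≤ ∑ i : Fin n, caseTerm kh η v j k q (ω i).2 (cell (ω i).1) := by
    rw [eventually_all]; intro j
    rw [eventually_all]; intro k
    rw [eventually_all]; exact hω j k
  exact h1

/-! ### Consistency -/

/-- The prior average over `A` of the likelihood of the rank structure `s`. -/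
noncomputable def averagedLikelihood {p N n : ℕ} (prior : Measure (CorrelationMatrix p))
    (A : Set (CorrelationMatrix p)) (s : RankData p N n) : ℝ≥0∞ :=
  ∫⁻ C in A, Measure.pi (fun _ : Fin n => latentLaw C) (orderEvent s.2.2) ∂prior

theorem measurable_likelihood {p N n : ℕ} (s : RankData p N n) :
    Measurable fun C : CorrelationMatrix p =>
      Measure.pi (fun _ : Fin n => latentLaw C) (orderEvent s.2.2) :=
  measurable_pi_latentLaw_apply (measurableSet_orderEvent _)

theorem averagedLikelihood_rankData {p N n : ℕ} (prior : Measure (CorrelationMatrix p))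
    (A : Set (CorrelationMatrix p)) (ζ : Fin p → ℝ → Fin (N + 1))
    (ω : ℕ → (Fin p → ℝ) × Pattern p) :
    averagedLikelihood prior A (rankData ζ fun i : Fin n => ω i)
      = ∫⁻ C in A, rankLikelihood n ω C ∂prior := by
  unfold averagedLikelihood rankLikelihood
  rw [rankEvent_eq_orderEvent ζ]

open Classical in
/-- The probability that the rank structure lies in a set `B` on which the likelihood, averaged over
the prior, favours `W` over the cell of the true correlation matrix. It is bounded by the sum over `B`
of the likelihoods averaged over that cell, hence by the sum of those averaged over `W`. -/
theorem pi_rankData_mem_le_of_averagedLikelihood_le {p N n : ℕ}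
    (prior : Measure (CorrelationMatrix p)) [IsProbabilityMeasure prior]
    {C₀ : CorrelationMatrix p} (F : Fin p → Measure ℝ)
    (κ : Kernel (Fin p → ℝ) (Pattern p)) [IsMarkovKernel κ]
    {ζ : Fin p → ℝ → Fin (N + 1)} (hζ : ∀ j, Monotone (ζ j))
    {kh : Pattern p → (Fin p → Fin (N + 1)) → ℝ} {ε : ℝ} (hε : 0 < ε)
    (hkh0 : ∀ r c, 0 < kh r c)
    (hkhdep : ∀ r c c', (∀ j, r j = false → c j = c' j) → kh r c = kh r c')
    (hint : ∫⁻ y, ∑ r, κ y {r} * (κ y {r} / ENNReal.ofReal (kh r fun j => ζ j (y j)))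
      ∂(gaussianCopula C₀ F) ≤ ENNReal.ofReal (1 + ε))
    {W : Set (CorrelationMatrix p)} {a b : ℝ} (ha : 0 < a) (hb : 0 < b)
    (hprior : ENNReal.ofReal a ≤ prior (correlationCell n ⁻¹' {correlationCell n C₀}))
    {B : Finset (RankData p N n)}
    (hB : ∀ s ∈ B, ENNReal.ofReal b * averagedLikelihood prior
      (correlationCell n ⁻¹' {correlationCell n C₀}) s ≤ averagedLikelihood prior W s)
    {M : ℝ} (hM : ∀ C ∈ W, ∑ s ∈ B, ENNReal.ofReal (patternWeight kh s.1 s.2.1) *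
        Measure.pi (fun _ : Fin n => latentLaw C) (orderEvent s.2.2) ≤ ENNReal.ofReal M) :
    (Measure.pi fun _ : Fin n => gaussianCopula C₀ F ⊗ₘ κ) {y | rankData ζ y ∈ B}
      ≤ ENNReal.ofReal (a⁻¹ * b⁻¹ * Real.exp (2 * ε * n) * M)
        + ENNReal.ofReal ((2 * p + 4 * p ^ 2) * ((n : ℝ) + 1)⁻¹ ^ 2 + Real.exp (-(ε * n))) := by
  set V := correlationCell n ⁻¹' {correlationCell n C₀} with hV
  have hVm : MeasurableSet V := measurable_correlationCell n (Set.countable_singleton _).measurableSet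
  set P := (Measure.pi fun _ : Fin n => gaussianCopula C₀ F ⊗ₘ κ) {y | rankData ζ y ∈ B} with hP
  set e : ℝ≥0∞ := ENNReal.ofReal (Real.exp (2 * ε * n)) with he
  set β : ℝ≥0∞ :=
    ENNReal.ofReal ((2 * p + 4 * p ^ 2) * ((n : ℝ) + 1)⁻¹ ^ 2 + Real.exp (-(ε * n))) with hβ
  have hsumm : Measurable fun C : CorrelationMatrix p =>
      ∑ s ∈ B, ENNReal.ofReal (patternWeight kh s.1 s.2.1) *
        Measure.pi (fun _ : Fin n => latentLaw C) (orderEvent s.2.2) :=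
    Finset.measurable_sum _ fun s _ => (measurable_likelihood s).const_mul _
  have hswap : ∀ A : Set (CorrelationMatrix p),
      ∫⁻ C in A, ∑ s ∈ B, ENNReal.ofReal (patternWeight kh s.1 s.2.1) *
        Measure.pi (fun _ : Fin n => latentLaw C) (orderEvent s.2.2) ∂prior
      = ∑ s ∈ B, ENNReal.ofReal (patternWeight kh s.1 s.2.1) * averagedLikelihood prior A s := by
    intro A
    rw [lintegral_finsetSum _ fun s _ => (measurable_likelihood s).const_mul _]
    exact Finset.sum_congr rfl fun s _ => lintegral_const_mul _ (measurable_likelihood s)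
  have h1 : prior V * P ≤ e * ∑ s ∈ B, ENNReal.ofReal (patternWeight kh s.1 s.2.1) *
      averagedLikelihood prior V s + prior V * β := by
    calc prior V * P = ∫⁻ _ in V, P ∂prior := by rw [setLIntegral_const, mul_comm]
      _ ≤ ∫⁻ C in V, (e * ∑ s ∈ B, ENNReal.ofReal (patternWeight kh s.1 s.2.1) *
            Measure.pi (fun _ : Fin n => latentLaw C) (orderEvent s.2.2) + β) ∂prior := by
          refine setLIntegral_mono ((hsumm.const_mul _).add_const _) fun C hC => ?_
          exact pi_rankData_mem_le (abs_sub_le_of_correlationCell_eq (Eq.symm hC)) F κ hζ hε hkh0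
            hkhdep hint B
      _ = _ := by
          rw [lintegral_add_right _ measurable_const, lintegral_const_mul _ hsumm, hswap,
            setLIntegral_const, mul_comm β]
  have h2 : ENNReal.ofReal b * ∑ s ∈ B, ENNReal.ofReal (patternWeight kh s.1 s.2.1) *
      averagedLikelihood prior V s ≤ ENNReal.ofReal M := by
    calc _ = ∑ s ∈ B, ENNReal.ofReal (patternWeight kh s.1 s.2.1) *
          (ENNReal.ofReal b * averagedLikelihood prior V s) := by
          rw [Finset.mul_sum]
          exact Finset.sum_congr rfl fun s _ => mul_left_comm _ _ _
      _ ≤ ∑ s ∈ B, ENNReal.ofReal (patternWeight kh s.1 s.2.1) *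
          averagedLikelihood prior W s := Finset.sum_le_sum fun s hs => by gcongr; exact hB s hs
      _ = ∫⁻ C in W, ∑ s ∈ B, ENNReal.ofReal (patternWeight kh s.1 s.2.1) *
            Measure.pi (fun _ : Fin n => latentLaw C) (orderEvent s.2.2) ∂prior := (hswap W).symm
      _ ≤ ∫⁻ _ in W, ENNReal.ofReal M ∂prior := setLIntegral_mono measurable_const hM
      _ ≤ ENNReal.ofReal M := by
          rw [setLIntegral_const]
          exact mul_le_of_le_one_right zero_le prob_le_one
  have hb0 : ENNReal.ofReal b ≠ 0 := (ENNReal.ofReal_pos.2 hb).ne'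
  have h3 : ∑ s ∈ B, ENNReal.ofReal (patternWeight kh s.1 s.2.1) *
      averagedLikelihood prior V s ≤ (ENNReal.ofReal b)⁻¹ * ENNReal.ofReal M := by
    rw [← ENNReal.div_eq_inv_mul, ENNReal.le_div_iff_mul_le (Or.inl hb0)
      (Or.inl ENNReal.ofReal_ne_top), mul_comm]
    exact h2
  have hV0 : prior V ≠ 0 := fun h => by
    rw [h] at hprior
    exact absurd (ENNReal.ofReal_pos.2 ha) (not_lt.2 hprior)
  have hVt : prior V ≠ ∞ := measure_ne_top _ _
  have h4 : P ≤ (prior V)⁻¹ * (e * ((ENNReal.ofReal b)⁻¹ * ENNReal.ofReal M)) + β := by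
    calc P = (prior V)⁻¹ * (prior V * P) := by
          rw [← mul_assoc, ENNReal.inv_mul_cancel hV0 hVt, one_mul]
      _ ≤ (prior V)⁻¹ * (e * ((ENNReal.ofReal b)⁻¹ * ENNReal.ofReal M) + prior V * β) := by
          gcongr
          exact h1.trans (add_le_add (mul_le_mul_right h3 e) le_rfl)
      _ = _ := by
          rw [mul_add, ← mul_assoc (prior V)⁻¹ (prior V), ENNReal.inv_mul_cancel hV0 hVt, one_mul]
  refine h4.trans (add_le_add ?_ le_rfl)
  calc _ ≤ (ENNReal.ofReal a)⁻¹ * (e * ((ENNReal.ofReal b)⁻¹ * ENNReal.ofReal M)) := by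
        gcongr
    _ = ENNReal.ofReal (a⁻¹ * b⁻¹ * Real.exp (2 * ε * n) * M) := by
        rw [he, ← ENNReal.ofReal_inv_of_pos ha, ← ENNReal.ofReal_inv_of_pos hb,
          ← ENNReal.ofReal_mul (inv_nonneg.2 hb.le), ← ENNReal.ofReal_mul (Real.exp_pos _).le,
          ← ENNReal.ofReal_mul (inv_nonneg.2 ha.le)]
        congr 1
        ring

theorem summable_poly_mul_exp_neg (D : ℕ) {c : ℝ} (hc : 0 < c) :
    Summable fun n : ℕ => ((n : ℝ) + 1) ^ D * Real.exp (-(c * n)) := by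
  have h := (summable_nat_add_iff 1).2 (Real.summable_pow_mul_exp_neg_nat_mul D hc)
  refine (h.mul_left (Real.exp c)).congr fun n => ?_
  push_cast
  rw [mul_left_comm, ← Real.exp_add]
  congr 2
  ring

theorem summable_sq_inv (a : ℝ) : Summable fun n : ℕ => a * ((n : ℝ) + 1)⁻¹ ^ 2 := by
  have := (summable_nat_add_iff 1).2 (Real.summable_nat_pow_inv.2 one_lt_two)
  refine (this.mul_left a).congr fun n => ?_
  push_cast
  rw [inv_pow]

theorem correlationCellCount_le (p n : ℕ) :
    (correlationCellCount p n : ℝ) ≤ 3 ^ (p * p) * ((n : ℝ) + 1) ^ (11 * (p * p)) := by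
  unfold correlationCellCount
  push_cast
  rw [← pow_mul, pow_mul _ 11, ← mul_pow]
  gcongr
  have : (1 : ℝ) ≤ ((n : ℝ) + 1) ^ 11 := one_le_pow₀ (by linarith [Nat.cast_nonneg (α := ℝ) n])
  linarith

/-- An almost everywhere positive function is rarely small. -/
theorem exists_measure_lt_le {α : Type*} [MeasurableSpace α] {μ : Measure α}
    [IsProbabilityMeasure μ] {f : α → ℝ≥0∞} (hf : Measurable f) (hpos : ∀ᵐ a ∂μ, 0 < f a) {γ : ℝ}
    (hγ : 0 < γ) : ∃ η : ℝ, 0 < η ∧ η ≤ 1 ∧ μ {a | f a < ENNReal.ofReal η} ≤ ENNReal.ofReal γ := by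
  set S : ℕ → Set α := fun n => {a | f a < ENNReal.ofReal (((n : ℝ) + 1)⁻¹)} with hS
  have hanti : Antitone S := by
    intro a b hab x hx
    refine lt_of_lt_of_le hx (ENNReal.ofReal_le_ofReal ?_)
    gcongr
  have hlim := tendsto_measure_iInter_atTop (μ := μ) (s := S)
    (fun n => (measurableSet_lt hf measurable_const).nullMeasurableSet) hanti
    ⟨0, measure_ne_top _ _⟩
  have hnull : μ (⋂ n, S n) = 0 := by
    refine measure_mono_null (fun a ha => ?_) (ae_iff.1 hpos)
    show ¬ 0 < f a
    intro h0
    have hlim0 : Tendsto (fun n : ℕ => ENNReal.ofReal (((n : ℝ) + 1)⁻¹)) atTop (𝓝 0) := by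
      have := ENNReal.tendsto_ofReal (tendsto_one_div_add_atTop_nhds_zero_nat (𝕜 := ℝ))
      simpa using this
    obtain ⟨n, hn⟩ := (hlim0.eventually (gt_mem_nhds h0)).exists
    exact absurd (Set.mem_iInter.1 ha n) (not_lt.2 hn.le)
  rw [hnull] at hlim
  obtain ⟨n, hn⟩ := (hlim.eventually (ge_mem_nhds (ENNReal.ofReal_pos.2 hγ))).exists
  exact ⟨((n : ℝ) + 1)⁻¹, by positivity,
    inv_le_one_of_one_le₀ (by linarith [Nat.cast_nonneg (α := ℝ) n]), hn⟩

open Classical in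
/-- Correlation matrices whose entry `(j, k)` is off by at least `η₀` eventually have a negligible
share of the averaged likelihood. -/
theorem ae_eventually_averagedLikelihood_lt {p : ℕ} (prior : Measure (CorrelationMatrix p))
    [IsProbabilityMeasure prior] {F : Fin p → Measure ℝ} (hF : ∀ j, IsProbabilityMeasure (F j))
    (hF_nondeg : ∀ j x, F j ≠ Measure.dirac x)
    {κ : Kernel (Fin p → ℝ) (Pattern p)} [IsMarkovKernel κ] (hMAR : MissingAtRandom κ)
    {C₀ : CorrelationMatrix p}
    (hprior : ∀ᶠ n : ℕ in atTop,
      ENNReal.ofReal (((correlationCellCount p n : ℝ))⁻¹ * (((n : ℝ) + 1) ^ 2)⁻¹)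
        ≤ prior (correlationCell n ⁻¹' {correlationCell n C₀}))
    (hκ0 : ∀ᵐ y ∂(gaussianCopula C₀ F), 0 < κ y {fun _ => false})
    (j k : Fin p) {η₀ : ℝ} (hη₀ : 0 < η₀) :
    ∀ᵐ ω ∂(dataLaw C₀ F κ), ∀ᶠ n : ℕ in atTop,
      ∫⁻ C in {C | η₀ ≤ |C.1 j k - C₀.1 j k|}, rankLikelihood n ω C ∂prior
        < ENNReal.ofReal (((n : ℝ) + 1)⁻¹) * ∫⁻ C, rankLikelihood n ω C ∂prior := by
  set W : Set (CorrelationMatrix p) := {C | η₀ ≤ |C.1 j k - C₀.1 j k|} with hW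
  set μ := gaussianCopula C₀ F with hμ
  choose x t hxt using fun l => exists_threshold (μ := F l) (hF_nondeg l)
  obtain ⟨Δ, hΔ, hgap⟩ := exists_orthant_gap C₀ j k (t j) (t k) hη₀
  set γ : ℝ := min (Δ / 25) 1 with hγdef
  have hγ : 0 < γ := lt_min (by positivity) one_pos
  have hγ1 : γ ≤ 1 := min_le_right _ _
  have hγΔ : 25 * γ ≤ Δ := by
    have := min_le_left (Δ / 25) 1
    rw [← hγdef] at this
    linarith
  obtain ⟨η, hη, hη1, hκη⟩ := exists_measure_lt_le (κ.measurable_coe (measurableSet_singleton _))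
    hκ0 (half_pos hγ)
  set c : ℝ := γ ^ 2 * η / 4 with hc
  have hc0 : 0 < c := by positivity
  set ε : ℝ := min (η * (γ / 2)) (c / 12) with hεdef
  have hε : 0 < ε := lt_min (by positivity) (by positivity)
  have hεη : ε ≤ η * (γ / 2) := min_le_left _ _
  have hεc : ε ≤ c / 12 := min_le_right _ _
  obtain ⟨N, ζ, v, kh, hζ, hcut, hkh0, hkhdep, hkhsum, hkhint, hkh⟩ :=
    hMAR.exists_grid_mechanism μ x hε
  obtain ⟨δ, hδ, hcard⟩ := exists_card_smallTieSets_le p (a := c / 8) (by positivity)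
  -- the probabilities of the quadrants, on the latent and on the observed scale
  set m : Fin p → Fin p → Bool × Bool → ℝ := fun j k q =>
    μ.real {y | quadrant v j k (fun l => ζ l (y l)) = q} with hm
  have hcellm : Measurable fun (y : Fin p → ℝ) l => ζ l (y l) := measurable_pi_lambda _ fun l =>
    (hζ l).measurable.comp (measurable_pi_apply l)
  have hmset : ∀ j k q, MeasurableSet {y : Fin p → ℝ | quadrant v j k (fun l => ζ l (y l)) = q} :=
    fun j k q => ((measurable_of_finite (quadrant v j k)).comp hcellm) (measurableSet_singleton q)
  have hbelow : ∀ l z, ζ l (copulaLink F z l) ≤ v l ↔ z l ≤ t l := fun l z => by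
    rw [← hcut]; exact hxt l (z l)
  have hmlat : ∀ S : Set (Fin p → ℝ), MeasurableSet S → ∀ T : Set (EuclideanSpace ℝ (Fin p)),
      (∀ z, copulaLink F z ∈ S ↔ z ∈ T) → μ.real S = (latentLaw C₀).real T := by
    intro S hS T hST
    rw [hμ, gaussianCopula, map_measureReal_apply (measurable_copulaLink F) hS]
    congr 1
    ext z
    exact hST z
  have hmTT : m j k (true, true) = (latentLaw C₀).real {z | z j ≤ t j ∧ z k ≤ t k} := by
    refine hmlat _ (hmset j k _) _ fun z => ?_
    show quadrant v j k _ = _ ↔ _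
    simp only [quadrant, Prod.mk.injEq, decide_eq_true_eq, hbelow]
    exact Iff.rfl
  have hmj : m j k (true, true) + m j k (true, false) = (gaussianReal 0 1).real (Set.Iic (t j)) := by
    rw [← latentLaw_coord_le C₀ j (t j)]
    simp only [hm]
    rw [← measureReal_union _ (hmset j k _)]
    · refine hmlat _ ((hmset j k _).union (hmset j k _)) _ fun z => ?_
      show quadrant v j k _ = _ ∨ quadrant v j k _ = _ ↔ z j ≤ t j
      simp only [quadrant, Prod.mk.injEq, decide_eq_true_eq, decide_eq_false_iff_not, hbelow]
      tauto
    · refine Set.disjoint_left.2 fun y h1 h2 => ?_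
      have : ((true, true) : Bool × Bool) = (true, false) := Eq.trans (Eq.symm h1) h2
      simp at this
  have hmk : m j k (true, true) + m j k (false, true) = (gaussianReal 0 1).real (Set.Iic (t k)) := by
    rw [← latentLaw_coord_le C₀ k (t k)]
    simp only [hm]
    rw [← measureReal_union _ (hmset j k _)]
    · refine hmlat _ ((hmset j k _).union (hmset j k _)) _ fun z => ?_
      show quadrant v j k _ = _ ∨ quadrant v j k _ = _ ↔ z k ≤ t k
      simp only [quadrant, Prod.mk.injEq, decide_eq_true_eq, decide_eq_false_iff_not, hbelow]
      tauto
    · refine Set.disjoint_left.2 fun y h1 h2 => ?_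
      have : ((true, true) : Bool × Bool) = (false, true) := Eq.trans (Eq.symm h1) h2
      simp at this
  have hmsum : ∑ q, m j k q = 1 := by
    have h := measureReal_biUnion_finset (μ := μ) (s := (Finset.univ : Finset (Bool × Bool)))
      (f := fun q => {y : Fin p → ℝ | quadrant v j k (fun l => ζ l (y l)) = q})
      (fun q _ q' _ hqq => Set.disjoint_left.2 fun y h1 h2 => hqq (Eq.trans (Eq.symm h1) h2))
      (fun q _ => hmset j k q)
    rw [← h]
    have : (⋃ q ∈ (Finset.univ : Finset (Bool × Bool)),
        {y : Fin p → ℝ | quadrant v j k (fun l => ζ l (y l)) = q}) = Set.univ := by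
      ext y; simp
    rw [this, probReal_univ]
  -- the typical rank structures, and those which favour `W`
  set G : (n : ℕ) → Finset (RankData p N n) := fun n => Finset.univ.filter fun s =>
    (∃ y, s = rankData ζ y ∧ ∀ l, (tieCount y l : ℝ) ≤ δ * n) ∧ EnoughCases kh η γ v m s.1 s.2.1
    with hG
  set B : (n : ℕ) → Finset (RankData p N n) := fun n => (G n).filter fun s =>
    ENNReal.ofReal (((n : ℝ) + 1)⁻¹) * averagedLikelihood prior
      (correlationCell n ⁻¹' {correlationCell n C₀}) s ≤ averagedLikelihood prior W s with hB
  set K : ℝ := 3 ^ (p * p) * 7 with hK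
  set D : ℕ := 11 * (p * p) + 3 + (N + 1) * p with hD
  set bound : ℕ → ℝ := fun n => K * (((n : ℝ) + 1) ^ D * Real.exp (-(c / 2 * n))) +
    ((2 * p + 4 * p ^ 2) * ((n : ℝ) + 1)⁻¹ ^ 2 + ((n : ℝ) + 1) ^ 0 * Real.exp (-(ε * n))) with hbound
  obtain ⟨n₀, hn₀⟩ := eventually_atTop.1 hprior
  have hprob : ∀ n, n₀ ≤ n → 0 < n → (Measure.pi fun _ : Fin n => μ ⊗ₘ κ) {y | rankData ζ y ∈ B n}
      ≤ ENNReal.ofReal (bound n) := by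
    intro n hn hn0
    have hcc : (0 : ℝ) < correlationCellCount p n := by
      unfold correlationCellCount; positivity
    have h := pi_rankData_mem_le_of_averagedLikelihood_le (n := n) prior F κ hζ hε hkh0 hkhdep
      hkhint (W := W) (a := ((correlationCellCount p n : ℝ))⁻¹ * (((n : ℝ) + 1) ^ 2)⁻¹)
      (b := ((n : ℝ) + 1)⁻¹) (by positivity) (by positivity) (hn₀ n hn) (B := B n)
      (fun s hs => (Finset.mem_filter.1 hs).2)
      (M := ((smallTieSets p n δ).card : ℝ) ^ 2 * ((n : ℝ) + 1) ^ ((N + 1) * p) *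
          (7 * Real.exp ((ε - γ ^ 2 * η / 4) * n)))
      (fun C hC => sum_patternWeight_mul_likelihood_le hn0 hζ hkh0 hkhdep hkhsum hη hη1 hγ hγ1 (B n)
        (fun s hs => (Finset.mem_filter.1 (Finset.mem_filter.1 hs).1).2.1)
        (fun s hs => (Finset.mem_filter.1 (Finset.mem_filter.1 hs).1).2.2)
        hmsum hmj hmk C (hγΔ.trans (by rw [hmTT]; exact hgap C hC)))
    refine h.trans ?_
    rw [← ENNReal.ofReal_add (by positivity) (by positivity)]
    refine ENNReal.ofReal_le_ofReal ?_
    simp only [hbound]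
    refine add_le_add ?_ (by simp)
    -- the rates: `2 ε` for the change of measure, `c / 4` for the ties, `ε - c` for the likelihood
    have hcard2 : ((smallTieSets p n δ).card : ℝ) ^ 2 ≤ Real.exp (c / 4 * n) := by
      calc ((smallTieSets p n δ).card : ℝ) ^ 2 ≤ (Real.exp (c / 8 * n)) ^ 2 := by
            gcongr; exact hcard n
        _ = Real.exp (c / 4 * n) := by
            rw [← Real.exp_nat_mul]; congr 1; push_cast; ring
    have hexp : Real.exp (2 * ε * n) * (Real.exp (c / 4 * n) *
        Real.exp ((ε - γ ^ 2 * η / 4) * n)) ≤ Real.exp (-(c / 2 * n)) := by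
      rw [← Real.exp_add, ← Real.exp_add, Real.exp_le_exp, ← hc]
      have h1 : 2 * ε + (c / 4 + (ε - c)) ≤ -(c / 2) := by linarith
      have h2 := mul_le_mul_of_nonneg_right h1 (Nat.cast_nonneg (α := ℝ) n)
      linarith
    calc _ = (correlationCellCount p n : ℝ) * (((n : ℝ) + 1) ^ 2 * ((n : ℝ) + 1) *
          ((n : ℝ) + 1) ^ ((N + 1) * p) * 7 * (Real.exp (2 * ε * n) *
            (((smallTieSets p n δ).card : ℝ) ^ 2 * Real.exp ((ε - γ ^ 2 * η / 4) * n)))) := by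
          rw [mul_inv, inv_inv, inv_inv, inv_inv]; ring
      _ ≤ (3 ^ (p * p) * ((n : ℝ) + 1) ^ (11 * (p * p))) * (((n : ℝ) + 1) ^ 2 * ((n : ℝ) + 1) *
          ((n : ℝ) + 1) ^ ((N + 1) * p) * 7 * Real.exp (-(c / 2 * n))) := by
          have h3 : Real.exp (2 * ε * n) *
              (((smallTieSets p n δ).card : ℝ) ^ 2 * Real.exp ((ε - γ ^ 2 * η / 4) * n))
              ≤ Real.exp (-(c / 2 * n)) := le_trans (by gcongr) hexp
          refine mul_le_mul (correlationCellCount_le p n) ?_ (by positivity) (by positivity)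
          gcongr
      _ = _ := by rw [hK, hD]; ring
  -- the rank structures which favour `W` occur finitely often
  have hBC : ∀ᵐ ω ∂(dataLaw C₀ F κ), ∀ᶠ n : ℕ in atTop,
      rankData ζ (fun i : Fin n => ω i) ∉ B n := by
    set E : ℕ → Set (ℕ → (Fin p → ℝ) × Pattern p) := fun n =>
      {ω | (n₀ ≤ n ∧ 0 < n) ∧ rankData ζ (fun i : Fin n => ω i) ∈ B n} with hE
    have hEle : ∀ n, dataLaw C₀ F κ (E n) ≤ ENNReal.ofReal (bound n) := by
      intro n
      by_cases hn : n₀ ≤ n ∧ 0 < n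
      · have hmeas : MeasurableSet {y : Fin n → (Fin p → ℝ) × Pattern p | rankData ζ y ∈ B n} :=
          measurable_rankData hζ (B n).measurableSet
        have h1 : dataLaw C₀ F κ (E n)
            = (Measure.pi fun _ : Fin n => μ ⊗ₘ κ) {y | rankData ζ y ∈ B n} := by
          rw [← map_infinitePi_fin, Measure.map_apply (by fun_prop) hmeas]
          unfold dataLaw
          congr 1
          ext ω
          simp only [hE, hn, and_self, true_and]
          exact Iff.rfl
        rw [h1]
        exact hprob n hn.1 hn.2
      · have : E n = ∅ := by
          ext ω; simp only [hE, hn, false_and]; exact Iff.rfl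
        rw [this, measure_empty]
        exact zero_le
    have hsum : Summable bound :=
      ((summable_poly_mul_exp_neg D (half_pos hc0)).mul_left K).add
        ((summable_sq_inv _).add (summable_poly_mul_exp_neg 0 hε))
    have htsum : ∑' n, dataLaw C₀ F κ (E n) ≠ ∞ :=
      ne_top_of_le_ne_top hsum.tsum_ofReal_ne_top (ENNReal.tsum_le_tsum hEle)
    filter_upwards [ae_eventually_notMem htsum] with ω hω
    filter_upwards [hω, eventually_ge_atTop n₀, eventually_gt_atTop 0] with n h1 h2 h3 h4
    exact h1 ⟨⟨h2, h3⟩, h4⟩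
  have hties : ∀ᵐ ω ∂(dataLaw C₀ F κ), ∀ l, ∀ᶠ n : ℕ in atTop,
      (tieCount (fun i : Fin n => ω i) l : ℝ) ≤ δ * n :=
    ae_all_iff.2 fun l => ae_eventually_card_repeated_le (μ ⊗ₘ κ)
      (f := fun a => a.1 l) (by fun_prop) hδ
  have hcases := ae_eventually_enoughCases μ κ hζ hη hγ hεη hκη hkh v m fun _ _ _ => rfl
  filter_upwards [hBC, hties, hcases] with ω h1 h2 h3
  filter_upwards [h1, eventually_all.2 h2, h3] with n hn1 hn2 hn3
  have hmemG : rankData ζ (fun i : Fin n => ω i) ∈ G n := by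
    refine Finset.mem_filter.2 ⟨Finset.mem_univ _, ⟨_, rfl, hn2⟩, fun j k q => ?_⟩
    refine (hn3 j k q).trans (le_of_eq (Finset.sum_congr rfl fun i _ => ?_))
    exact (caseTerm_maskCell kh η v j k q _ _).symm
  have hnot : ¬ (ENNReal.ofReal (((n : ℝ) + 1)⁻¹) * averagedLikelihood prior
      (correlationCell n ⁻¹' {correlationCell n C₀}) (rankData ζ fun i : Fin n => ω i)
      ≤ averagedLikelihood prior W (rankData ζ fun i : Fin n => ω i)) := fun h =>
    hn1 (Finset.mem_filter.2 ⟨hmemG, h⟩)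
  rw [averagedLikelihood_rankData, averagedLikelihood_rankData, not_le] at hnot
  refine hnot.trans_le ?_
  gcongr
  exact Measure.restrict_le_self

theorem exists_entries_close_subset {p : ℕ} {C₀ : CorrelationMatrix p}
    {A : Set (CorrelationMatrix p)} (hA : A ∈ 𝓝 C₀) :
    ∃ η > 0, ∀ C : CorrelationMatrix p, (∀ j k, |C.1 j k - C₀.1 j k| < η) → C ∈ A := by
  rw [show 𝓝 C₀ = comap (fun C : CorrelationMatrix p => C.1) (𝓝 C₀.1) from nhds_induced _ _,
    mem_comap] at hA
  obtain ⟨S, hS, hSA⟩ := hA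
  obtain ⟨η, hη, hball⟩ := Metric.mem_nhds_iff.1
    (show S ∈ @nhds (Fin p → Fin p → ℝ) _ C₀.1 from hS)
  refine ⟨η, hη, fun C hC => hSA (hball ?_)⟩
  show @dist (Fin p → Fin p → ℝ) _ C.1 C₀.1 < η
  exact (dist_pi_lt_iff hη).2 fun j => (dist_pi_lt_iff hη).2 fun k => hC j k

/-- If `A` has all but a proportion `b` of the averaged likelihood, which must be positive for the
posterior to be meaningful, then its posterior probability is at least `1 - b`. -/
theorem rankPosterior_apply_ge {p : ℕ} (prior : Measure (CorrelationMatrix p))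
    [IsProbabilityMeasure prior] (n : ℕ) (ω : ℕ → (Fin p → ℝ) × Pattern p)
    {A : Set (CorrelationMatrix p)} {b : ℝ≥0∞}
    (h0 : ∫⁻ C, rankLikelihood n ω C ∂prior ≠ 0)
    (hA : ∫⁻ C, rankLikelihood n ω C ∂prior
      ≤ ∫⁻ C in A, rankLikelihood n ω C ∂prior + b * ∫⁻ C, rankLikelihood n ω C ∂prior) :
    1 - b ≤ rankPosterior prior n ω A ∧ rankPosterior prior n ω A ≤ 1 := by
  set V := ∫⁻ C, rankLikelihood n ω C ∂prior with hV
  have hVt : V ≠ ∞ := by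
    refine ((lintegral_mono fun C => ?_).trans_lt (show ∫⁻ _, (1 : ℝ≥0∞) ∂prior < ∞ by simp)).ne
    exact prob_le_one
  have hpost : rankPosterior prior n ω A = V⁻¹ * ∫⁻ C in A, rankLikelihood n ω C ∂prior := by
    rw [rankPosterior, Measure.smul_apply, withDensity_apply' _ A, smul_eq_mul]
  rw [hpost]
  constructor
  · rw [tsub_le_iff_right]
    calc 1 = V⁻¹ * V := (ENNReal.inv_mul_cancel h0 hVt).symm
      _ ≤ V⁻¹ * (∫⁻ C in A, rankLikelihood n ω C ∂prior + b * V) := by gcongr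
      _ = V⁻¹ * ∫⁻ C in A, rankLikelihood n ω C ∂prior + b * (V⁻¹ * V) := by ring
      _ = _ := by rw [ENNReal.inv_mul_cancel h0 hVt, mul_one]
  · calc _ ≤ V⁻¹ * V := by gcongr; exact setLIntegral_le_lintegral _ _
      _ = 1 := ENNReal.inv_mul_cancel h0 hVt

theorem theorem3 (p : ℕ)
    (ν : Measure (CorrelationMatrix p))
    (dens : CorrelationMatrix p → ℝ) (hdens_meas : Measurable dens)
    (hdens_pos : ∀ᵐ C ∂ν, 0 < dens C)
    (prior : Measure (CorrelationMatrix p)) (hprior : IsProbabilityMeasure prior)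
    (hprior_dens : prior = ν.withDensity (fun C => ENNReal.ofReal (dens C)))
    (F : Fin p → Measure ℝ) (hF : ∀ j, IsProbabilityMeasure (F j))
    (hF_nondeg : ∀ j x, F j ≠ Measure.dirac x)
    (κ : Kernel (Fin p → ℝ) (Pattern p)) (hκ : IsMarkovKernel κ)
    (hMAR : MissingAtRandom κ) :
    ∀ᵐ C₀ ∂ν,
      (∀ᵐ y ∂(gaussianCopula C₀ F), 0 < κ y {fun _ => false}) →
      ∀ A ∈ 𝓝 C₀, ∀ᵐ ω ∂(dataLaw C₀ F κ),
        Tendsto (fun n => rankPosterior prior n ω A) atTop (𝓝 1) := by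
  -- the prior is equivalent to `ν`, as its density is positive
  have hac : ν ≪ prior := by
    rw [hprior_dens]
    refine withDensity_absolutelyContinuous' hdens_meas.ennreal_ofReal.aemeasurable ?_
    filter_upwards [hdens_pos] with C hC
    exact (ENNReal.ofReal_pos.2 hC).ne'
  filter_upwards [hac.ae_le (ae_eventually_le_measure_correlationCell prior)] with C₀ hC₀ hκ0 A hA
  obtain ⟨η, hη, hηA⟩ := exists_entries_close_subset hA
  set W : Fin p → Fin p → Set (CorrelationMatrix p) := fun j k =>
    {C | η ≤ |C.1 j k - C₀.1 j k|} with hW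
  have hcover : Set.univ ⊆ A ∪ ⋃ j, ⋃ k, W j k := by
    intro C _
    by_cases h : ∀ j k, |C.1 j k - C₀.1 j k| < η
    · exact Or.inl (hηA C h)
    · push Not at h
      obtain ⟨j, k, hjk⟩ := h
      exact Or.inr (Set.mem_iUnion.2 ⟨j, Set.mem_iUnion.2 ⟨k, hjk⟩⟩)
  have hneg : ∀ᵐ ω ∂(dataLaw C₀ F κ), ∀ j k, ∀ᶠ n : ℕ in atTop,
      ∫⁻ C in W j k, rankLikelihood n ω C ∂prior
        < ENNReal.ofReal (((n : ℝ) + 1)⁻¹) * ∫⁻ C, rankLikelihood n ω C ∂prior :=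
    ae_all_iff.2 fun j => ae_all_iff.2 fun k =>
      ae_eventually_averagedLikelihood_lt prior hF hF_nondeg hMAR hC₀ hκ0 j k hη
  filter_upwards [hneg] with ω hω
  have hev : ∀ᶠ n : ℕ in atTop,
      1 - (p : ℝ≥0∞) * (p * ENNReal.ofReal (((n : ℝ) + 1)⁻¹)) ≤ rankPosterior prior n ω A ∧
        rankPosterior prior n ω A ≤ 1 := by
    filter_upwards [eventually_all.2 fun j => eventually_all.2 (hω j)] with n hn
    refine rankPosterior_apply_ge prior n ω ?_ ?_
    · rcases isEmpty_or_nonempty (Fin p) with hp | ⟨⟨j⟩⟩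
      · -- without columns there is no constraint on the latent values
        have h1 : ∀ C, rankLikelihood n ω C = 1 := fun C => by
          have : rankEvent n ω = Set.univ := by
            ext z
            simp [rankEvent]
          rw [rankLikelihood, this, measure_univ]
        simp [h1]
      · intro h0
        have := hn j j
        rw [h0, mul_zero] at this
        exact not_lt_zero this
    · calc ∫⁻ C, rankLikelihood n ω C ∂prior
          ≤ ∫⁻ C in A ∪ ⋃ j, ⋃ k, W j k, rankLikelihood n ω C ∂prior := by
            rw [← setLIntegral_univ]
            exact lintegral_mono_set hcover
        _ ≤ ∫⁻ C in A, rankLikelihood n ω C ∂prior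
            + ∑ j, ∑ k, ∫⁻ C in W j k, rankLikelihood n ω C ∂prior := by
            refine (lintegral_union_le _ _ _).trans (add_le_add le_rfl ?_)
            refine (lintegral_iUnion_le _ _).trans ?_
            rw [tsum_fintype]
            refine Finset.sum_le_sum fun j _ => (lintegral_iUnion_le _ _).trans ?_
            rw [tsum_fintype]
        _ ≤ ∫⁻ C in A, rankLikelihood n ω C ∂prior
            + ∑ _j : Fin p, ∑ _k : Fin p, ENNReal.ofReal (((n : ℝ) + 1)⁻¹) *
              ∫⁻ C, rankLikelihood n ω C ∂prior := by
            gcongr with j _ k _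
            exact (hn j k).le
        _ = _ := by
            simp only [Finset.sum_const, Finset.card_univ, Fintype.card_fin, nsmul_eq_mul]
            ring
  have hlim : Tendsto (fun n : ℕ => 1 - (p : ℝ≥0∞) * (p * ENNReal.ofReal (((n : ℝ) + 1)⁻¹)))
      atTop (𝓝 1) := by
    have h1 : Tendsto (fun n : ℕ => ENNReal.ofReal (((n : ℝ) + 1)⁻¹)) atTop (𝓝 0) := by
      have := ENNReal.tendsto_ofReal (tendsto_one_div_add_atTop_nhds_zero_nat (𝕜 := ℝ))
      simpa using this
    have h2 : Tendsto (fun n : ℕ => (p : ℝ≥0∞) * (p * ENNReal.ofReal (((n : ℝ) + 1)⁻¹)))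
        atTop (𝓝 ((p : ℝ≥0∞) * (p * 0))) :=
      ENNReal.Tendsto.const_mul (ENNReal.Tendsto.const_mul h1
        (Or.inr (ENNReal.natCast_ne_top p))) (Or.inr (ENNReal.natCast_ne_top p))
    have h3 := ENNReal.Tendsto.sub (tendsto_const_nhds (x := (1 : ℝ≥0∞))) h2
      (Or.inl ENNReal.one_ne_top)
    simpa using h3
  exact tendsto_of_tendsto_of_tendsto_of_le_of_le' hlim tendsto_const_nhds
    (hev.mono fun n h => h.1) (hev.mono fun n h => h.2)
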